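/- **Conventions.** Manifolds are connected, Hausdorff, second countable, of class $C^4$, without boundary and of dimension at least $1$; pseudo-Riemannian metrics have arbitrary signature and are of class $C^3$; functions are of class $C^4$ unless stated otherwise. $\nabla^2$ and $\Delta$ denote the Hessian $(0,2)$-tensor and its metric trace, and $\mathrm{Ric}(X,Y)=\mathrm{trace}(V\mapsto R(V,X)Y)$ with $R(X,Y)Z=\nabla_X\nabla_YZ-\nabla_Y\nabla_XZ-\nabla_{[X,Y]}Z$. A metric is *Einstein* if $\mathrm{Ric}=\lambda g$ with a constant $\lambda$. A metric on an $n$-manifold has *normalized scalar curvature* $k$ (a function) if $\mathrm{Ric}=(n-1)k\,g$; for $n=2$, $k$ is the Gaussian curvature, and for $n=1$ this equation is void and $k$ may be chosen freely. A *warped product* with base $B$, fibre $F$ is a metric $g_B+\varphi^2g_F$ on $B\times F$ with $\varphi>0$ (or $\varphi\neq0$) a function on $B$. **Theorem.** Let $M$ and $M_*$ be manifolds of dimensions $n,n_*\ge1$ with $n+n_*\ge 3$. **Classification.** Let $\widetilde g$, $g_*$ be pseudo-Riemannian metrics on $M$, $M_*$ and let $f(y,x)$ be a non-constant, nowhere vanishing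 function on $M\times M_*$ such that $\overline g=f^{-2}(\widetilde g+g_*)$ is Einstein. Then one of the following holds. 1. $f$ depends only on one of the two factors, so that $\overline g$ is a warped product: if $f=\varphi(y)$ then $\overline g=\varphi^{-2}\widetilde g+(\varphi^{-1})^2g_*$ with fibre $(M_*,g_*)$, and if $f=\psi(x)$ then $\overline g=(\psi^{-1})^2\widetilde g+\psi^{-2}g_*$ with fibre $(M,\widetilde g)$. Moreover the fibre is Einstein. 2. $f(y,x)=a(y)+b(x)$ with non-constant functions $a$ on $M$ and $b$ on $M_*$ of class $C^4$, and there are functions $\widetilde k$ on $M$ and $k_*$ on $M_*$ with $$\mathrm{Ric}_{\widetilde g}=(n-1)\widetilde k\,\widetilde g,\quad \mathrm{Ric}_{g_*}=(n_*-1)k_*\,g_*,\quad \widetilde\nabla^2a=\tfrac{\widetilde\Delta a}{n}\,\widetilde g,\quad \nabla_*^2b=\tfrac{\Delta_*b}{n_*}\,g_*,$$ such that: * if $(n,n_*)\ne(2,2)$ (in particular if $n\ge3$ or $n_*\ge3$), then $\widetilde k$ and $k_*$ are constant, $\widetilde k=-k_*$, and for some constant $c$ one has $\widetilde\nabla^2a=(-\widetilde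 k a+c)\,\widetilde g$ and $\nabla_*^2b=(-k_*b+c)\,g_*$; in particular both factors are Einstein; * if $n=n_*=2$, then either the Gaussian curvatures $K=\widetilde k$ and $K_*=k_*$ are constant and $K=-K_*$, or both are non-constant, of class $C^2$, and satisfy $\widetilde\nabla^2K=\frac{\widetilde\Delta K}{2}\widetilde g$ and $\nabla_*^2K_*=\frac{\Delta_*K_*}{2}g_*$ (such metrics are called extremal). **Converse of 1.** Every warped product metric on $M\times M_*$ with positive warping function, with base $M$ or with base $M_*$ (in particular every Einstein one), is of the form $f^{-2}(g_1+g_2)$ with pseudo-Riemannian metrics $g_1$ on $M$, $g_2$ on $M_*$, where $f>0$ depends only on the base and the metric on the fibre is unchanged. **Converse of 2.** Let $\widetilde g,g_*$ satisfy $\mathrm{Ric}_{\widetilde g}=(n-1)\widetilde k\,\widetilde g$ and $\mathrm{Ric}_{g_*}=(n_*-1)k_*\,g_*$ with constants $\widetilde k=-k_*$, and let $a$ on $M$ and $b$ on $M_*$ be solutions of $\widetilde\nabla^2a=(-\widetilde k a+c)\widetilde g$ and $\nabla_*^2b=(-k_*b+c)g_*$ with the same constant $c$. If $a+b$ vanishes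 nowhere, then $\overline g=(a+b)^{-2}(\widetilde g+g_*)$ is a pseudo-Riemannian Einstein metric on $M\times M_*$. **Surfaces of non-constant curvature.** There are $C^\infty$ pseudo-Riemannian metrics $\widetilde g$, $g_*$ on $\mathbb R^2$, both of non-constant Gaussian curvature, and a nowhere vanishing $C^\infty$ function $f$ on $\mathbb R^2\times\mathbb R^2$ such that $f^{-2}(\widetilde g+g_*)$ is Einstein. There are no such compact examples, not even locally conformally: let $n=n_*=2$, let $M$ and $M_*$ be compact, and suppose that every point of $M\times M_*$ has a neighbourhood $U\times V$, with $U\subset M$ and $V\subset M_*$ open and connected, and a nowhere vanishing $C^4$ function $f$ on $U\times V$ that is neither a function on $U$ alone nor a function on $V$ alone, such that $f^{-2}(\widetilde g+g_*)$ is Einstein on $U\times V$. Then the Gaussian curvatures of $\widetilde g$ and of $g_*$ are both constant. -/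

import Mathlib

set_option maxSynthPendingDepth 3

open Set
open scoped Manifold ContDiff

/-! ### Tensor calculus in local coordinates

`E` is a finite-dimensional real vector space, `G : E → E →L[ℝ] E →L[ℝ] ℝ` is a field of symmetric
nondegenerate bilinear forms on an open subset of `E` (a pseudo-Riemannian metric read in a chart);
constant vectors of `E` play the role of the coordinate vector fields. -/

namespace LocalGeometry

noncomputable section

variable {E : Type*} [NormedAddCommGroup E] [NormedSpace ℝ E]

/-- Raising an index: the linear isomorphism `E* → E` inverse to `X ↦ G u X ·`. -/
def sharp (G : E → E →L[ℝ] E →L[ℝ] ℝ) (u : E) : (E →L[ℝ] ℝ) →L[ℝ] E :=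
  (G u).inverse

/-- Christoffel symbols of the first kind:
`(X, Y, Z) ↦ ½ (∂_X G(Y, Z) + ∂_Y G(X, Z) - ∂_Z G(X, Y))`. -/
def christoffelFirst (G : E → E →L[ℝ] E →L[ℝ] ℝ) (u : E) : E →L[ℝ] E →L[ℝ] E →L[ℝ] ℝ :=
  let D : E →L[ℝ] E →L[ℝ] E →L[ℝ] ℝ := fderiv ℝ G u
  let flip : (E →L[ℝ] E →L[ℝ] ℝ) →L[ℝ] (E →L[ℝ] E →L[ℝ] ℝ) :=
    (ContinuousLinearMap.flipₗᵢ ℝ E E ℝ).toContinuousLinearEquiv.toContinuousLinearMap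
  (1 / 2 : ℝ) • (D + D.flip - flip.comp D.flip)

theorem christoffelFirst_apply (G : E → E →L[ℝ] E →L[ℝ] ℝ) (u X Y Z : E) :
    christoffelFirst G u X Y Z =
      1 / 2 * (fderiv ℝ G u X Y Z + fderiv ℝ G u Y X Z - fderiv ℝ G u Z X Y) := by
  simp [christoffelFirst]

/-- The Levi-Civita connection in coordinates: `christoffel G u X Y = Γ(X, Y) = ∇_X Y` for constant
vector fields `X`, `Y`. -/
def christoffel (G : E → E →L[ℝ] E →L[ℝ] ℝ) (u : E) : E →L[ℝ] E →L[ℝ] E :=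
  (ContinuousLinearMap.compL ℝ E (E →L[ℝ] ℝ) E (sharp G u)).comp (christoffelFirst G u)

theorem christoffel_apply (G : E → E →L[ℝ] E →L[ℝ] ℝ) (u X Y : E) :
    christoffel G u X Y = sharp G u (christoffelFirst G u X Y) := rfl

/-- The curvature tensor `R(X, Y)Z = ∇_X ∇_Y Z - ∇_Y ∇_X Z` for constant vector fields. -/
def riemann (G : E → E →L[ℝ] E →L[ℝ] ℝ) (u X Y Z : E) : E :=
  fderiv ℝ (christoffel G) u X Y Z - fderiv ℝ (christoffel G) u Y X Z
    + christoffel G u X (christoffel G u Y Z) - christoffel G u Y (christoffel G u X Z)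

/-- The endomorphism `V ↦ R(V, X)Y`. -/
def ricciEndo (G : E → E →L[ℝ] E →L[ℝ] ℝ) (u X Y : E) : E →ₗ[ℝ] E where
  toFun V := riemann G u V X Y
  map_add' V W := by simp [riemann]; abel
  map_smul' c V := by simp [riemann, smul_sub, smul_add]

/-- The Ricci tensor `Ric(X, Y) = trace (V ↦ R(V, X)Y)`. -/
def ricci (G : E → E →L[ℝ] E →L[ℝ] ℝ) (u X Y : E) : ℝ :=
  LinearMap.trace ℝ E (ricciEndo G u X Y)

/-- The Hessian `∇²h(X, Y) = ∂_X ∂_Y h - dh(Γ(X, Y))`. -/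
def hessian (G : E → E →L[ℝ] E →L[ℝ] ℝ) (h : E → ℝ) (u : E) : E →L[ℝ] E →L[ℝ] ℝ :=
  fderiv ℝ (fderiv ℝ h) u -
    (ContinuousLinearMap.compL ℝ E E ℝ (fderiv ℝ h u)).comp (christoffel G u)

theorem hessian_apply (G : E → E →L[ℝ] E →L[ℝ] ℝ) (h : E → ℝ) (u X Y : E) :
    hessian G h u X Y =
      fderiv ℝ (fderiv ℝ h) u X Y - fderiv ℝ h u (christoffel G u X Y) := rfl

/-- The Laplacian: the metric trace of the Hessian. -/
def laplacian (G : E → E →L[ℝ] E →L[ℝ] ℝ) (h : E → ℝ) (u : E) : ℝ :=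
  LinearMap.trace ℝ E ((sharp G u).comp (hessian G h u) : E →L[ℝ] E)

end

end LocalGeometry

/-! ### Pseudo-Riemannian metrics on manifolds -/

noncomputable section

section

variable {E : Type*} [NormedAddCommGroup E] [NormedSpace ℝ E] {H : Type*} [TopologicalSpace H]
  {E' : Type*} [NormedAddCommGroup E'] [NormedSpace ℝ E'] {H' : Type*} [TopologicalSpace H']

/-- A field of bilinear forms on the tangent spaces of a manifold `M`, i.e. a `(0,2)`-tensor
field. -/
abbrev BilinField (I : ModelWithCorners ℝ E H) (M : Type*) [TopologicalSpace M]
    [ChartedSpace H M] : Type _ :=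
  ∀ p : M, TangentSpace I p →L[ℝ] TangentSpace I p →L[ℝ] ℝ

namespace BilinField

variable {I : ModelWithCorners ℝ E H} {M : Type*} [TopologicalSpace M] [ChartedSpace H M]
  {J : ModelWithCorners ℝ E' H'} {N : Type*} [TopologicalSpace N] [ChartedSpace H' N]

/-- The pullback `φ^* h`: `(φ^* h)_p (X, Y) = h_{φ p} (dφ_p X, dφ_p Y)`. -/
def pullback (I : ModelWithCorners ℝ E H) (φ : M → N) (h : BilinField J N) : BilinField I M :=
  fun p => (ContinuousLinearMap.precomp ℝ (mfderiv I J φ p)).comp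
    ((h (φ p)).comp (mfderiv I J φ p))

theorem pullback_apply (φ : M → N) (h : BilinField J N) (p : M) (X Y : TangentSpace I p) :
    pullback I φ h p X Y = h (φ p) (mfderiv I J φ p X) (mfderiv I J φ p Y) := rfl

/-- The coordinate expression of a tensor field in a chart `e`: its pullback under the
parametrization `e⁻¹`. It is meaningful on the coordinate domain `(e.extend I).target`. -/
def inChart (g : BilinField I M) (e : OpenPartialHomeomorph M H) : E → E →L[ℝ] E →L[ℝ] ℝ :=
  pullback 𝓘(ℝ, E) (e.extend I).symm g

theorem inChart_apply (g : BilinField I M) (e : OpenPartialHomeomorph M H) (u X Y : E) :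
    g.inChart e u X Y = g ((e.extend I).symm u)
      (mfderiv 𝓘(ℝ, E) I (e.extend I).symm u X) (mfderiv 𝓘(ℝ, E) I (e.extend I).symm u Y) := rfl

/-- `g` is a pseudo-Riemannian metric (of arbitrary signature) of class `C^r`. -/
structure IsPseudoRiemannian (r : WithTop ℕ∞) (g : BilinField I M) : Prop where
  symm : ∀ (p : M) (X Y : TangentSpace I p), g p X Y = g p Y X
  nondegenerate : ∀ (p : M) (X : TangentSpace I p), (∀ Y : TangentSpace I p, g p X Y = 0) → X = 0
  contDiffOn : ∀ e ∈ atlas H M, ContDiffOn ℝ r (g.inChart e) (e.extend I).target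

/-- `Ric = ρ g` at the points of `W`, in every chart of the atlas. -/
def RicciEqOn (g : BilinField I M) (ρ : M → ℝ) (W : Set M) : Prop :=
  ∀ e ∈ atlas H M, ∀ u ∈ (e.extend I).target, (e.extend I).symm u ∈ W → ∀ X Y : E,
    LocalGeometry.ricci (g.inChart e) u X Y = ρ ((e.extend I).symm u) * g.inChart e u X Y

/-- `Ric = ρ g` everywhere. -/
def RicciEq (g : BilinField I M) (ρ : M → ℝ) : Prop := g.RicciEqOn ρ univ

/-- `g` is Einstein on `W`: `Ric = λ g` on `W` with a constant `λ`. -/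
def IsEinsteinOn (g : BilinField I M) (W : Set M) : Prop :=
  ∃ lam : ℝ, g.RicciEqOn (fun _ => lam) W

/-- `g` is Einstein: `Ric = λ g` with a constant `λ`. -/
def IsEinstein (g : BilinField I M) : Prop := g.IsEinsteinOn univ

/-- `∇²h = σ g`, in every chart of the atlas. -/
def HessianEq (g : BilinField I M) (h : M → ℝ) (σ : M → ℝ) : Prop :=
  ∀ e ∈ atlas H M, ∀ u ∈ (e.extend I).target, ∀ X Y : E,
    LocalGeometry.hessian (g.inChart e) (h ∘ (e.extend I).symm) u X Y =
      σ ((e.extend I).symm u) * g.inChart e u X Y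

/-- The Laplacian `Δh` of a function on `M`, computed at `p` in the preferred chart at `p`. -/
def laplacian (g : BilinField I M) (h : M → ℝ) (p : M) : ℝ :=
  LocalGeometry.laplacian (g.inChart (chartAt H p)) (h ∘ ((chartAt H p).extend I).symm)
    ((chartAt H p).extend I p)

/-- The product metric `g + h = π₁^* g + π₂^* h` on `M × N`. -/
def prod (g : BilinField I M) (h : BilinField J N) : BilinField (I.prod J) (M × N) :=
  fun p => pullback (I.prod J) Prod.fst g p + pullback (I.prod J) Prod.snd h p

theorem prod_apply (g : BilinField I M) (h : BilinField J N) (p : M × N)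
    (X Y : TangentSpace (I.prod J) p) :
    g.prod h p X Y =
      g p.1 (mfderiv (I.prod J) I Prod.fst p X) (mfderiv (I.prod J) I Prod.fst p Y) +
      h p.2 (mfderiv (I.prod J) J Prod.snd p X) (mfderiv (I.prod J) J Prod.snd p Y) := rfl

/-- The metric `f⁻² (g + h)` on `M × N`. -/
def conformalProd (f : M × N → ℝ) (g : BilinField I M) (h : BilinField J N) :
    BilinField (I.prod J) (M × N) :=
  fun p => (f p ^ 2)⁻¹ • g.prod h p

/-- The warped product `g + φ² h` with base `(M, g)`, fibre `(N, h)` and warping function `φ` on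
`M`. -/
def warpedProdFst (g : BilinField I M) (φ : M → ℝ) (h : BilinField J N) :
    BilinField (I.prod J) (M × N) :=
  fun p => pullback (I.prod J) Prod.fst g p + (φ p.1 ^ 2) • pullback (I.prod J) Prod.snd h p

/-- The warped product `ψ² g + h` with base `(N, h)`, fibre `(M, g)` and warping function `ψ` on
`N`. -/
def warpedProdSnd (g : BilinField I M) (ψ : N → ℝ) (h : BilinField J N) :
    BilinField (I.prod J) (M × N) :=
  fun p => (ψ p.2 ^ 2) • pullback (I.prod J) Prod.fst g p + pullback (I.prod J) Prod.snd h p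

/-- The scaled field `u g` for a function `u` on `M`. -/
def scale (u : M → ℝ) (g : BilinField I M) : BilinField I M := fun p => u p • g p

/-- Near every point of `M × N` the metric `g + h` is conformal to an Einstein metric, by a
conformal factor that depends on both variables: every point has a neighbourhood `U × V`, with `U`
and `V` open and connected, on which there is a nowhere vanishing function `f` of class `C^r`,
neither a function of the first variable alone nor of the second variable alone, such that
`f⁻² (g + h)` is Einstein on `U × V`. -/
def IsLocallyConformallyEinsteinProd (r : WithTop ℕ∞) (g : BilinField I M)
    (h : BilinField J N) : Prop :=
  ∀ p : M × N, ∃ (U : Set M) (V : Set N), IsOpen U ∧ IsOpen V ∧ IsConnected U ∧ IsConnected V ∧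
    p.1 ∈ U ∧ p.2 ∈ V ∧ ∃ f : M × N → ℝ,
      ContMDiffOn (I.prod J) 𝓘(ℝ, ℝ) r f (U ×ˢ V) ∧ (∀ q ∈ U ×ˢ V, f q ≠ 0) ∧
      (∃ y ∈ U, ∃ y' ∈ U, ∃ x ∈ V, f (y, x) ≠ f (y', x)) ∧
      (∃ y ∈ U, ∃ x ∈ V, ∃ x' ∈ V, f (y, x) ≠ f (y, x')) ∧
      (conformalProd f g h).IsEinsteinOn (U ×ˢ V)

end BilinField

end

end

/-!
All tensor calculus is done in charts, for a field `G` of bilinear forms on an open subset of a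
vector space; `chartDom` and `BilinField.IsPseudoRiemannian.isMetricOn` pass from the manifold to a
chart. A factor found in one chart, as in `Ric = K g`, has to be shown to be independent of the
chart.

**Classification.** Under `G ↦ F⁻² G` in dimension `d` the Ricci tensor changes by `(d - 2) F⁻¹
∇²F` plus a multiple of `G` (`IsMetricOn.ricci_conformal`). If `f⁻² (g + h)` is Einstein and `d = n
+ m ≥ 3`, the mixed components of the Einstein equation say that the mixed second derivatives of
`f` vanish, hence `f = a + b` (`BilinField.RicciEqOn.eq_add`), and the remaining components are
`IsSplitEinstein`. If one summand is constant, the metric is a warped product and the equation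
along the fibre makes the fibre Einstein. Otherwise, comparing two values of `b` in the equation
along the first factor shows that `Ric` and `∇²a` are multiples of `g`; by symmetry the same holds
on the second factor. The factors then satisfy a functional equation whose only solutions are `K =
s a + t`, `L = s b + t'` with quadratic Hessian factors (`exists_affine_of_add_mul_eq`). The scalar
component of the Einstein equation involves `|∇a|²`, whose differential is twice the Hessian factor
times `da`; differentiating it at a point where `da ≠ 0`, and comparing two values of `b`, gives
`(n - 2) s = (m - 2) s = 0` and `(m - 1) t + (n - 1) t' = 0` (`IsSplitEinstein.slope_equations`,
`IsSplitEinstein.exists_structure`). So `s ≠ 0` is only possible for two surfaces, where the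
curvature is then a non-constant affine function of `a`.

**Converses and examples.** These are verified with the same formula, using that `|∇a|²` is a
quadratic polynomial in `a` when `∇²a` is an affine function of `a` times `g`
(`BilinField.isEinstein_conformalProd`). Two copies of `e^{-x} dx² + e^{3x} dy²`, of curvature `-3
e^x`, with `f = e^x + e^{x'}`, form an example with non-constant curvatures.

**Compact surfaces.** The local form of the classification shows that the curvature `K` of each
factor satisfies `∇²K = (C - K² / 2) g` with a constant `C` (`IsLocallyExtremal.exists_ricciEq`).
Such a function `u` on a closed connected surface is constant
(`BilinField.HessianEq.eq_of_compact`). If the Hessian vanishes at a maximum, then `u` is constant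
by a Gronwall argument. Otherwise the Hessian at the maximum is definite and so is the metric, at
that point and therefore everywhere; replacing `(g, u)` by `(-g, -u)` if necessary, it is positive
definite. Now `|∇u|²` is a cubic polynomial in `u` vanishing at the maximum and at the minimum, and
this cubic forces the Hessian factor at the minimum to be strictly smaller in absolute value than
at the maximum.

On a closed surface this is impossible (`IsConcircular.false_of_lt`). Where `∇u ≠ 0` the form `*du
/ |∇u|²` is closed (`fderiv_angularForm_symm`) and gives local coordinates `(u, φ)`, with `φ`
unique up to sign and additive constants. A small circle around the maximum is a closed curve along
which `φ` increases at a rate less than `1 / b`, where `b` is chosen strictly between the absolute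
values of the two factors. Moving it along the curves `φ = const`, it can be pushed to any level of
`u` (`IsHalfTranslationAtlas.exists_level_curve`), in particular to levels so close to the minimum
that, by compactness, it passes near a minimum point and then stays in a disc around it. There `φ`
has a rate of change close to the reciprocal of the Hessian factor relative to the polar angle, so
the curve would turn around the minimum at an angular velocity strictly between `0` and `1`. But
the mean angular velocity of a closed curve, parametrized by an interval of length `2π`, is an
integer (`exists_im_deriv_div_eq_intCast`).
-/

set_option linter.unusedSectionVars false

/-! ### The Levi-Civita connection in coordinates -/

namespace LocalGeometry

noncomputable section

variable {E : Type*} [NormedAddCommGroup E] [NormedSpace ℝ E]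

/-- `G` is a pseudo-Riemannian metric of class `C^3` on the open set `Ω` of a vector space. -/
structure IsMetricOn (G : E → E →L[ℝ] E →L[ℝ] ℝ) (Ω : Set E) : Prop where
  isOpen : IsOpen Ω
  contDiffOn : ContDiffOn ℝ 3 G Ω
  symm : ∀ u ∈ Ω, ∀ X Y, G u X Y = G u Y X
  nondegenerate : ∀ u ∈ Ω, ∀ X, (∀ Y, G u X Y = 0) → X = 0

theorem isInvertible_of_nondegenerate [FiniteDimensional ℝ E] {B : E →L[ℝ] E →L[ℝ] ℝ}
    (hB : ∀ X, (∀ Y, B X Y = 0) → X = 0) : B.IsInvertible := by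
  have hinj : Function.Injective (B : E →ₗ[ℝ] E →L[ℝ] ℝ) := by
    rw [injective_iff_map_eq_zero]
    exact fun X hX => hB X fun Y => by
      have := DFunLike.congr_fun hX Y
      simpa using this
  have hdim : Module.finrank ℝ E = Module.finrank ℝ (E →L[ℝ] ℝ) := by
    rw [← (LinearMap.toContinuousLinearMap (𝕜 := ℝ) (E := E) (F' := ℝ)).finrank_eq]
    exact (Subspace.dual_finrank_eq (K := ℝ) (V := E)).symm
  exact ⟨(LinearEquiv.ofInjectiveOfFinrankEq (B : E →ₗ[ℝ] E →L[ℝ] ℝ) hinj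
    hdim).toContinuousLinearEquiv, by ext; rfl⟩

namespace IsMetricOn

variable {G : E → E →L[ℝ] E →L[ℝ] ℝ} {Ω : Set E} (hG : IsMetricOn G Ω)

include hG

theorem contDiffAt {u : E} (hu : u ∈ Ω) : ContDiffAt ℝ 3 G u :=
  hG.contDiffOn.contDiffAt (hG.isOpen.mem_nhds hu)

theorem differentiableAt {u : E} (hu : u ∈ Ω) : DifferentiableAt ℝ G u :=
  (hG.contDiffAt hu).differentiableAt (by norm_num)

theorem hasFDerivAt_apply {u : E} (hu : u ∈ Ω) (Y Z : E) :
    HasFDerivAt (fun v => G v Y Z) (((fderiv ℝ G u).flip Y).flip Z) u := by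
  have h := (hG.differentiableAt hu).hasFDerivAt
  have h1 := (h.clm_apply (hasFDerivAt_const Y u)).clm_apply (hasFDerivAt_const Z u)
  refine h1.congr_fderiv ?_
  ext X; simp

theorem fderiv_symm {u : E} (hu : u ∈ Ω) (X Y Z : E) :
    fderiv ℝ G u X Y Z = fderiv ℝ G u X Z Y := by
  have h1 := hG.hasFDerivAt_apply hu Y Z
  have h2 := hG.hasFDerivAt_apply hu Z Y
  have h3 : (fun v => G v Y Z) =ᶠ[nhds u] fun v => G v Z Y := by
    filter_upwards [hG.isOpen.mem_nhds hu] with v hv using hG.symm v hv Y Z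
  have := (h2.congr_of_eventuallyEq h3).unique h1
  have := DFunLike.congr_fun this X
  simpa using this.symm

variable [FiniteDimensional ℝ E]

theorem isInvertible {u : E} (hu : u ∈ Ω) : (G u).IsInvertible :=
  isInvertible_of_nondegenerate (hG.nondegenerate u hu)

theorem apply_sharp {u : E} (hu : u ∈ Ω) (w : E →L[ℝ] ℝ) : G u (sharp G u w) = w :=
  (hG.isInvertible hu).self_apply_inverse w

omit [FiniteDimensional ℝ E] in
theorem ext_apply {u : E} (hu : u ∈ Ω) {X Y : E} (h : ∀ Z, G u X Z = G u Y Z) : X = Y := by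
  rw [← sub_eq_zero]
  exact hG.nondegenerate u hu _ fun Z => by simp [h Z]

theorem contDiffAt_sharp {u : E} (hu : u ∈ Ω) : ContDiffAt ℝ 3 (sharp G) u := by
  have := FiniteDimensional.complete ℝ E
  exact ((hG.isInvertible hu).contDiffAt_map_inverse).comp u (hG.contDiffAt hu)

omit [FiniteDimensional ℝ E] in
theorem contDiffAt_christoffelFirst {u : E} (hu : u ∈ Ω) :
    ContDiffAt ℝ 2 (christoffelFirst G) u := by
  have hD : ContDiffAt ℝ 2 (fderiv ℝ G) u :=
    (hG.contDiffAt hu).fderiv_right (by norm_num)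
  have hF : ContDiffAt ℝ 2 (fun v => (fderiv ℝ G v).flip) u :=
    (ContinuousLinearMap.flipₗᵢ ℝ E E (E →L[ℝ] ℝ)).toContinuousLinearEquiv.contDiff.contDiffAt.comp
      u hD
  unfold christoffelFirst
  refine ContDiffAt.const_smul _ ((hD.add hF).sub ?_)
  exact ContDiffAt.clm_comp (f := fun v => (fderiv ℝ G v).flip) contDiffAt_const hF

theorem contDiffAt_christoffel {u : E} (hu : u ∈ Ω) : ContDiffAt ℝ 2 (christoffel G) u := by
  have h1 : ContDiffAt ℝ 2 (sharp G) u := (hG.contDiffAt_sharp hu).of_le (by norm_num)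
  unfold christoffel
  exact ((ContinuousLinearMap.compL ℝ E (E →L[ℝ] ℝ) E).contDiff.contDiffAt.comp u h1).clm_comp
    (hG.contDiffAt_christoffelFirst hu)

theorem apply_christoffel {u : E} (hu : u ∈ Ω) (X Y Z : E) :
    G u (christoffel G u X Y) Z = christoffelFirst G u X Y Z := by
  rw [christoffel_apply, hG.apply_sharp hu]

theorem christoffel_symm {u : E} (hu : u ∈ Ω) (X Y : E) :
    christoffel G u X Y = christoffel G u Y X := by
  refine hG.ext_apply hu fun Z => ?_
  rw [hG.apply_christoffel hu, hG.apply_christoffel hu, christoffelFirst_apply,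
    christoffelFirst_apply, hG.fderiv_symm hu Z X Y]
  ring

/-- The Levi-Civita connection is metric. -/
theorem fderiv_apply {u : E} (hu : u ∈ Ω) (X Y Z : E) :
    fderiv ℝ G u X Y Z = G u (christoffel G u X Y) Z + G u Y (christoffel G u X Z) := by
  rw [hG.symm u hu Y, hG.apply_christoffel hu, hG.apply_christoffel hu, christoffelFirst_apply,
    christoffelFirst_apply, hG.fderiv_symm hu X Z Y, hG.fderiv_symm hu Z X Y]
  linarith [hG.fderiv_symm hu Y X Z]

theorem hasFDerivAt_christoffel_apply {u : E} (hu : u ∈ Ω) (Y Z : E) :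
    HasFDerivAt (fun v => christoffel G v Y Z) (((fderiv ℝ (christoffel G) u).flip Y).flip Z) u := by
  have h := ((hG.contDiffAt_christoffel hu).differentiableAt (by norm_num)).hasFDerivAt
  have h1 := (h.clm_apply (hasFDerivAt_const Y u)).clm_apply (hasFDerivAt_const Z u)
  refine h1.congr_fderiv ?_
  ext X; simp

theorem fderiv_christoffel_apply {u : E} (hu : u ∈ Ω) {Y Z : E} {D : E →L[ℝ] E}
    (hD : HasFDerivAt (fun v => christoffel G v Y Z) D u) (X : E) :
    fderiv ℝ (christoffel G) u X Y Z = D X := by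
  have := (hG.hasFDerivAt_christoffel_apply hu Y Z).unique hD
  rw [← this]; simp

/-- The Levi-Civita connection is characterized by the Koszul formula. -/
theorem christoffel_eq {u : E} (hu : u ∈ Ω) {X Y V : E}
    (h : ∀ Z, G u V Z = christoffelFirst G u X Y Z) : christoffel G u X Y = V :=
  hG.ext_apply hu fun Z => by rw [hG.apply_christoffel hu, h]

/-- The vector field `W` dual to a differentiable `1`-form `w` is differentiable, and `∇_X W` is dual to
`∇_X w`. -/
theorem hasFDerivAt_sharp {u : E} (hu : u ∈ Ω) {w : E → E →L[ℝ] ℝ} {w' : E →L[ℝ] E →L[ℝ] ℝ}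
    (hw : HasFDerivAt w w' u) :
    HasFDerivAt (fun v => sharp G v (w v))
      ((sharp G u).comp (w' - (ContinuousLinearMap.compL ℝ E E ℝ (w u)).comp (christoffel G u))
        - (christoffel G u).flip (sharp G u (w u))) u := by
  have hs : DifferentiableAt ℝ (fun v => sharp G v (w v)) u :=
    ((hG.contDiffAt_sharp hu).differentiableAt (by norm_num)).clm_apply hw.differentiableAt
  refine hs.hasFDerivAt.congr_fderiv ?_
  ext X
  refine hG.ext_apply hu fun Z => ?_
  have h1 := ((hG.differentiableAt hu).hasFDerivAt.clm_apply hs.hasFDerivAt).clm_apply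
    (hasFDerivAt_const Z u)
  have h2 := hw.clm_apply (hasFDerivAt_const Z u)
  have h3 : (fun v => w v Z) =ᶠ[nhds u] fun v => G v (sharp G v (w v)) Z := by
    filter_upwards [hG.isOpen.mem_nhds hu] with v hv
    rw [hG.apply_sharp hv]
  have h4 := DFunLike.congr_fun ((h2.congr_of_eventuallyEq h3.symm).unique h1) X
  simp [hG.apply_sharp hu] at h4 ⊢
  have h5 := hG.fderiv_apply hu X (sharp G u (w u)) Z
  rw [hG.apply_sharp hu] at h5
  linarith

end IsMetricOn

end

end LocalGeometry

/-! ### Conformal changes of the metric -/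

namespace LocalGeometry

noncomputable section

variable {E : Type*} [NormedAddCommGroup E] [NormedSpace ℝ E]

/-- The squared norm `G (∇h, ∇h)` of the gradient of `h`. -/
def gradSq (G : E → E →L[ℝ] E →L[ℝ] ℝ) (h : E → ℝ) (u : E) : ℝ :=
  fderiv ℝ h u (sharp G u (fderiv ℝ h u))

/-- The logarithmic differential `-dF / F` of the conformal factor `F⁻¹`. -/
def logDiff (F : E → ℝ) (u : E) : E →L[ℝ] ℝ := -((F u)⁻¹ • fderiv ℝ F u)

namespace IsMetricOn

variable {G : E → E →L[ℝ] E →L[ℝ] ℝ} {Ω : Set E} {F : E → ℝ}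

theorem conformal (hG : IsMetricOn G Ω) (hF : ContDiffOn ℝ 3 F Ω) (h0 : ∀ u ∈ Ω, F u ≠ 0) :
    IsMetricOn (fun u => (F u ^ 2)⁻¹ • G u) Ω where
  isOpen := hG.isOpen
  contDiffOn := ((hF.pow 2).inv fun u hu => pow_ne_zero 2 (h0 u hu)).smul hG.contDiffOn
  symm u hu X Y := by simp [hG.symm u hu X Y]
  nondegenerate u hu X h := by
    refine hG.nondegenerate u hu X fun Y => ?_
    have := h Y
    simpa [h0 u hu] using this

variable [FiniteDimensional ℝ E]

/-- The change of the Levi-Civita connection under a conformal change of the metric. -/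
theorem christoffel_conformal (hG : IsMetricOn G Ω) (hF : ContDiffOn ℝ 3 F Ω)
    (h0 : ∀ u ∈ Ω, F u ≠ 0) {u : E} (hu : u ∈ Ω) (X Y : E) :
    christoffel (fun u => (F u ^ 2)⁻¹ • G u) u X Y =
      christoffel G u X Y + logDiff F u X • Y + logDiff F u Y • X
        - G u X Y • sharp G u (logDiff F u) := by
  refine (hG.conformal hF h0).christoffel_eq hu fun Z => ?_
  have hFd : HasFDerivAt F (fderiv ℝ F u) u :=
    ((hF.contDiffAt (hG.isOpen.mem_nhds hu)).differentiableAt (by norm_num)).hasFDerivAt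
  have hGd := (hG.differentiableAt hu).hasFDerivAt
  have h := h0 u hu
  have hc : HasFDerivAt (fun v => (F v ^ 2)⁻¹) (-(2 * (F u)⁻¹ ^ 3) • fderiv ℝ F u) u := by
    have := (hasDerivAt_inv (pow_ne_zero 2 h)).comp_hasFDerivAt u (hFd.pow 2)
    refine this.congr_fderiv ?_
    ext X
    simp
    field_simp
  have hd : fderiv ℝ (fun u => (F u ^ 2)⁻¹ • G u) u = _ := (hc.smul hGd).fderiv
  have key := hG.apply_christoffel hu X Y Z
  rw [christoffelFirst_apply] at key ⊢
  rw [hd]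
  simp [hG.apply_sharp hu, key, logDiff]
  field_simp
  ring

omit [FiniteDimensional ℝ E] in
theorem hasFDerivAt_logDiff (hG : IsMetricOn G Ω) (hF : ContDiffOn ℝ 3 F Ω)
    (h0 : ∀ u ∈ Ω, F u ≠ 0) {u : E} (hu : u ∈ Ω) :
    HasFDerivAt (logDiff F) (((F u ^ 2)⁻¹ • (fderiv ℝ F u).smulRight (fderiv ℝ F u))
      - (F u)⁻¹ • fderiv ℝ (fderiv ℝ F) u) u := by
  have hFc := hF.contDiffAt (hG.isOpen.mem_nhds hu)
  have hFd : HasFDerivAt F (fderiv ℝ F u) u := (hFc.differentiableAt (by norm_num)).hasFDerivAt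
  have hFdd : HasFDerivAt (fderiv ℝ F) (fderiv ℝ (fderiv ℝ F) u) u :=
    ((hFc.fderiv_right (m := 2) (by norm_num)).differentiableAt (by norm_num)).hasFDerivAt
  have h := h0 u hu
  have hc := (hasDerivAt_inv h).comp_hasFDerivAt u hFd
  refine (hc.smul hFdd).neg.congr_fderiv ?_
  ext X Y
  simp
  ring

/-- The change of the curvature tensor under a conformal change of the metric; `D` is the covariant
derivative of the gradient `W` of the logarithm of the conformal factor. -/
theorem riemann_conformal (hG : IsMetricOn G Ω) (hF : ContDiffOn ℝ 3 F Ω)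
    (h0 : ∀ u ∈ Ω, F u ≠ 0) {u : E} (hu : u ∈ Ω) (X Y V : E) {w : E →L[ℝ] ℝ} {W : E}
    {D : E →L[ℝ] E} (hw : w = logDiff F u) (hW : W = sharp G u w)
    (hD : D = (sharp G u).comp ((((F u ^ 2)⁻¹ • (fderiv ℝ F u).smulRight (fderiv ℝ F u))
      - (F u)⁻¹ • hessian G F u))) :
    riemann (fun u => (F u ^ 2)⁻¹ • G u) u V X Y = riemann G u V X Y
      + G u (D V) Y • X - G u (D X) Y • V - G u X Y • D V + G u V Y • D X
      + (w V • (w X • Y + w Y • X - G u X Y • W)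
        + (2 * (w X * w Y) - G u X Y * w W) • V
        - (w X * G u V Y + w Y * G u V X - G u X Y * w V) • W)
      - (w X • (w V • Y + w Y • V - G u V Y • W)
        + (2 * (w V * w Y) - G u V Y * w W) • X
        - (w V * G u X Y + w Y * G u X V - G u V Y * w X) • W) := by
  have hG' := hG.conformal hF h0
  have hwd := hG.hasFDerivAt_logDiff hF h0 hu
  have hWd := hG.hasFDerivAt_sharp hu hwd
  have hsym : ∀ A B, fderiv ℝ (fderiv ℝ F) u A B = fderiv ℝ (fderiv ℝ F) u B A := by
    have hFc := hF.contDiffAt (hG.isOpen.mem_nhds hu)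
    exact hFc.isSymmSndFDerivAt (by simp; norm_num)
  have hev : ∀ Y Z, (fun v => christoffel (fun u => (F u ^ 2)⁻¹ • G u) v Y Z) =ᶠ[nhds u]
      fun v => christoffel G v Y Z + logDiff F v Y • Z + logDiff F v Z • Y
        - G v Y Z • sharp G v (logDiff F v) := fun Y Z => by
    filter_upwards [hG.isOpen.mem_nhds hu] with v hv
    exact hG.christoffel_conformal hF h0 hv Y Z
  have hder : ∀ X Y Z, fderiv ℝ (christoffel (fun u => (F u ^ 2)⁻¹ • G u)) u X Y Z = _ :=
    fun X Y Z => hG'.fderiv_christoffel_apply hu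
      (((((hG.hasFDerivAt_christoffel_apply hu Y Z).add
        ((hwd.clm_apply (hasFDerivAt_const Y u)).smul (hasFDerivAt_const Z u))).add
        ((hwd.clm_apply (hasFDerivAt_const Z u)).smul (hasFDerivAt_const Y u))).sub
        ((hG.hasFDerivAt_apply hu Y Z).smul hWd)).congr_of_eventuallyEq (hev Y Z)) X
  have hwF : ∀ A, fderiv ℝ F u A = -(F u * w A) := fun A => by
    have := h0 u hu
    rw [hw]; simp [logDiff]; field_simp
  have hDY : ∀ A B, G u (D A) B = (F u ^ 2)⁻¹ * (fderiv ℝ F u A * fderiv ℝ F u B)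
      - (F u)⁻¹ * (fderiv ℝ (fderiv ℝ F) u A B - fderiv ℝ F u (christoffel G u A B)) := by
    intro A B
    rw [hD, ContinuousLinearMap.comp_apply, hG.apply_sharp hu]
    simp [hessian_apply]
  have hDW : ∀ A, ((sharp G u).comp ((((F u ^ 2)⁻¹ • (fderiv ℝ F u).smulRight (fderiv ℝ F u))
      - (F u)⁻¹ • fderiv ℝ (fderiv ℝ F) u) - (ContinuousLinearMap.compL ℝ E E ℝ (w)).comp
        (christoffel G u))) A = D A := by
    intro A
    rw [hD]
    refine hG.ext_apply hu fun Z => ?_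
    simp only [ContinuousLinearMap.comp_apply, hG.apply_sharp hu]
    simp [hessian_apply, hw, logDiff]
    ring
  rw [riemann, riemann, hder, hder, hG.christoffel_conformal hF h0 hu, hG.christoffel_conformal hF h0 hu,
    hG.christoffel_conformal hF h0 hu, hG.christoffel_conformal hF h0 hu]
  rw [← hw, ← hW, hDY, hDY]
  have hGW : ∀ Z, G u Z W = w Z := fun Z => by rw [hG.symm u hu, hW, hG.apply_sharp hu]
  simp only [sub_apply, add_apply,
    ContinuousLinearMap.flip_apply, ContinuousLinearMap.smulRight_apply,
    smul_apply, hDW, map_add, map_sub, map_smul, hG.fderiv_apply hu,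
    hGW, zero_apply, ContinuousLinearMap.comp_apply]
  simp only [smul_eq_mul, hwF, hsym X V]
  have hGs := hG.symm u hu
  have hΓ := hG.christoffel_symm hu
  have hF1 : ∀ a b : ℝ, (F u ^ 2)⁻¹ * (-(F u * a) * -(F u * b)) = a * b := fun a b => by
    have := h0 u hu
    field_simp
  have hF2 : ∀ a b : ℝ, (F u)⁻¹ * (a - -(F u * b)) = (F u)⁻¹ * a + b := fun a b => by
    have := h0 u hu
    field_simp
    ring
  rw [hΓ X V, hGs X V]
  simp only [hF1, hF2, map_zero, smul_zero]
  module

/-- The change of the Ricci tensor under a conformal change of the metric. -/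
theorem ricci_conformal (hG : IsMetricOn G Ω) (hF : ContDiffOn ℝ 3 F Ω)
    (h0 : ∀ u ∈ Ω, F u ≠ 0) {u : E} (hu : u ∈ Ω) (X Y : E) :
    ricci (fun u => (F u ^ 2)⁻¹ • G u) u X Y = ricci G u X Y
      + (Module.finrank ℝ E - 2) / F u * hessian G F u X Y
      + (laplacian G F u / F u - (Module.finrank ℝ E - 1) * gradSq G F u / F u ^ 2) * G u X Y := by
  obtain ⟨w, hw⟩ : ∃ w, w = logDiff F u := ⟨_, rfl⟩
  obtain ⟨W, hW⟩ : ∃ W, W = sharp G u w := ⟨_, rfl⟩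
  obtain ⟨D, hD⟩ : ∃ D, D = (sharp G u).comp ((((F u ^ 2)⁻¹ • (fderiv ℝ F u).smulRight
      (fderiv ℝ F u)) - (F u)⁻¹ • hessian G F u)) := ⟨_, rfl⟩
  have hGW : ∀ Z, G u W Z = w Z := fun Z => by rw [hW, hG.apply_sharp hu]
  -- the terms added to `V ↦ R(V, X)Y` are multiples of `id`, of `D`, and rank one maps
  have hend : ricciEndo (fun u => (F u ^ 2)⁻¹ • G u) u X Y = ricciEndo G u X Y
      + ((((G u).flip Y).comp D : E →L[ℝ] ℝ) : E →ₗ[ℝ] ℝ).smulRight X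
      - (G u (D X) Y) • LinearMap.id - (G u X Y) • (D : E →ₗ[ℝ] E)
      + (((G u).flip Y : E →L[ℝ] ℝ) : E →ₗ[ℝ] ℝ).smulRight (D X)
      + ((w : E →ₗ[ℝ] ℝ).smulRight (w X • Y + w Y • X - G u X Y • W)
        + (2 * (w X * w Y) - G u X Y * w W) • LinearMap.id
        - (w X • (((G u).flip Y : E →L[ℝ] ℝ) : E →ₗ[ℝ] ℝ)
          + w Y • (((G u).flip X : E →L[ℝ] ℝ) : E →ₗ[ℝ] ℝ)
          - G u X Y • (w : E →ₗ[ℝ] ℝ)).smulRight W)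
      - (w X • ((w : E →ₗ[ℝ] ℝ).smulRight Y + w Y • LinearMap.id
          - (((G u).flip Y : E →L[ℝ] ℝ) : E →ₗ[ℝ] ℝ).smulRight W)
        + ((2 * w Y) • (w : E →ₗ[ℝ] ℝ)
          - w W • (((G u).flip Y : E →L[ℝ] ℝ) : E →ₗ[ℝ] ℝ)).smulRight X
        - (G u X Y • (w : E →ₗ[ℝ] ℝ) + w Y • (G u X : E →ₗ[ℝ] ℝ)
          - w X • (((G u).flip Y : E →L[ℝ] ℝ) : E →ₗ[ℝ] ℝ)).smulRight W) := by
    ext V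
    have := hG.riemann_conformal hF h0 hu X Y V hw hW hD
    change riemann (fun u => (F u ^ 2)⁻¹ • G u) u V X Y = _
    rw [this]
    simp [ricciEndo]
    module
  have htD : LinearMap.trace ℝ E (D : E →ₗ[ℝ] E) =
      gradSq G F u / F u ^ 2 - laplacian G F u / F u := by
    have : (D : E →ₗ[ℝ] E) = (F u ^ 2)⁻¹ • (fderiv ℝ F u : E →ₗ[ℝ] ℝ).smulRight
        (sharp G u (fderiv ℝ F u)) - (F u)⁻¹ • ((sharp G u).comp (hessian G F u) : E →L[ℝ] E) := by
      ext V; simp [hD]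
    rw [this]
    simp only [map_sub, map_smul, LinearMap.trace_smulRight]
    simp [gradSq, laplacian]
    ring
  have hDXY : G u (D X) Y = w X * w Y - (F u)⁻¹ * hessian G F u X Y := by
    rw [hD, ContinuousLinearMap.comp_apply, hG.apply_sharp hu]
    have := h0 u hu
    simp [hw, logDiff]
    field_simp
  have hwW : w W = gradSq G F u / F u ^ 2 := by
    have := h0 u hu
    simp [hW, hw, logDiff, gradSq]
    field_simp
  rw [ricci, hend]
  simp only [map_add, map_sub, map_smul, LinearMap.trace_smulRight, LinearMap.trace_id, htD,
    LinearMap.add_apply, LinearMap.sub_apply, LinearMap.smul_apply, ContinuousLinearMap.coe_coe,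
    ContinuousLinearMap.flip_apply, ContinuousLinearMap.comp_apply, hDXY, hGW, smul_eq_mul,
    hG.symm u hu X W]
  rw [ricci, hwW]
  ring

end IsMetricOn

end

end LocalGeometry

/-! ### Products of metrics -/

namespace LocalGeometry

noncomputable section

variable {E : Type*} [NormedAddCommGroup E] [NormedSpace ℝ E]
  {E' : Type*} [NormedAddCommGroup E'] [NormedSpace ℝ E']

/-- The product of two fields of bilinear forms. -/
def prodMetric (G : E → E →L[ℝ] E →L[ℝ] ℝ) (G' : E' → E' →L[ℝ] E' →L[ℝ] ℝ) (p : E × E') :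
    (E × E') →L[ℝ] (E × E') →L[ℝ] ℝ :=
  (ContinuousLinearMap.precomp ℝ (ContinuousLinearMap.fst ℝ E E')).comp
      ((G p.1).comp (ContinuousLinearMap.fst ℝ E E')) +
    (ContinuousLinearMap.precomp ℝ (ContinuousLinearMap.snd ℝ E E')).comp
      ((G' p.2).comp (ContinuousLinearMap.snd ℝ E E'))

theorem prodMetric_apply (G : E → E →L[ℝ] E →L[ℝ] ℝ) (G' : E' → E' →L[ℝ] E' →L[ℝ] ℝ)
    (p X Y : E × E') : prodMetric G G' p X Y = G p.1 X.1 Y.1 + G' p.2 X.2 Y.2 := rfl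

variable {G : E → E →L[ℝ] E →L[ℝ] ℝ} {G' : E' → E' →L[ℝ] E' →L[ℝ] ℝ} {Ω : Set E} {Ω' : Set E'}

theorem IsMetricOn.prod (hG : IsMetricOn G Ω) (hG' : IsMetricOn G' Ω') :
    IsMetricOn (prodMetric G G') (Ω ×ˢ Ω') where
  isOpen := hG.isOpen.prod hG'.isOpen
  contDiffOn := by
    have h1 : ContDiffOn ℝ 3 (fun p : E × E' => G p.1) (Ω ×ˢ Ω') :=
      hG.contDiffOn.comp contDiff_fst.contDiffOn fun p hp => hp.1
    have h2 : ContDiffOn ℝ 3 (fun p : E × E' => G' p.2) (Ω ×ˢ Ω') :=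
      hG'.contDiffOn.comp contDiff_snd.contDiffOn fun p hp => hp.2
    exact (contDiffOn_const.clm_comp (h1.clm_comp contDiffOn_const)).add
      (contDiffOn_const.clm_comp (h2.clm_comp contDiffOn_const))
  symm p hp X Y := by
    rw [prodMetric_apply, prodMetric_apply, hG.symm _ hp.1, hG'.symm _ hp.2]
  nondegenerate p hp X h := by
    refine Prod.ext (hG.nondegenerate _ hp.1 _ fun Y => ?_) (hG'.nondegenerate _ hp.2 _ fun Y => ?_)
    · simpa [prodMetric_apply] using h (Y, 0)
    · simpa [prodMetric_apply] using h (0, Y)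

variable [FiniteDimensional ℝ E] [FiniteDimensional ℝ E']

theorem IsMetricOn.sharp_prod (hG : IsMetricOn G Ω) (hG' : IsMetricOn G' Ω') {p : E × E'}
    (hp : p ∈ Ω ×ˢ Ω') (w : E × E' →L[ℝ] ℝ) :
    sharp (prodMetric G G') p w = (sharp G p.1 (w.comp (ContinuousLinearMap.inl ℝ E E')),
      sharp G' p.2 (w.comp (ContinuousLinearMap.inr ℝ E E'))) := by
  refine (hG.prod hG').ext_apply hp fun Z => ?_
  rw [(hG.prod hG').apply_sharp hp, prodMetric_apply, hG.apply_sharp hp.1, hG'.apply_sharp hp.2]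
  simp [← map_add]

omit [FiniteDimensional ℝ E] [FiniteDimensional ℝ E'] in
theorem IsMetricOn.fderiv_prod (hG : IsMetricOn G Ω) (hG' : IsMetricOn G' Ω') {p : E × E'}
    (hp : p ∈ Ω ×ˢ Ω') (X Y Z : E × E') :
    fderiv ℝ (prodMetric G G') p X Y Z =
      fderiv ℝ G p.1 X.1 Y.1 Z.1 + fderiv ℝ G' p.2 X.2 Y.2 Z.2 := by
  have h1 := ((hG.hasFDerivAt_apply hp.1 Y.1 Z.1).comp p hasFDerivAt_fst)
  have h2 := ((hG'.hasFDerivAt_apply hp.2 Y.2 Z.2).comp p hasFDerivAt_snd)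
  have h := ((hG.prod hG').hasFDerivAt_apply hp Y Z).unique (h1.add h2)
  simpa using DFunLike.congr_fun h X

theorem IsMetricOn.christoffel_prod (hG : IsMetricOn G Ω) (hG' : IsMetricOn G' Ω') {p : E × E'}
    (hp : p ∈ Ω ×ˢ Ω') (X Y : E × E') :
    christoffel (prodMetric G G') p X Y =
      (christoffel G p.1 X.1 Y.1, christoffel G' p.2 X.2 Y.2) := by
  refine (hG.prod hG').christoffel_eq hp fun Z => ?_
  rw [prodMetric_apply, hG.apply_christoffel hp.1, hG'.apply_christoffel hp.2]
  simp only [christoffelFirst_apply, hG.fderiv_prod hG' hp]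
  ring

theorem IsMetricOn.riemann_prod (hG : IsMetricOn G Ω) (hG' : IsMetricOn G' Ω') {p : E × E'}
    (hp : p ∈ Ω ×ˢ Ω') (X Y Z : E × E') :
    riemann (prodMetric G G') p X Y Z =
      (riemann G p.1 X.1 Y.1 Z.1, riemann G' p.2 X.2 Y.2 Z.2) := by
  have hder : ∀ X Y Z, fderiv ℝ (christoffel (prodMetric G G')) p X Y Z =
      (fderiv ℝ (christoffel G) p.1 X.1 Y.1 Z.1, fderiv ℝ (christoffel G') p.2 X.2 Y.2 Z.2) := by
    intro X Y Z
    have h1 := ((hG.hasFDerivAt_christoffel_apply hp.1 Y.1 Z.1).comp p hasFDerivAt_fst)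
    have h2 := ((hG'.hasFDerivAt_christoffel_apply hp.2 Y.2 Z.2).comp p hasFDerivAt_snd)
    have hev : (fun v => christoffel (prodMetric G G') v Y Z) =ᶠ[nhds p] fun v =>
        (christoffel G v.1 Y.1 Z.1, christoffel G' v.2 Y.2 Z.2) := by
      filter_upwards [(hG.prod hG').isOpen.mem_nhds hp] with v hv
      exact hG.christoffel_prod hG' hv Y Z
    rw [(hG.prod hG').fderiv_christoffel_apply hp ((h1.prodMk h2).congr_of_eventuallyEq hev)]
    simp
  simp only [riemann, hder, hG.christoffel_prod hG' hp]
  ext <;> simp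

theorem IsMetricOn.ricci_prod (hG : IsMetricOn G Ω) (hG' : IsMetricOn G' Ω') {p : E × E'}
    (hp : p ∈ Ω ×ˢ Ω') (X Y : E × E') :
    ricci (prodMetric G G') p X Y = ricci G p.1 X.1 Y.1 + ricci G' p.2 X.2 Y.2 := by
  have : ricciEndo (prodMetric G G') p X Y =
      (ricciEndo G p.1 X.1 Y.1).prodMap (ricciEndo G' p.2 X.2 Y.2) := by
    apply LinearMap.ext
    intro V
    exact hG.riemann_prod hG' hp V X Y
  rw [ricci, this, LinearMap.trace_prodMap']
  rfl

/-- The mixed components of the Hessian on a product are the mixed partial derivatives. -/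
theorem IsMetricOn.hessian_prod_mixed (hG : IsMetricOn G Ω) (hG' : IsMetricOn G' Ω') {p : E × E'}
    (hp : p ∈ Ω ×ˢ Ω') (F : E × E' → ℝ) (X : E) (Y : E') :
    hessian (prodMetric G G') F p (X, 0) (0, Y) = fderiv ℝ (fderiv ℝ F) p (X, 0) (0, Y) := by
  rw [hessian_apply, hG.christoffel_prod hG' hp]
  simp [← Prod.zero_eq_mk]

section Sum

variable {a : E → ℝ} {b : E' → ℝ}

omit [FiniteDimensional ℝ E] [FiniteDimensional ℝ E'] in
theorem fderiv_sum_prod {p : E × E'} (ha : DifferentiableAt ℝ a p.1)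
    (hb : DifferentiableAt ℝ b p.2) (X : E × E') :
    fderiv ℝ (fun q : E × E' => a q.1 + b q.2) p X = fderiv ℝ a p.1 X.1 + fderiv ℝ b p.2 X.2 := by
  have h := ((ha.hasFDerivAt.comp p hasFDerivAt_fst).add
    (hb.hasFDerivAt.comp p hasFDerivAt_snd)).fderiv
  have : (fun q : E × E' => a q.1 + b q.2) = (a ∘ Prod.fst) + (b ∘ Prod.snd) := rfl
  rw [this, h]
  simp

theorem IsMetricOn.hessian_sum_prod (hG : IsMetricOn G Ω) (hG' : IsMetricOn G' Ω')
    (ha : ContDiffOn ℝ 3 a Ω) (hb : ContDiffOn ℝ 3 b Ω') {p : E × E'}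
    (hp : p ∈ Ω ×ˢ Ω') (X Y : E × E') :
    hessian (prodMetric G G') (fun q : E × E' => a q.1 + b q.2) p X Y =
      hessian G a p.1 X.1 Y.1 + hessian G' b p.2 X.2 Y.2 := by
  have ha' : ∀ u ∈ Ω, ContDiffAt ℝ 3 a u := fun u hu => ha.contDiffAt (hG.isOpen.mem_nhds hu)
  have hb' : ∀ u ∈ Ω', ContDiffAt ℝ 3 b u := fun u hu => hb.contDiffAt (hG'.isOpen.mem_nhds hu)
  have hev : ∀ Y : E × E', (fun q => fderiv ℝ (fun q : E × E' => a q.1 + b q.2) q Y) =ᶠ[nhds p]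
      fun q => fderiv ℝ a q.1 Y.1 + fderiv ℝ b q.2 Y.2 := fun Y => by
    filter_upwards [(hG.prod hG').isOpen.mem_nhds hp] with v hv
    exact fderiv_sum_prod ((ha' _ hv.1).differentiableAt (by norm_num))
      ((hb' _ hv.2).differentiableAt (by norm_num)) Y
  have hsum : ContDiffAt ℝ 3 (fun q : E × E' => a q.1 + b q.2) p :=
    ((ha' _ hp.1).comp p contDiffAt_fst).add ((hb' _ hp.2).comp p contDiffAt_snd)
  have h0 := ((hsum.fderiv_right (m := 2) (by norm_num)).differentiableAt
    (by norm_num)).hasFDerivAt.clm_apply (hasFDerivAt_const Y p)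
  have h1 := ((((ha' _ hp.1).fderiv_right (m := 2) (by norm_num)).differentiableAt
    (by norm_num)).hasFDerivAt.comp p (hasFDerivAt_fst (𝕜 := ℝ))).clm_apply
      (hasFDerivAt_const Y.1 p)
  have h2 := ((((hb' _ hp.2).fderiv_right (m := 2) (by norm_num)).differentiableAt
    (by norm_num)).hasFDerivAt.comp p (hasFDerivAt_snd (𝕜 := ℝ))).clm_apply
      (hasFDerivAt_const Y.2 p)
  have h := DFunLike.congr_fun (h0.unique ((h1.add h2).congr_of_eventuallyEq (hev Y))) X
  simp at h
  rw [hessian_apply, h, hG.christoffel_prod hG' hp, fderiv_sum_prod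
    ((ha' _ hp.1).differentiableAt (by norm_num)) ((hb' _ hp.2).differentiableAt (by norm_num)),
    hessian_apply, hessian_apply]
  ring

theorem IsMetricOn.gradSq_sum_prod (hG : IsMetricOn G Ω) (hG' : IsMetricOn G' Ω')
    (ha : ContDiffOn ℝ 3 a Ω) (hb : ContDiffOn ℝ 3 b Ω') {p : E × E'} (hp : p ∈ Ω ×ˢ Ω') :
    gradSq (prodMetric G G') (fun q : E × E' => a q.1 + b q.2) p =
      gradSq G a p.1 + gradSq G' b p.2 := by
  have ha' := (ha.contDiffAt (hG.isOpen.mem_nhds hp.1)).differentiableAt (by norm_num)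
  have hb' := (hb.contDiffAt (hG'.isOpen.mem_nhds hp.2)).differentiableAt (by norm_num)
  have h1 : (fderiv ℝ (fun q : E × E' => a q.1 + b q.2) p).comp (ContinuousLinearMap.inl ℝ E E') =
      fderiv ℝ a p.1 := by ext X; simp [fderiv_sum_prod ha' hb']
  have h2 : (fderiv ℝ (fun q : E × E' => a q.1 + b q.2) p).comp (ContinuousLinearMap.inr ℝ E E') =
      fderiv ℝ b p.2 := by ext X; simp [fderiv_sum_prod ha' hb']
  rw [gradSq, hG.sharp_prod hG' hp, h1, h2, fderiv_sum_prod ha' hb']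
  rfl

theorem IsMetricOn.laplacian_sum_prod (hG : IsMetricOn G Ω) (hG' : IsMetricOn G' Ω')
    (ha : ContDiffOn ℝ 3 a Ω) (hb : ContDiffOn ℝ 3 b Ω') {p : E × E'} (hp : p ∈ Ω ×ˢ Ω') :
    laplacian (prodMetric G G') (fun q : E × E' => a q.1 + b q.2) p =
      laplacian G a p.1 + laplacian G' b p.2 := by
  have : ((sharp (prodMetric G G') p).comp (hessian (prodMetric G G')
      (fun q : E × E' => a q.1 + b q.2) p) : E × E' →L[ℝ] E × E').toLinearMap =
      (((sharp G p.1).comp (hessian G a p.1) : E →L[ℝ] E) : E →ₗ[ℝ] E).prodMap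
        ((sharp G' p.2).comp (hessian G' b p.2) : E' →L[ℝ] E') := by
    apply LinearMap.ext
    intro V
    refine (hG.prod hG').ext_apply hp fun Z => ?_
    simp only [ContinuousLinearMap.coe_coe, ContinuousLinearMap.comp_apply,
      LinearMap.prodMap_apply, prodMetric_apply, (hG.prod hG').apply_sharp hp,
      hG.apply_sharp hp.1, hG'.apply_sharp hp.2, hG.hessian_sum_prod hG' ha hb hp]
  rw [laplacian, this, LinearMap.trace_prodMap']
  rfl

end Sum

/-- If the Hessian is a multiple of the metric, the factor is determined by the Laplacian. -/
theorem IsMetricOn.laplacian_eq (hG : IsMetricOn G Ω) {a : E → ℝ} {u : E} (hu : u ∈ Ω) {σ : ℝ}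
    (h : ∀ X Y, hessian G a u X Y = σ * G u X Y) :
    laplacian G a u = Module.finrank ℝ E * σ := by
  have : ((sharp G u).comp (hessian G a u) : E →L[ℝ] E).toLinearMap = σ • LinearMap.id := by
    apply LinearMap.ext
    intro V
    refine hG.ext_apply hu fun Z => ?_
    simp only [ContinuousLinearMap.coe_coe, ContinuousLinearMap.comp_apply, hG.apply_sharp hu, h]
    simp
  rw [laplacian, this, map_smul, LinearMap.trace_id, smul_eq_mul, mul_comm]

/-- The derivative of the squared norm of a gradient when the Hessian is a multiple of the
metric. -/
theorem IsMetricOn.hasFDerivAt_gradSq (hG : IsMetricOn G Ω) {a : E → ℝ} {u : E} (hu : u ∈ Ω)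
    (ha : ContDiffAt ℝ 2 a u) {σ : ℝ} (h : ∀ X Y, hessian G a u X Y = σ * G u X Y) :
    HasFDerivAt (gradSq G a) ((2 * σ) • fderiv ℝ a u) u := by
  have hd := ((ha.fderiv_right (m := 1) (by norm_num)).differentiableAt (by norm_num)).hasFDerivAt
  have hs := hG.hasFDerivAt_sharp hu hd
  refine (hd.clm_apply hs).congr_fderiv ?_
  ext X
  have h1 : fderiv ℝ (fderiv ℝ a) u X (sharp G u (fderiv ℝ a u)) = σ * fderiv ℝ a u X +
      fderiv ℝ a u (christoffel G u X (sharp G u (fderiv ℝ a u))) := by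
    have := h X (sharp G u (fderiv ℝ a u))
    rw [hessian_apply, hG.symm u hu, hG.apply_sharp hu] at this
    linarith
  have h2 : sharp G u ((fderiv ℝ (fderiv ℝ a) u - (ContinuousLinearMap.compL ℝ E E ℝ
      (fderiv ℝ a u)).comp (christoffel G u)) X) = σ • X := by
    refine hG.ext_apply hu fun Z => ?_
    rw [hG.apply_sharp hu]
    rw [map_smul]
    exact h X Z
  simp only [add_apply, ContinuousLinearMap.flip_apply,
    ContinuousLinearMap.comp_apply, sub_apply (_ : E →L[ℝ] E), h1]
  rw [h2]
  simp
  ring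

end

end LocalGeometry

/-! ### Conformal changes of products -/

namespace LocalGeometry

noncomputable section

variable {E : Type*} [NormedAddCommGroup E] [NormedSpace ℝ E]
  {E' : Type*} [NormedAddCommGroup E'] [NormedSpace ℝ E']

theorem christoffel_congr {G₁ G₂ : E → E →L[ℝ] E →L[ℝ] ℝ} {u : E} (h : G₁ =ᶠ[nhds u] G₂) :
    christoffel G₁ u = christoffel G₂ u := by
  rw [christoffel, christoffel, sharp, sharp, christoffelFirst, christoffelFirst, h.fderiv_eq,
    h.eq_of_nhds]

/-- The Ricci tensor at a point depends only on the germ of the metric there. -/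
theorem ricci_congr {G₁ G₂ : E → E →L[ℝ] E →L[ℝ] ℝ} {u : E} (h : G₁ =ᶠ[nhds u] G₂) (X Y : E) :
    ricci G₁ u X Y = ricci G₂ u X Y := by
  have h1 : christoffel G₁ =ᶠ[nhds u] christoffel G₂ :=
    (eventually_eventually_nhds.2 h).mono fun v hv => christoffel_congr hv
  have : ricciEndo G₁ u X Y = ricciEndo G₂ u X Y := by
    apply LinearMap.ext
    intro V
    change riemann G₁ u V X Y = riemann G₂ u V X Y
    rw [riemann, riemann, h1.fderiv_eq, h1.eq_of_nhds]
  rw [ricci, ricci, this]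

theorem hessian_congr {G : E → E →L[ℝ] E →L[ℝ] ℝ} {a b : E → ℝ} {u : E} (h : a =ᶠ[nhds u] b) :
    hessian G a u = hessian G b u := by
  have h1 : fderiv ℝ a =ᶠ[nhds u] fderiv ℝ b :=
    (eventually_eventually_nhds.2 h).mono fun v hv => Filter.EventuallyEq.fderiv_eq hv
  rw [hessian, hessian, h1.fderiv_eq, h1.eq_of_nhds]

theorem gradSq_congr {G : E → E →L[ℝ] E →L[ℝ] ℝ} {a b : E → ℝ} {u : E} (h : a =ᶠ[nhds u] b) :
    gradSq G a u = gradSq G b u := by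
  rw [gradSq, gradSq, h.fderiv_eq]

variable {G : E → E →L[ℝ] E →L[ℝ] ℝ} {G' : E' → E' →L[ℝ] E' →L[ℝ] ℝ} {Ω : Set E} {Ω' : Set E'}
  [FiniteDimensional ℝ E] [FiniteDimensional ℝ E']

/-- If `F⁻² (G + G')` is Einstein, the mixed second derivatives of `F` vanish. -/
theorem IsMetricOn.fderiv_fderiv_mixed_eq_zero (hG : IsMetricOn G Ω) (hG' : IsMetricOn G' Ω')
    {F : E × E' → ℝ} (hF : ContDiffOn ℝ 3 F (Ω ×ˢ Ω')) (h0 : ∀ p ∈ Ω ×ˢ Ω', F p ≠ 0)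
    (hd : 3 ≤ Module.finrank ℝ E + Module.finrank ℝ E') {p : E × E'} (hp : p ∈ Ω ×ˢ Ω') {lam : ℝ}
    (hE : ∀ X Y, ricci (fun q => (F q ^ 2)⁻¹ • prodMetric G G' q) p X Y =
      lam * ((F p ^ 2)⁻¹ • prodMetric G G' p) X Y) (X : E) (Y : E') :
    fderiv ℝ (fderiv ℝ F) p (X, 0) (0, Y) = 0 := by
  have h := hE (X, 0) (0, Y)
  rw [(hG.prod hG').ricci_conformal hF h0 hp, hG.ricci_prod hG' hp,
    hG.hessian_prod_mixed hG' hp] at h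
  have hr1 : ricci G p.1 X 0 = 0 := by
    have : ricciEndo G p.1 X 0 = 0 := by
      apply LinearMap.ext
      intro V
      simp [ricciEndo, riemann]
    rw [ricci, this, map_zero]
  have hr2 : ricci G' p.2 0 Y = 0 := by
    have : ricciEndo G' p.2 0 Y = 0 := by
      apply LinearMap.ext
      intro V
      simp [ricciEndo, riemann]
    rw [ricci, this, map_zero]
  have hF0 := h0 p hp
  simp [prodMetric_apply, hr1, hr2, hF0] at h
  -- the coefficient `d - 2` of the Hessian, where `d` is the total dimension, is not zero
  refine h.resolve_left ?_
  have : (3 : ℝ) ≤ Module.finrank ℝ E + Module.finrank ℝ E' := by exact_mod_cast hd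
  linarith

/-- The Ricci tensor of `(a + b)⁻² (G + G')`. -/
theorem IsMetricOn.ricci_conformal_sum (hG : IsMetricOn G Ω) (hG' : IsMetricOn G' Ω')
    {a : E → ℝ} {b : E' → ℝ} (ha : ContDiffOn ℝ 3 a Ω) (hb : ContDiffOn ℝ 3 b Ω')
    {F : E × E' → ℝ} (hFab : ∀ p ∈ Ω ×ˢ Ω', F p = a p.1 + b p.2) (h0 : ∀ p ∈ Ω ×ˢ Ω', F p ≠ 0)
    {p : E × E'} (hp : p ∈ Ω ×ˢ Ω') (X Y : E × E') :
    ricci (fun q => (F q ^ 2)⁻¹ • prodMetric G G' q) p X Y =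
      ricci G p.1 X.1 Y.1 + ricci G' p.2 X.2 Y.2
      + (Module.finrank ℝ E + Module.finrank ℝ E' - 2) / F p *
        (hessian G a p.1 X.1 Y.1 + hessian G' b p.2 X.2 Y.2)
      + ((laplacian G a p.1 + laplacian G' b p.2) / F p
        - (Module.finrank ℝ E + Module.finrank ℝ E' - 1) * (gradSq G a p.1 + gradSq G' b p.2)
          / F p ^ 2) * (G p.1 X.1 Y.1 + G' p.2 X.2 Y.2) := by
  have hO := (hG.prod hG').isOpen
  have hev : (fun q => (F q ^ 2)⁻¹ • prodMetric G G' q) =ᶠ[nhds p]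
      fun q => ((a q.1 + b q.2) ^ 2)⁻¹ • prodMetric G G' q := by
    filter_upwards [hO.mem_nhds hp] with q hq
    rw [hFab q hq]
  have hc : ContDiffOn ℝ 3 (fun q : E × E' => a q.1 + b q.2) (Ω ×ˢ Ω') :=
    (ha.comp contDiff_fst.contDiffOn fun p hp => hp.1).add
      (hb.comp contDiff_snd.contDiffOn fun p hp => hp.2)
  rw [ricci_congr hev, (hG.prod hG').ricci_conformal hc (fun q hq => hFab q hq ▸ h0 q hq) hp,
    hG.ricci_prod hG' hp, hG.hessian_sum_prod hG' ha hb hp, hG.gradSq_sum_prod hG' ha hb hp,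
    hG.laplacian_sum_prod hG' ha hb hp, prodMetric_apply, hFab p hp]
  simp

end

end LocalGeometry

/-! ### Charts -/

noncomputable section Charts

variable {E : Type*} [NormedAddCommGroup E] [NormedSpace ℝ E]
  {M : Type*} [TopologicalSpace M] [ChartedSpace E M]
  {E' : Type*} [NormedAddCommGroup E'] [NormedSpace ℝ E']
  {N : Type*} [TopologicalSpace N] [ChartedSpace E' N]

/-- The part of the coordinate domain of the chart `e` that parametrizes points of `W`. -/
def chartDom (e : OpenPartialHomeomorph M E) (W : Set M) : Set E :=
  (e.extend 𝓘(ℝ, E)).target ∩ (e.extend 𝓘(ℝ, E)).symm ⁻¹' W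

omit [ChartedSpace E M] in
theorem extend_target_eq (e : OpenPartialHomeomorph M E) :
    (e.extend 𝓘(ℝ, E)).target = e.target := by
  simp

omit [ChartedSpace E M] in
theorem extend_symm_eq (e : OpenPartialHomeomorph M E) :
    ((e.extend 𝓘(ℝ, E)).symm : E → M) = e.symm := by
  ext u; simp

omit [ChartedSpace E M] in
theorem isOpen_extend_target (e : OpenPartialHomeomorph M E) :
    IsOpen (e.extend 𝓘(ℝ, E)).target := by
  rw [extend_target_eq]; exact e.open_target

omit [ChartedSpace E M] in
theorem chartDom_univ (e : OpenPartialHomeomorph M E) :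
    chartDom e univ = (e.extend 𝓘(ℝ, E)).target := by simp [chartDom]

omit [ChartedSpace E M] in
theorem isOpen_chartDom (e : OpenPartialHomeomorph M E) {W : Set M} (hW : IsOpen W) :
    IsOpen (chartDom e W) := by
  rw [chartDom, extend_target_eq, extend_symm_eq]
  exact e.symm.isOpen_inter_preimage hW

section

variable [IsManifold 𝓘(ℝ, E) 4 M]

theorem contMDiffOn_extend_symm_atlas {e : OpenPartialHomeomorph M E} (he : e ∈ atlas E M) :
    ContMDiffOn 𝓘(ℝ, E) 𝓘(ℝ, E) 4 (e.extend 𝓘(ℝ, E)).symm (e.extend 𝓘(ℝ, E)).target := by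
  rw [extend_target_eq, extend_symm_eq]
  exact contMDiffOn_symm_of_mem_maximalAtlas (IsManifold.subset_maximalAtlas he)

theorem mdifferentiableAt_extend_symm {e : OpenPartialHomeomorph M E} (he : e ∈ atlas E M)
    {u : E} (hu : u ∈ (e.extend 𝓘(ℝ, E)).target) :
    MDifferentiableAt 𝓘(ℝ, E) 𝓘(ℝ, E) (e.extend 𝓘(ℝ, E)).symm u :=
  ((contMDiffOn_extend_symm_atlas he).contMDiffAt
    ((isOpen_extend_target e).mem_nhds hu)).mdifferentiableAt (by norm_num)

theorem isInvertible_mfderiv_extend_symm {e : OpenPartialHomeomorph M E} (he : e ∈ atlas E M)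
    {u : E} (hu : u ∈ (e.extend 𝓘(ℝ, E)).target) :
    (mfderiv 𝓘(ℝ, E) 𝓘(ℝ, E) (e.extend 𝓘(ℝ, E)).symm u).IsInvertible := by
  rw [extend_target_eq] at hu
  rw [extend_symm_eq]
  have : IsManifold 𝓘(ℝ, E) 1 M := IsManifold.of_le (n := 4) (by norm_num)
  have h := (mdifferentiable_of_mem_atlas (I := 𝓘(ℝ, E)) he)
  exact ⟨h.symm.mfderiv (x := u) hu, rfl⟩

theorem ContMDiffOn.contDiffOn_chart {r : WithTop ℕ∞} (hr : r ≤ 4) {φ : M → ℝ} {W : Set M}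
    (hφ : ContMDiffOn 𝓘(ℝ, E) 𝓘(ℝ, ℝ) r φ W) {e : OpenPartialHomeomorph M E}
    (he : e ∈ atlas E M) :
    ContDiffOn ℝ r (φ ∘ (e.extend 𝓘(ℝ, E)).symm) (chartDom e W) := by
  rw [← contMDiffOn_iff_contDiffOn]
  exact hφ.comp ((contMDiffOn_extend_symm_atlas he).of_le hr |>.mono inter_subset_left)
    inter_subset_right

theorem BilinField.IsPseudoRiemannian.isMetricOn [FiniteDimensional ℝ E]
    {g : BilinField 𝓘(ℝ, E) M} (hg : g.IsPseudoRiemannian 3) {e : OpenPartialHomeomorph M E}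
    (he : e ∈ atlas E M) {W : Set M} (hW : IsOpen W) :
    LocalGeometry.IsMetricOn (g.inChart e) (chartDom e W) where
  isOpen := isOpen_chartDom e hW
  contDiffOn := (hg.contDiffOn e he).mono inter_subset_left
  symm u hu X Y := by rw [BilinField.inChart_apply, BilinField.inChart_apply, hg.symm]
  nondegenerate u hu X h := by
    have hi := isInvertible_mfderiv_extend_symm he hu.1
    have h0 : mfderiv 𝓘(ℝ, E) 𝓘(ℝ, E) (e.extend 𝓘(ℝ, E)).symm u X = 0 := by
      refine hg.nondegenerate _ _ fun Y => ?_
      obtain ⟨Z, rfl⟩ := hi.surjective Y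
      exact h Z
    exact hi.injective (h0.trans (map_zero _).symm)

end

section Product

omit [ChartedSpace E M] [ChartedSpace E' N] in
theorem mem_extend_prod_target {e : OpenPartialHomeomorph M E} {e' : OpenPartialHomeomorph N E'}
    {p : E × E'} : p ∈ ((e.prod e').extend (𝓘(ℝ, E).prod 𝓘(ℝ, E'))).target ↔
      p.1 ∈ (e.extend 𝓘(ℝ, E)).target ∧ p.2 ∈ (e'.extend 𝓘(ℝ, E')).target := by
  simp

omit [ChartedSpace E M] [ChartedSpace E' N] in
theorem extend_prod_symm_apply (e : OpenPartialHomeomorph M E) (e' : OpenPartialHomeomorph N E')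
    (p : E × E') : ((e.prod e').extend (𝓘(ℝ, E).prod 𝓘(ℝ, E'))).symm p =
      ((e.extend 𝓘(ℝ, E)).symm p.1, (e'.extend 𝓘(ℝ, E')).symm p.2) := by
  simp

variable [IsManifold 𝓘(ℝ, E) 4 M] [IsManifold 𝓘(ℝ, E') 4 N]

theorem BilinField.inChart_conformalProd (g : BilinField 𝓘(ℝ, E) M) (h : BilinField 𝓘(ℝ, E') N)
    (f : M × N → ℝ) {e : OpenPartialHomeomorph M E} {e' : OpenPartialHomeomorph N E'}
    (he : e ∈ atlas E M) (he' : e' ∈ atlas E' N) {p : E × E'}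
    (hp : p.1 ∈ (e.extend 𝓘(ℝ, E)).target ∧ p.2 ∈ (e'.extend 𝓘(ℝ, E')).target) :
    (BilinField.conformalProd f g h).inChart (e.prod e') p =
      (f ((e.extend 𝓘(ℝ, E)).symm p.1, (e'.extend 𝓘(ℝ, E')).symm p.2) ^ 2)⁻¹ •
        LocalGeometry.prodMetric (g.inChart e) (h.inChart e') p := by
  have hs := mdifferentiableAt_extend_symm he hp.1
  have hs' := mdifferentiableAt_extend_symm he' hp.2
  have hS : (((e.prod e').extend (𝓘(ℝ, E).prod 𝓘(ℝ, E'))).symm : E × E' → M × N) = fun q =>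
      ((e.extend 𝓘(ℝ, E)).symm q.1, (e'.extend 𝓘(ℝ, E')).symm q.2) :=
    funext (extend_prod_symm_apply e e')
  have h1 : HasMFDerivAt 𝓘(ℝ, E × E') 𝓘(ℝ, E)
      (fun q : E × E' => (e.extend 𝓘(ℝ, E)).symm q.1) p
      ((mfderiv 𝓘(ℝ, E) 𝓘(ℝ, E) (e.extend 𝓘(ℝ, E)).symm p.1).comp
        (ContinuousLinearMap.fst ℝ E E')) :=
    hs.hasMFDerivAt.comp p (hasFDerivAt_fst.hasMFDerivAt)
  have h2 : HasMFDerivAt 𝓘(ℝ, E × E') 𝓘(ℝ, E')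
      (fun q : E × E' => (e'.extend 𝓘(ℝ, E')).symm q.2) p
      ((mfderiv 𝓘(ℝ, E') 𝓘(ℝ, E') (e'.extend 𝓘(ℝ, E')).symm p.2).comp
        (ContinuousLinearMap.snd ℝ E E')) :=
    hs'.hasMFDerivAt.comp p (hasFDerivAt_snd.hasMFDerivAt)
  refine ContinuousLinearMap.ext fun X => ContinuousLinearMap.ext fun Y => ?_
  rw [BilinField.inChart_apply, hS]
  have h3 := (h1.prodMk h2).mfderiv
  rw [h3]
  have h4 : mfderiv (𝓘(ℝ, E).prod 𝓘(ℝ, E')) 𝓘(ℝ, E) (Prod.fst : M × N → M)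
      ((e.extend 𝓘(ℝ, E)).symm p.1, (e'.extend 𝓘(ℝ, E')).symm p.2) = _ := mfderiv_fst
  have h5 : mfderiv (𝓘(ℝ, E).prod 𝓘(ℝ, E')) 𝓘(ℝ, E') (Prod.snd : M × N → N)
      ((e.extend 𝓘(ℝ, E)).symm p.1, (e'.extend 𝓘(ℝ, E')).symm p.2) = _ := mfderiv_snd
  change (f _ ^ 2)⁻¹ * (BilinField.prod g h _ _ _) = (f _ ^ 2)⁻¹ * LocalGeometry.prodMetric _ _ _ _ _
  rw [BilinField.prod_apply, LocalGeometry.prodMetric_apply, BilinField.inChart_apply,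
    BilinField.inChart_apply, h4, h5]
  rfl

end Product

end Charts

/-! ### Splitting of the conformal factor -/

noncomputable section Split

variable {E : Type*} [NormedAddCommGroup E] [NormedSpace ℝ E]
  {M : Type*} [TopologicalSpace M] [ChartedSpace E M]
  {E' : Type*} [NormedAddCommGroup E'] [NormedSpace ℝ E']
  {N : Type*} [TopologicalSpace N] [ChartedSpace E' N]

theorem chartAt_mem_chartDom {W : Set M} {p : M} (hp : p ∈ W) :
    (chartAt E p).extend 𝓘(ℝ, E) p ∈ chartDom (chartAt E p) W := by
  have h := mem_chart_source E p
  refine ⟨?_, ?_⟩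
  · rw [extend_target_eq]; simp
  · rw [mem_preimage, extend_symm_eq]; simpa [(chartAt E p).left_inv h] using hp

theorem extend_symm_chartAt (p : M) :
    ((chartAt E p).extend 𝓘(ℝ, E)).symm ((chartAt E p).extend 𝓘(ℝ, E) p) = p := by
  rw [extend_symm_eq]; simp

/-- A function all of whose coordinate differentials vanish on a connected open set is constant
there. -/
theorem eq_of_hasFDerivAt_chart_zero {φ : M → ℝ} {W : Set M} (hW : IsOpen W)
    (hWc : IsPreconnected W)
    (h : ∀ e ∈ atlas E M, ∀ u ∈ chartDom e W,
      HasFDerivAt (φ ∘ (e.extend 𝓘(ℝ, E)).symm) (0 : E →L[ℝ] ℝ) u)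
    {p q : M} (hp : p ∈ W) (hq : q ∈ W) : φ p = φ q := by
  have hloc : ∀ p ∈ W, ∀ᶠ y in nhds p, φ y = φ p := by
    intro p hp
    have he := chart_mem_atlas E p
    obtain ⟨r, hr, hball⟩ := Metric.isOpen_iff.1 (isOpen_chartDom (chartAt E p) hW) _
      (chartAt_mem_chartDom hp)
    have hc : ∀ u ∈ Metric.ball ((chartAt E p).extend 𝓘(ℝ, E) p) r,
        (φ ∘ ((chartAt E p).extend 𝓘(ℝ, E)).symm) u =
          (φ ∘ ((chartAt E p).extend 𝓘(ℝ, E)).symm) ((chartAt E p).extend 𝓘(ℝ, E) p) := by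
      intro u hu
      refine (convex_ball _ _).is_const_of_fderivWithin_eq_zero (𝕜 := ℝ)
        (fun v hv => ((h _ he v (hball hv)).differentiableAt).differentiableWithinAt) ?_ hu
        (Metric.mem_ball_self hr)
      intro v hv
      rw [fderivWithin_of_isOpen Metric.isOpen_ball hv, (h _ he v (hball hv)).fderiv]
    have hcont : ContinuousAt (chartAt E p) p :=
      (chartAt E p).continuousAt (mem_chart_source E p)
    filter_upwards [(chartAt E p).open_source.mem_nhds (mem_chart_source E p),
      hcont.preimage_mem_nhds (Metric.ball_mem_nhds _ hr)] with y hy1 hy2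
    have := hc (chartAt E p y) (by simpa using hy2)
    simpa [extend_symm_eq, (chartAt E p).left_inv hy1,
      (chartAt E p).left_inv (mem_chart_source E p)] using this
  have : PreconnectedSpace W := isPreconnected_iff_preconnectedSpace.1 hWc
  have hlc : IsLocallyConstant (fun y : W => φ y) := by
    rw [IsLocallyConstant.iff_eventually_eq]
    exact fun y => continuous_subtype_val.continuousAt.eventually (hloc y y.2)
  exact hlc.apply_eq_of_isPreconnected isPreconnected_univ (mem_univ ⟨p, hp⟩) (mem_univ ⟨q, hq⟩)

variable [FiniteDimensional ℝ E] [FiniteDimensional ℝ E']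
  [IsManifold 𝓘(ℝ, E) 4 M] [IsManifold 𝓘(ℝ, E') 4 N]

omit [NormedSpace ℝ E] [NormedSpace ℝ E'] [FiniteDimensional ℝ E] [FiniteDimensional ℝ E']
  [IsManifold 𝓘(ℝ, E) 4 M] [IsManifold 𝓘(ℝ, E') 4 N] in
theorem mem_atlas_prod {e : OpenPartialHomeomorph M E} {e' : OpenPartialHomeomorph N E'}
    (he : e ∈ atlas E M) (he' : e' ∈ atlas E' N) :
    e.prod e' ∈ atlas (ModelProd E E') (M × N) :=
  mem_image2_of_mem he he'

omit [FiniteDimensional ℝ E] [FiniteDimensional ℝ E'] in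
/-- The Einstein equation for `f⁻² (g + h)` in a product chart. -/
theorem BilinField.RicciEqOn.prodMetric {g : BilinField 𝓘(ℝ, E) M} {h : BilinField 𝓘(ℝ, E') N}
    {f : M × N → ℝ} {ρ : M × N → ℝ} {U : Set M} {V : Set N}
    (hE : (BilinField.conformalProd f g h).RicciEqOn ρ (U ×ˢ V))
    {e : OpenPartialHomeomorph M E} {e' : OpenPartialHomeomorph N E'}
    (he : e ∈ atlas E M) (he' : e' ∈ atlas E' N) {p : E × E'}
    (hp : p ∈ chartDom e U ×ˢ chartDom e' V) (X Y : E × E') :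
    LocalGeometry.ricci (fun q : E × E' =>
      (f ((e.extend 𝓘(ℝ, E)).symm q.1, (e'.extend 𝓘(ℝ, E')).symm q.2) ^ 2)⁻¹ •
        LocalGeometry.prodMetric (g.inChart e) (h.inChart e') q) p X Y =
      ρ ((e.extend 𝓘(ℝ, E)).symm p.1, (e'.extend 𝓘(ℝ, E')).symm p.2) *
      ((f ((e.extend 𝓘(ℝ, E)).symm p.1, (e'.extend 𝓘(ℝ, E')).symm p.2) ^ 2)⁻¹ •
        LocalGeometry.prodMetric (g.inChart e) (h.inChart e') p) X Y := by
  have hp' : p.1 ∈ (e.extend 𝓘(ℝ, E)).target ∧ p.2 ∈ (e'.extend 𝓘(ℝ, E')).target :=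
    ⟨hp.1.1, hp.2.1⟩
  have h1 := hE (e.prod e') (mem_atlas_prod he he') p (mem_extend_prod_target.2 hp')
    (by rw [extend_prod_symm_apply]; exact ⟨hp.1.2, hp.2.2⟩) X Y
  rw [extend_prod_symm_apply, BilinField.inChart_conformalProd g h f he he' hp'] at h1
  rw [← h1]
  refine LocalGeometry.ricci_congr ?_ X Y
  filter_upwards [((isOpen_extend_target e).prod (isOpen_extend_target e')).mem_nhds
    (show p ∈ _ ×ˢ _ from hp')] with q hq
  rw [BilinField.inChart_conformalProd g h f he he' hq]

omit [FiniteDimensional ℝ E] [FiniteDimensional ℝ E'] in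
theorem ContMDiffOn.contDiffOn_chart_prod {f : M × N → ℝ} {U : Set M} {V : Set N}
    (hf : ContMDiffOn (𝓘(ℝ, E).prod 𝓘(ℝ, E')) 𝓘(ℝ, ℝ) 4 f (U ×ˢ V))
    {e : OpenPartialHomeomorph M E} {e' : OpenPartialHomeomorph N E'}
    (he : e ∈ atlas E M) (he' : e' ∈ atlas E' N) :
    ContDiffOn ℝ 4 (fun q : E × E' =>
      f ((e.extend 𝓘(ℝ, E)).symm q.1, (e'.extend 𝓘(ℝ, E')).symm q.2))
      (chartDom e U ×ˢ chartDom e' V) := by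
  rw [← contMDiffOn_iff_contDiffOn]
  refine hf.comp (t := U ×ˢ V) (f := fun q : E × E' =>
    ((e.extend 𝓘(ℝ, E)).symm q.1, (e'.extend 𝓘(ℝ, E')).symm q.2)) ?_ fun q hq =>
      ⟨hq.1.2, hq.2.2⟩
  refine ContMDiffOn.prodMk ?_ ?_
  · exact (contMDiffOn_extend_symm_atlas he).comp (t := (e.extend 𝓘(ℝ, E)).target)
      contDiff_fst.contMDiff.contMDiffOn fun q hq => hq.1.1
  · exact (contMDiffOn_extend_symm_atlas he').comp (t := (e'.extend 𝓘(ℝ, E')).target)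
      contDiff_snd.contMDiff.contMDiffOn fun q hq => hq.2.1

/-- If `f⁻² (g + h)` is Einstein then `f` is a sum of functions on the factors. -/
theorem BilinField.RicciEqOn.eq_add {g : BilinField 𝓘(ℝ, E) M} {h : BilinField 𝓘(ℝ, E') N}
    (hg : g.IsPseudoRiemannian 3) (hh : h.IsPseudoRiemannian 3)
    (hd : 3 ≤ Module.finrank ℝ E + Module.finrank ℝ E')
    {f : M × N → ℝ} {U : Set M} {V : Set N} (hU : IsOpen U) (hV : IsOpen V)
    (hUc : IsPreconnected U) (hVc : IsPreconnected V)
    (hf : ContMDiffOn (𝓘(ℝ, E).prod 𝓘(ℝ, E')) 𝓘(ℝ, ℝ) 4 f (U ×ˢ V))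
    (h0 : ∀ q ∈ U ×ˢ V, f q ≠ 0) {lam : ℝ}
    (hE : (BilinField.conformalProd f g h).RicciEqOn (fun _ => lam) (U ×ˢ V))
    {y y₀ : M} {x x₀ : N} (hy : y ∈ U) (hy₀ : y₀ ∈ U) (hx : x ∈ V) (hx₀ : x₀ ∈ V) :
    f (y, x) = f (y, x₀) + (f (y₀, x) - f (y₀, x₀)) := by
  -- the partial differential of `f` in the first variable does not depend on the second one
  have hconst : ∀ e ∈ atlas E M, ∀ u ∈ chartDom e U, ∀ X : E, ∀ x ∈ V, ∀ x' ∈ V,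
      fderiv ℝ (fun v => f ((e.extend 𝓘(ℝ, E)).symm v, x)) u X =
      fderiv ℝ (fun v => f ((e.extend 𝓘(ℝ, E)).symm v, x')) u X := by
    intro e he u hu X x hx x' hx'
    refine eq_of_hasFDerivAt_chart_zero (E := E') (φ := fun x =>
      fderiv ℝ (fun v => f ((e.extend 𝓘(ℝ, E)).symm v, x)) u X) hV hVc ?_ hx hx'
    intro e' he' v hv
    have hO := (isOpen_chartDom e hU).prod (isOpen_chartDom e' hV)
    have hF := hf.contDiffOn_chart_prod he he'
    have hmix := (hg.isMetricOn he hU).fderiv_fderiv_mixed_eq_zero (hh.isMetricOn he' hV)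
      (hF.of_le (by norm_num)) (fun p hp => h0 _ ⟨hp.1.2, hp.2.2⟩) hd (p := (u, v)) ⟨hu, hv⟩
      (fun X Y => hE.prodMetric he he' ⟨hu, hv⟩ X Y) X
    set F := (fun q : E × E' =>
      f ((e.extend 𝓘(ℝ, E)).symm q.1, (e'.extend 𝓘(ℝ, E')).symm q.2)) with hFdef
    have hFat : ∀ q ∈ chartDom e U ×ˢ chartDom e' V, ContDiffAt ℝ 4 F q := fun q hq =>
      hF.contDiffAt (hO.mem_nhds hq)
    have hpart : ∀ v' ∈ chartDom e' V,
        fderiv ℝ (fun w => f ((e.extend 𝓘(ℝ, E)).symm w, (e'.extend 𝓘(ℝ, E')).symm v')) u X =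
          fderiv ℝ F (u, v') (X, 0) := by
      intro v' hv'
      have h1 := ((hFat (u, v') ⟨hu, hv'⟩).differentiableAt (by norm_num)).hasFDerivAt
      have h2 : HasFDerivAt (fun w : E => (w, v'))
        ((ContinuousLinearMap.id ℝ E).prod (0 : E →L[ℝ] E')) u :=
        (hasFDerivAt_id u).prodMk (hasFDerivAt_const v' u)
      have h3 := (h1.comp u h2).fderiv
      change fderiv ℝ (F ∘ fun w => (w, v')) u X = _
      rw [h3]
      simp
    have hev : ((fun x => fderiv ℝ (fun v => f ((e.extend 𝓘(ℝ, E)).symm v, x)) u X) ∘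
        (e'.extend 𝓘(ℝ, E')).symm) =ᶠ[nhds v] fun v' => fderiv ℝ F (u, v') (X, 0) := by
      filter_upwards [(isOpen_chartDom e' hV).mem_nhds hv] with v' hv'
      exact hpart v' hv'
    have h1 := (((hFat (u, v) ⟨hu, hv⟩).fderiv_right (m := 3) (by norm_num)).differentiableAt
      (by norm_num)).hasFDerivAt
    have h2 : HasFDerivAt (fun w : E' => (u, w))
      ((0 : E' →L[ℝ] E).prod (ContinuousLinearMap.id ℝ E')) v :=
      (hasFDerivAt_const u v).prodMk (hasFDerivAt_id v)
    have h3 := (h1.comp v h2).clm_apply (hasFDerivAt_const (X, (0 : E')) v)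
    refine (h3.congr_of_eventuallyEq hev).congr_fderiv ?_
    ext Y
    have hsym := (hFat (u, v) ⟨hu, hv⟩).isSymmSndFDerivAt (by simp; norm_num) (X, 0) (0, Y)
    simp [← hsym, hmix]
  have key := eq_of_hasFDerivAt_chart_zero (E := E) (φ := fun y => f (y, x) - f (y, x₀)) hU hUc ?_
    hy hy₀
  · linarith [key]
  intro e he u hu
  have hdiff : ∀ x ∈ V, DifferentiableAt ℝ (fun v => f ((e.extend 𝓘(ℝ, E)).symm v, x)) u := by
    intro x hx
    have hF := hf.contDiffOn_chart_prod he (chart_mem_atlas E' x)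
    have hO := (isOpen_chartDom e hU).prod (isOpen_chartDom (chartAt E' x) hV)
    have h1 := ((hF.contDiffAt (hO.mem_nhds (show (u, (chartAt E' x).extend 𝓘(ℝ, E') x) ∈ _ from
      ⟨hu, chartAt_mem_chartDom hx⟩))).differentiableAt (by norm_num))
    have h2 : DifferentiableAt ℝ (fun w : E => (w, (chartAt E' x).extend 𝓘(ℝ, E') x)) u :=
      differentiableAt_id.prodMk (differentiableAt_const _)
    have h3 := h1.comp u h2
    refine h3.congr_of_eventuallyEq (Filter.Eventually.of_forall fun w => ?_)
    simp only [Function.comp_apply, extend_symm_chartAt]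
  have h1 := (hdiff x hx).hasFDerivAt.sub (hdiff x₀ hx₀).hasFDerivAt
  refine h1.congr_fderiv ?_
  ext X
  exact sub_eq_zero.2 (hconst e he u hu X x hx x₀ hx₀)

end Split

/-! ### Components of the Einstein equation -/

noncomputable section

open LocalGeometry in
/-- The Einstein equation `Ric = lam • (a + b)⁻² (g + h)` for the metric `(a + b)⁻² (g + h)` on
`U × V`, split into its components along the two factors. -/
structure IsSplitEinstein {E : Type*} [NormedAddCommGroup E] [NormedSpace ℝ E]
    {M : Type*} [TopologicalSpace M] [ChartedSpace E M]
    {E' : Type*} [NormedAddCommGroup E'] [NormedSpace ℝ E']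
    {N : Type*} [TopologicalSpace N] [ChartedSpace E' N]
    (g : BilinField 𝓘(ℝ, E) M) (a : M → ℝ) (U : Set M)
    (h : BilinField 𝓘(ℝ, E') N) (b : N → ℝ) (V : Set N) (lam : ℝ) : Prop where
  exists_factor : ∀ e ∈ atlas E M, ∀ u ∈ chartDom e U, ∀ e' ∈ atlas E' N, ∀ v ∈ chartDom e' V,
    ∃ θ : ℝ,
      ((a ((e.extend 𝓘(ℝ, E)).symm u) + b ((e'.extend 𝓘(ℝ, E')).symm v)) * θ =
        lam - (laplacian (g.inChart e) (a ∘ (e.extend 𝓘(ℝ, E)).symm) u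
            + laplacian (h.inChart e') (b ∘ (e'.extend 𝓘(ℝ, E')).symm) v)
          * (a ((e.extend 𝓘(ℝ, E)).symm u) + b ((e'.extend 𝓘(ℝ, E')).symm v))
          + (Module.finrank ℝ E + Module.finrank ℝ E' - 1) *
            (gradSq (g.inChart e) (a ∘ (e.extend 𝓘(ℝ, E)).symm) u
              + gradSq (h.inChart e') (b ∘ (e'.extend 𝓘(ℝ, E')).symm) v)) ∧
      (∀ X Y, (a ((e.extend 𝓘(ℝ, E)).symm u) + b ((e'.extend 𝓘(ℝ, E')).symm v)) *
          ricci (g.inChart e) u X Y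
        + (Module.finrank ℝ E + Module.finrank ℝ E' - 2) *
          hessian (g.inChart e) (a ∘ (e.extend 𝓘(ℝ, E)).symm) u X Y = θ * g.inChart e u X Y) ∧
      (∀ X Y, (a ((e.extend 𝓘(ℝ, E)).symm u) + b ((e'.extend 𝓘(ℝ, E')).symm v)) *
          ricci (h.inChart e') v X Y
        + (Module.finrank ℝ E + Module.finrank ℝ E' - 2) *
          hessian (h.inChart e') (b ∘ (e'.extend 𝓘(ℝ, E')).symm) v X Y =
        θ * h.inChart e' v X Y)

variable {E : Type*} [NormedAddCommGroup E] [NormedSpace ℝ E]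
  {M : Type*} [TopologicalSpace M] [ChartedSpace E M]
  {E' : Type*} [NormedAddCommGroup E'] [NormedSpace ℝ E']
  {N : Type*} [TopologicalSpace N] [ChartedSpace E' N]
  {g : BilinField 𝓘(ℝ, E) M} {a : M → ℝ} {U : Set M}
  {h : BilinField 𝓘(ℝ, E') N} {b : N → ℝ} {V : Set N} {lam : ℝ}

theorem IsSplitEinstein.swap (hS : IsSplitEinstein g a U h b V lam) :
    IsSplitEinstein h b V g a U lam where
  exists_factor e he u hu e' he' v hv := by
    obtain ⟨θ, h1, h2, h3⟩ := hS.exists_factor e' he' v hv e he u hu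
    refine ⟨θ, ?_, fun X Y => ?_, fun X Y => ?_⟩
    · rw [add_comm (b _), h1]; ring
    · rw [add_comm (b _), ← h3]; ring
    · rw [add_comm (b _), ← h2]; ring

variable [FiniteDimensional ℝ E] [FiniteDimensional ℝ E']
  [IsManifold 𝓘(ℝ, E) 4 M] [IsManifold 𝓘(ℝ, E') 4 N]

open LocalGeometry in
theorem BilinField.RicciEqOn.isSplitEinstein {f : M × N → ℝ}
    (hg : g.IsPseudoRiemannian 3) (hh : h.IsPseudoRiemannian 3)
    (hU : IsOpen U) (hV : IsOpen V)
    (ha : ContMDiffOn 𝓘(ℝ, E) 𝓘(ℝ, ℝ) 4 a U) (hb : ContMDiffOn 𝓘(ℝ, E') 𝓘(ℝ, ℝ) 4 b V)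
    (hf : ∀ y ∈ U, ∀ x ∈ V, f (y, x) = a y + b x) (h0 : ∀ q ∈ U ×ˢ V, f q ≠ 0)
    (hE : (BilinField.conformalProd f g h).RicciEqOn (fun _ => lam) (U ×ˢ V)) :
    IsSplitEinstein g a U h b V lam where
  exists_factor e he u hu e' he' v hv := by
    have hG := hg.isMetricOn he hU
    have hG' := hh.isMetricOn he' hV
    have hE' := hE.prodMetric he he' (p := (u, v)) ⟨hu, hv⟩
    have hF : a ((e.extend 𝓘(ℝ, E)).symm u) + b ((e'.extend 𝓘(ℝ, E')).symm v) ≠ 0 := by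
      rw [← hf _ hu.2 _ hv.2]; exact h0 _ ⟨hu.2, hv.2⟩
    have hric := fun X Y => hG.ricci_conformal_sum hG'
      ((ha.contDiffOn_chart le_rfl he).of_le (by norm_num))
      ((hb.contDiffOn_chart le_rfl he').of_le (by norm_num))
      (F := fun q : E × E' => f ((e.extend 𝓘(ℝ, E)).symm q.1, (e'.extend 𝓘(ℝ, E')).symm q.2))
      (fun p hp => hf _ hp.1.2 _ hp.2.2) (fun p hp => h0 (_, _) ⟨hp.1.2, hp.2.2⟩) (p := (u, v))
      ⟨hu, hv⟩ X Y
    simp only [hf _ hu.2 _ hv.2] at hE' hric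
    set c := a ((e.extend 𝓘(ℝ, E)).symm u) + b ((e'.extend 𝓘(ℝ, E')).symm v) with hc
    refine ⟨(lam - (LocalGeometry.laplacian (g.inChart e) (a ∘ (e.extend 𝓘(ℝ, E)).symm) u
            + LocalGeometry.laplacian (h.inChart e') (b ∘ (e'.extend 𝓘(ℝ, E')).symm) v) * c
          + (Module.finrank ℝ E + Module.finrank ℝ E' - 1) *
            (gradSq (g.inChart e) (a ∘ (e.extend 𝓘(ℝ, E)).symm) u
              + gradSq (h.inChart e') (b ∘ (e'.extend 𝓘(ℝ, E')).symm) v)) / c, ?_, ?_, ?_⟩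
    · field_simp
    · intro X Y
      have h1 := hric (X, 0) (Y, 0)
      rw [hE'] at h1
      have hz : ricci (h.inChart e') v 0 0 = 0 := by
        have : ricciEndo (h.inChart e') v 0 0 = 0 := by
          apply LinearMap.ext
          intro V
          simp [ricciEndo, riemann]
        rw [ricci, this, map_zero]
      simp [prodMetric_apply, hz] at h1
      simp only [extend_symm_eq] at h1 ⊢
      field_simp at h1 ⊢
      linarith
    · intro X Y
      have h1 := hric (0, X) (0, Y)
      rw [hE'] at h1
      have hz : ricci (g.inChart e) u 0 0 = 0 := by
        have : ricciEndo (g.inChart e) u 0 0 = 0 := by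
          apply LinearMap.ext
          intro V
          simp [ricciEndo, riemann]
        rw [ricci, this, map_zero]
      simp [prodMetric_apply, hz] at h1
      simp only [extend_symm_eq] at h1 ⊢
      field_simp at h1 ⊢
      linarith

theorem BilinField.IsPseudoRiemannian.exists_inChart_ne_zero [Nontrivial E]
    (hg : g.IsPseudoRiemannian 3) {e : OpenPartialHomeomorph M E} (he : e ∈ atlas E M)
    {u : E} (hu : u ∈ (e.extend 𝓘(ℝ, E)).target) : ∃ X Y, g.inChart e u X Y ≠ 0 := by
  by_contra! hc
  obtain ⟨X, hX⟩ := exists_ne (0 : E)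
  exact hX ((hg.isMetricOn he isOpen_univ).nondegenerate u (by simpa [chartDom] using hu) X (hc X))

open LocalGeometry in
/-- If `b` is constant, the first factor is the base and the fibre `(V, h)` is Einstein. -/
theorem IsSplitEinstein.isEinsteinOn_snd (hS : IsSplitEinstein g a U h b V lam)
    (hne : U.Nonempty) (h0 : ∀ y ∈ U, ∀ x ∈ V, a y + b x ≠ 0)
    (hb : ∃ c, ∀ x ∈ V, b x = c) (hV : IsOpen V) : h.IsEinsteinOn V := by
  obtain ⟨y, hy⟩ := hne
  obtain ⟨c, hc⟩ := hb
  have he := chart_mem_atlas E y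
  have hu := chartAt_mem_chartDom (E := E) hy
  set e := chartAt E y with hedef
  set u := e.extend 𝓘(ℝ, E) y with hudef
  have hsu : (e.extend 𝓘(ℝ, E)).symm u = y := extend_symm_chartAt y
  refine ⟨(lam - laplacian (g.inChart e) (a ∘ (e.extend 𝓘(ℝ, E)).symm) u * (a y + c)
    + (Module.finrank ℝ E + Module.finrank ℝ E' - 1) *
      gradSq (g.inChart e) (a ∘ (e.extend 𝓘(ℝ, E)).symm) u) / (a y + c) ^ 2, ?_⟩
  intro e' he' v hvt hv X Y
  have hv' : v ∈ chartDom e' V := ⟨hvt, hv⟩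
  obtain ⟨θ, h1, -, h3⟩ := hS.exists_factor e he u hu e' he' v hv'
  have hev : b ∘ (e'.extend 𝓘(ℝ, E')).symm =ᶠ[nhds v] fun _ => c := by
    filter_upwards [(isOpen_chartDom e' hV).mem_nhds hv'] with w hw
    exact hc _ hw.2
  have hH : hessian (h.inChart e') (b ∘ (e'.extend 𝓘(ℝ, E')).symm) v = 0 := by
    rw [hessian_congr hev]
    ext A B
    simp [hessian_apply]
  have hA : gradSq (h.inChart e') (b ∘ (e'.extend 𝓘(ℝ, E')).symm) v = 0 := by
    rw [gradSq_congr hev]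
    simp [gradSq]
  have h4 := h3 X Y
  have hL : LocalGeometry.laplacian (h.inChart e') (b ∘ (e'.extend 𝓘(ℝ, E')).symm) v = 0 := by
    rw [LocalGeometry.laplacian, hH]; simp
  rw [hL, hA, hsu, hc _ hv] at h1
  rw [hH, hsu, hc _ hv] at h4
  have hne := h0 y hy _ hv
  rw [hc _ hv] at hne
  simp only [zero_apply, mul_zero, add_zero] at h1 h4
  field_simp
  rw [← h1]
  linear_combination (a y + c) * h4

/-- If `b` takes two values, then on the first factor both the Ricci tensor and the Hessian of `a`
are multiples of the metric. The factors do not depend on the chart, as they solve a system of two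
linear equations given by two values of `b`. -/
theorem IsSplitEinstein.exists_ricci_eq [Nontrivial E'] (hS : IsSplitEinstein g a U h b V lam)
    (hh : h.IsPseudoRiemannian 3)
    (hd : 3 ≤ Module.finrank ℝ E + Module.finrank ℝ E')
    (hb : ∃ x ∈ V, ∃ x' ∈ V, b x ≠ b x') :
    ∃ K α : M → ℝ, ∀ e ∈ atlas E M, ∀ u ∈ chartDom e U, ∀ X Y,
      LocalGeometry.ricci (g.inChart e) u X Y =
        K ((e.extend 𝓘(ℝ, E)).symm u) * g.inChart e u X Y ∧
      LocalGeometry.hessian (g.inChart e) (a ∘ (e.extend 𝓘(ℝ, E)).symm) u X Y =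
        α ((e.extend 𝓘(ℝ, E)).symm u) * g.inChart e u X Y := by
  obtain ⟨x₁, hx₁, x₂, hx₂, hne⟩ := hb
  have hD : (0 : ℝ) < Module.finrank ℝ E + Module.finrank ℝ E' - 2 := by
    have : (3 : ℝ) ≤ Module.finrank ℝ E + Module.finrank ℝ E' := by exact_mod_cast hd
    linarith
  have key : ∀ y : M, ∃ κ α : ℝ, ∀ e ∈ atlas E M, ∀ u ∈ chartDom e U,
      (e.extend 𝓘(ℝ, E)).symm u = y → ∀ X Y,
      LocalGeometry.ricci (g.inChart e) u X Y = κ * g.inChart e u X Y ∧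
      LocalGeometry.hessian (g.inChart e) (a ∘ (e.extend 𝓘(ℝ, E)).symm) u X Y =
        α * g.inChart e u X Y := by
    intro y
    by_cases hy : y ∈ U
    swap
    · exact ⟨0, 0, fun e _ u hu hsu => absurd (hsu ▸ hu.2) hy⟩
    -- the factor in the Einstein equation does not depend on the chart of the first factor
    have hθ : ∀ x ∈ V, ∃ θ, ∀ e ∈ atlas E M, ∀ u ∈ chartDom e U,
        (e.extend 𝓘(ℝ, E)).symm u = y → ∀ X Y, (a y + b x) * LocalGeometry.ricci (g.inChart e) u X Y
        + (Module.finrank ℝ E + Module.finrank ℝ E' - 2) *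
          LocalGeometry.hessian (g.inChart e) (a ∘ (e.extend 𝓘(ℝ, E)).symm) u X Y =
            θ * g.inChart e u X Y := by
      intro x hx
      have hv := chartAt_mem_chartDom (E := E') hx
      obtain ⟨A, B, hAB⟩ := hh.exists_inChart_ne_zero (chart_mem_atlas E' x) hv.1
      obtain ⟨θ, -, -, h3⟩ := hS.exists_factor _ (chart_mem_atlas E y) _ (chartAt_mem_chartDom hy)
        _ (chart_mem_atlas E' x) _ hv
      refine ⟨θ, fun e he u hu hsu X Y => ?_⟩
      obtain ⟨θ', -, h2', h3'⟩ := hS.exists_factor e he u hu _ (chart_mem_atlas E' x) _ hv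
      have h4 := h3 A B
      have h5 := h3' A B
      rw [extend_symm_chartAt, extend_symm_chartAt] at h4
      rw [extend_symm_chartAt, hsu] at h5
      have hθθ' : θ' = θ := mul_right_cancel₀ hAB (by rw [← h4, ← h5])
      rw [← hθθ', ← h2', extend_symm_chartAt, hsu]
    obtain ⟨θ₁, h1⟩ := hθ x₁ hx₁
    obtain ⟨θ₂, h2⟩ := hθ x₂ hx₂
    -- the difference of the two equations determines `Ric`, and then either of them `∇²a`
    have hne' : b x₁ - b x₂ ≠ 0 := sub_ne_zero.2 hne
    refine ⟨(θ₁ - θ₂) / (b x₁ - b x₂), (θ₁ - (a y + b x₁) * ((θ₁ - θ₂) / (b x₁ - b x₂))) /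
      (Module.finrank ℝ E + Module.finrank ℝ E' - 2), fun e he u hu hsu X Y => ?_⟩
    have h1' := h1 e he u hu hsu X Y
    have h2' := h2 e he u hu hsu X Y
    have hR : LocalGeometry.ricci (g.inChart e) u X Y =
        (θ₁ - θ₂) / (b x₁ - b x₂) * g.inChart e u X Y := by
      field_simp
      linarith
    refine ⟨hR, ?_⟩
    rw [hR] at h1'
    rw [div_mul_eq_mul_div, eq_div_iff hD.ne']
    linarith
  choose K α hK using key
  exact ⟨K, α, fun e he u hu X Y => hK _ e he u hu rfl X Y⟩

end

/-! ### The structure of the factors -/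

noncomputable section

/-- If `(a + b) K + D α = (a + b) L + D β` on `U × V`, where `a, K, α` are functions on `U` and
`b, L, β` functions on `V`, then `K` and `L` are affine functions of `a` and `b` of the same slope,
and `α` and `β` are quadratic functions of `a` and `b`. -/
theorem exists_affine_of_add_mul_eq {M N : Type*} {U : Set M} {V : Set N} {a K α : M → ℝ}
    {b L β : N → ℝ} {D : ℝ}
    (ha : ∃ y ∈ U, ∃ y' ∈ U, a y ≠ a y') (hb : ∃ x ∈ V, ∃ x' ∈ V, b x ≠ b x')
    (h : ∀ y ∈ U, ∀ x ∈ V, (a y + b x) * K y + D * α y = (a y + b x) * L x + D * β x) :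
    ∃ s t t' c : ℝ,
      (∀ y ∈ U, K y = s * a y + t ∧ D * α y = -s * a y ^ 2 - (t - t') * a y + c) ∧
      (∀ x ∈ V, L x = s * b x + t' ∧ D * β x = -s * b x ^ 2 + (t - t') * b x + c) := by
  obtain ⟨y₁, hy₁, y₂, hy₂, hy⟩ := ha
  obtain ⟨x₁, hx₁, x₂, hx₂, hx⟩ := hb
  have hb0 : b x₁ - b x₂ ≠ 0 := sub_ne_zero.2 hx
  have ha0 : a y₁ - a y₂ ≠ 0 := sub_ne_zero.2 hy
  -- for fixed `x` the equation gives `K` in terms of `α`; two values of `x` eliminate `α`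
  obtain ⟨s, hs⟩ : ∃ s, s = (L x₁ - L x₂) / (b x₁ - b x₂) := ⟨_, rfl⟩
  obtain ⟨t, ht⟩ : ∃ t, t = (L x₁ * b x₁ - L x₂ * b x₂ + D * (β x₁ - β x₂)) / (b x₁ - b x₂) :=
    ⟨_, rfl⟩
  have hK : ∀ y ∈ U, K y = s * a y + t := by
    intro y hy
    have h1 := h y hy x₁ hx₁
    have h2 := h y hy x₂ hx₂
    rw [hs, ht]
    field_simp
    linarith
  obtain ⟨t', ht'⟩ : ∃ t', t' = L x₁ - s * b x₁ := ⟨_, rfl⟩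
  have hL : ∀ x ∈ V, L x = s * b x + t' := by
    intro x hx
    have h1 := h y₁ hy₁ x hx
    have h2 := h y₂ hy₂ x hx
    have h3 := h y₁ hy₁ x₁ hx₁
    have h4 := h y₂ hy₂ x₁ hx₁
    have h5 := hK y₁ hy₁
    have h6 := hK y₂ hy₂
    rw [h5] at h1 h3
    rw [h6] at h2 h4
    refine mul_left_cancel₀ ha0 ?_
    rw [ht']
    linarith
  refine ⟨s, t, t', s * b x₁ ^ 2 - (t - t') * b x₁ + D * β x₁, fun y hy => ⟨hK y hy, ?_⟩,
    fun x hx => ⟨hL x hx, ?_⟩⟩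
  · have h1 := h y hy x₁ hx₁
    rw [hK y hy, hL x₁ hx₁] at h1
    linarith
  · have h1 := h y₁ hy₁ x₁ hx₁
    have h2 := h y₁ hy₁ x hx
    rw [hK y₁ hy₁, hL x₁ hx₁] at h1
    rw [hK y₁ hy₁, hL x hx] at h2
    linarith

variable {E : Type*} [NormedAddCommGroup E] [NormedSpace ℝ E]
  {M : Type*} [TopologicalSpace M] [ChartedSpace E M]
  {E' : Type*} [NormedAddCommGroup E'] [NormedSpace ℝ E']
  {N : Type*} [TopologicalSpace N] [ChartedSpace E' N]
  {g : BilinField 𝓘(ℝ, E) M} {a : M → ℝ} {U : Set M}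
  {h : BilinField 𝓘(ℝ, E') N} {b : N → ℝ} {V : Set N} {lam : ℝ}
  [FiniteDimensional ℝ E] [FiniteDimensional ℝ E']
  [IsManifold 𝓘(ℝ, E) 4 M] [IsManifold 𝓘(ℝ, E') 4 N]

open LocalGeometry in
/-- `Ric = K g` and `∇²a = α g` on `W`, in every chart. -/
def RicciHessEqOn (g : BilinField 𝓘(ℝ, E) M) (a K α : M → ℝ) (W : Set M) : Prop :=
  ∀ e ∈ atlas E M, ∀ u ∈ chartDom e W, ∀ X Y,
    ricci (g.inChart e) u X Y = K ((e.extend 𝓘(ℝ, E)).symm u) * g.inChart e u X Y ∧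
    hessian (g.inChart e) (a ∘ (e.extend 𝓘(ℝ, E)).symm) u X Y =
      α ((e.extend 𝓘(ℝ, E)).symm u) * g.inChart e u X Y

open LocalGeometry in
/-- The two equations contained in the Einstein equation once the Ricci tensors and the Hessians are
multiples of the metrics. -/
theorem IsSplitEinstein.scalar_equations [Nontrivial E] [Nontrivial E']
    (hS : IsSplitEinstein g a U h b V lam)
    (hg : g.IsPseudoRiemannian 3) (hh : h.IsPseudoRiemannian 3) (hU : IsOpen U) (hV : IsOpen V)
    {K α : M → ℝ} {L β : N → ℝ} (hK : RicciHessEqOn g a K α U) (hL : RicciHessEqOn h b L β V)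
    {e : OpenPartialHomeomorph M E} {e' : OpenPartialHomeomorph N E'}
    (he : e ∈ atlas E M) (he' : e' ∈ atlas E' N) {u : E} {v : E'}
    (hu : u ∈ chartDom e U) (hv : v ∈ chartDom e' V) {y : M} {x : N}
    (hy : (e.extend 𝓘(ℝ, E)).symm u = y) (hx : (e'.extend 𝓘(ℝ, E')).symm v = x) :
    (a y + b x) * K y + (Module.finrank ℝ E + Module.finrank ℝ E' - 2) * α y =
      (a y + b x) * L x + (Module.finrank ℝ E + Module.finrank ℝ E' - 2) * β x ∧
    lam + (Module.finrank ℝ E + Module.finrank ℝ E' - 1) *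
        (gradSq (g.inChart e) (a ∘ (e.extend 𝓘(ℝ, E)).symm) u
          + gradSq (h.inChart e') (b ∘ (e'.extend 𝓘(ℝ, E')).symm) v) =
      (a y + b x) * ((a y + b x) * K y + (2 * Module.finrank ℝ E + Module.finrank ℝ E' - 2) * α y +
        Module.finrank ℝ E' * β x) := by
  subst hy hx
  obtain ⟨θ, h1, h2, h3⟩ := hS.exists_factor e he u hu e' he' v hv
  obtain ⟨X, Y, hXY⟩ := hg.exists_inChart_ne_zero he hu.1
  obtain ⟨X', Y', hXY'⟩ := hh.exists_inChart_ne_zero he' hv.1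
  have h4 := h2 X Y
  have h5 := h3 X' Y'
  rw [(hK e he u hu X Y).1, (hK e he u hu X Y).2] at h4
  rw [(hL e' he' v hv X' Y').1, (hL e' he' v hv X' Y').2] at h5
  rw [(hg.isMetricOn he hU).laplacian_eq hu fun X Y => (hK e he u hu X Y).2,
    (hh.isMetricOn he' hV).laplacian_eq hv fun X Y => (hL e' he' v hv X Y).2] at h1
  have h6 := mul_right_cancel₀ hXY ((by linarith : (((a ((e.extend 𝓘(ℝ, E)).symm u) +
      b ((e'.extend 𝓘(ℝ, E')).symm v)) * K ((e.extend 𝓘(ℝ, E)).symm u)) +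
      (Module.finrank ℝ E + Module.finrank ℝ E' - 2) * α ((e.extend 𝓘(ℝ, E)).symm u)) *
        g.inChart e u X Y = θ * g.inChart e u X Y))
  have h7 := mul_right_cancel₀ hXY' ((by linarith : (((a ((e.extend 𝓘(ℝ, E)).symm u) +
      b ((e'.extend 𝓘(ℝ, E')).symm v)) * L ((e'.extend 𝓘(ℝ, E')).symm v)) +
      (Module.finrank ℝ E + Module.finrank ℝ E' - 2) * β ((e'.extend 𝓘(ℝ, E')).symm v)) *
        h.inChart e' v X' Y' = θ * h.inChart e' v X' Y'))
  refine ⟨h6.trans h7.symm, ?_⟩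
  rw [← h6] at h1
  linarith

open LocalGeometry in
/-- The conditions on the coefficients obtained by differentiating the scalar component of the
Einstein equation in the direction of the first factor. -/
theorem IsSplitEinstein.slope_equations [Nontrivial E] [Nontrivial E']
    (hS : IsSplitEinstein g a U h b V lam)
    (hg : g.IsPseudoRiemannian 3) (hh : h.IsPseudoRiemannian 3) (hU : IsOpen U) (hV : IsOpen V)
    (hUc : IsPreconnected U) (ha : ContMDiffOn 𝓘(ℝ, E) 𝓘(ℝ, ℝ) 4 a U)
    (h0 : ∀ y ∈ U, ∀ x ∈ V, a y + b x ≠ 0)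
    (haU : ∃ y ∈ U, ∃ y' ∈ U, a y ≠ a y') (hbV : ∃ x ∈ V, ∃ x' ∈ V, b x ≠ b x')
    {K α : M → ℝ} {L β : N → ℝ} (hK : RicciHessEqOn g a K α U) (hL : RicciHessEqOn h b L β V)
    {n m D s t t' c : ℝ} (hn : n = Module.finrank ℝ E) (hm : m = Module.finrank ℝ E')
    (hD : D = n + m - 2)
    (hKa : ∀ y ∈ U, K y = s * a y + t ∧ D * α y = -s * a y ^ 2 - (t - t') * a y + c)
    (hLb : ∀ x ∈ V, L x = s * b x + t' ∧ D * β x = -s * b x ^ 2 + (t - t') * b x + c) :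
    (n - 2) * s = 0 ∧ ∃ r, s * r * (2 * m - n - 2) + 2 * D * t - (2 * n - 2) * (t - t') = 0 := by
  -- a point where the differential of `a` does not vanish
  obtain ⟨e, he, u, hu, hda⟩ : ∃ e ∈ atlas E M, ∃ u ∈ chartDom e U,
      fderiv ℝ (a ∘ (e.extend 𝓘(ℝ, E)).symm) u ≠ 0 := by
    by_contra! hc
    obtain ⟨y, hy, y', hy', hne⟩ := haU
    refine hne (eq_of_hasFDerivAt_chart_zero (E := E) hU hUc (fun e he u hu => ?_) hy hy')
    rw [← hc e he u hu]
    exact (((ha.contDiffOn_chart le_rfl he).contDiffAt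
      ((isOpen_chartDom e hU).mem_nhds hu)).differentiableAt (by norm_num)).hasFDerivAt
  have hac : ContDiffAt ℝ 4 (a ∘ (e.extend 𝓘(ℝ, E)).symm) u :=
    (ha.contDiffOn_chart le_rfl he).contDiffAt ((isOpen_chartDom e hU).mem_nhds hu)
  have hG := hg.isMetricOn he hU
  set A : E → ℝ := a ∘ (e.extend 𝓘(ℝ, E)).symm with hA
  have had : HasFDerivAt A (fderiv ℝ A u) u := (hac.differentiableAt (by norm_num)).hasFDerivAt
  have hgrad := hG.hasFDerivAt_gradSq hu (hac.of_le (by norm_num)) fun X Y => (hK e he u hu X Y).2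
  -- the derivative of the scalar equation, after division by `a + b`
  have key : ∀ x ∈ V, D * s * (A u + b x) + 2 * D * (s * A u + t)
      - (D + n) * (2 * s * A u + t - t') + m * (s * (A u - b x) + t - t') = 0 := by
    intro x hx
    have hv := chartAt_mem_chartDom (E := E') hx
    have heq : ∀ᶠ w in nhds u, D * (lam + (D + 1) * (gradSq (g.inChart e) A w
        + gradSq (h.inChart (chartAt E' x)) (b ∘ ((chartAt E' x).extend 𝓘(ℝ, E')).symm)
          ((chartAt E' x).extend 𝓘(ℝ, E') x))) =
        (A w + b x) * (D * ((A w + b x) * (s * A w + t))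
          + (D + n) * (-s * A w ^ 2 - (t - t') * A w + c) + m * (D * β x)) := by
      filter_upwards [(isOpen_chartDom e hU).mem_nhds hu] with w hw
      have h1 := (hS.scalar_equations hg hh hU hV hK hL he (chart_mem_atlas E' x) hw hv rfl
        (extend_symm_chartAt x)).2
      rw [← hn, ← hm, (hKa _ hw.2).1] at h1
      have h2 := (hKa _ hw.2).2
      have hAw : A w = a ((e.extend 𝓘(ℝ, E)).symm w) := rfl
      rw [← hAw] at h1 h2
      rw [show D + 1 = n + m - 1 by rw [hD]; ring, h1, ← h2, hD]
      ring
    have hl := (((hgrad.add_const (gradSq (h.inChart (chartAt E' x))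
      (b ∘ ((chartAt E' x).extend 𝓘(ℝ, E')).symm)
          ((chartAt E' x).extend 𝓘(ℝ, E') x))).const_mul (D + 1)).const_add lam).const_mul D
    have hp : HasDerivAt (fun r : ℝ => (r + b x) * (D * ((r + b x) * (s * r + t))
          + (D + n) * (-s * r ^ 2 - (t - t') * r + c) + m * (D * β x)))
        ((D * ((A u + b x) * (s * A u + t))
          + (D + n) * (-s * A u ^ 2 - (t - t') * A u + c) + m * (D * β x))
          + (A u + b x) * (D * ((s * A u + t) + (A u + b x) * s)
            + (D + n) * (-s * (2 * A u) - (t - t')))) (A u) := by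
      have hid := hasDerivAt_id (A u)
      have h1 := hid.add_const (b x)
      have h2 := (hid.const_mul s).add_const t
      have h3 := ((((hid.pow 2).const_mul (-s)).sub (hid.const_mul (t - t'))).add_const c).const_mul
        (D + n)
      have h4 := h1.mul ((((h1.mul h2).const_mul D).add h3).add_const (m * (D * β x)))
      refine (h4.congr_deriv ?_)
      simp
    have hr := hp.comp_hasFDerivAt u had
    have huniq := hl.unique (hr.congr_of_eventuallyEq heq)
    obtain ⟨X, hX⟩ : ∃ X, fderiv ℝ A u X ≠ 0 := by
      by_contra! hc
      exact hda (by ext X; simpa using hc X)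
    have h1 := DFunLike.congr_fun huniq X
    simp only [smul_apply, smul_eq_mul] at h1
    have h2 : D * ((D + 1) * (2 * α ((e.extend 𝓘(ℝ, E)).symm u))) = _ :=
      mul_right_cancel₀ hX (by rw [← h1]; ring)
    have h3 := (hKa _ hu.2).2
    have h4 := (hLb _ hx).2
    have hAu : A u = a ((e.extend 𝓘(ℝ, E)).symm u) := rfl
    rw [← hAu] at h3
    have h5 : D * ((D + 1) * (2 * α ((e.extend 𝓘(ℝ, E)).symm u))) =
      2 * (D + 1) * (-s * A u ^ 2 - (t - t') * A u + c) := by rw [← h3]; ring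
    rw [h5, h4] at h2
    have hne : A u + b x ≠ 0 := h0 _ hu.2 _ hx
    refine (mul_eq_zero.1 (?_ : (A u + b x) * _ = 0)).resolve_left hne
    have hDn : D = n + m - 2 := hD
    have h6 := sub_eq_zero.2 h2
    have hm' : m = D + 2 - n := by rw [hD]; ring
    rw [hm'] at h6 ⊢
    linear_combination -h6
  obtain ⟨x₁, hx₁, x₂, hx₂, hne⟩ := hbV
  have k1 := key x₁ hx₁
  have k2 := key x₂ hx₂
  have hb0 : b x₁ - b x₂ ≠ 0 := sub_ne_zero.2 hne
  have hs : (n - 2) * s = 0 := by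
    refine mul_right_cancel₀ hb0 ?_
    rw [hD] at k1 k2
    linear_combination k1 - k2
  refine ⟨hs, A u, ?_⟩
  rw [hD] at k1 ⊢
  linear_combination k1 - b x₁ * hs

/-- The structure of the two factors when `(a + b)⁻² (g + h)` is Einstein and neither `a` nor `b` is
constant. -/
theorem IsSplitEinstein.exists_structure [Nontrivial E] [Nontrivial E']
    (hS : IsSplitEinstein g a U h b V lam)
    (hd : 3 ≤ Module.finrank ℝ E + Module.finrank ℝ E')
    (hg : g.IsPseudoRiemannian 3) (hh : h.IsPseudoRiemannian 3) (hU : IsOpen U) (hV : IsOpen V)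
    (hUc : IsPreconnected U) (hVc : IsPreconnected V)
    (ha : ContMDiffOn 𝓘(ℝ, E) 𝓘(ℝ, ℝ) 4 a U) (hb : ContMDiffOn 𝓘(ℝ, E') 𝓘(ℝ, ℝ) 4 b V)
    (h0 : ∀ y ∈ U, ∀ x ∈ V, a y + b x ≠ 0)
    (haU : ∃ y ∈ U, ∃ y' ∈ U, a y ≠ a y') (hbV : ∃ x ∈ V, ∃ x' ∈ V, b x ≠ b x')
    {n m D : ℝ} (hn : n = Module.finrank ℝ E) (hm : m = Module.finrank ℝ E')
    (hD : D = n + m - 2) :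
    ∃ (K α : M → ℝ) (L β : N → ℝ) (s t t' c : ℝ),
      RicciHessEqOn g a K α U ∧ RicciHessEqOn h b L β V ∧
      (∀ y ∈ U, K y = s * a y + t ∧ D * α y = -s * a y ^ 2 - (t - t') * a y + c) ∧
      (∀ x ∈ V, L x = s * b x + t' ∧ D * β x = -s * b x ^ 2 + (t - t') * b x + c) ∧
      (n - 2) * s = 0 ∧ (m - 2) * s = 0 ∧ (m - 1) * t + (n - 1) * t' = 0 := by
  obtain ⟨K, α, hK⟩ := hS.exists_ricci_eq hh hd hbV
  obtain ⟨L, β, hL⟩ := hS.swap.exists_ricci_eq hg (by rwa [add_comm]) haU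
  obtain ⟨s, t, t', c, hKa, hLb⟩ := exists_affine_of_add_mul_eq (K := K) (α := α) (L := L) (β := β)
    (D := D) haU hbV fun y hy x hx => by
      have := (hS.scalar_equations hg hh hU hV hK hL (chart_mem_atlas E y) (chart_mem_atlas E' x)
        (chartAt_mem_chartDom hy) (chartAt_mem_chartDom hx) (extend_symm_chartAt y)
        (extend_symm_chartAt x)).1
      rwa [← hn, ← hm, ← hD] at this
  obtain ⟨h1, r, h2⟩ := hS.slope_equations hg hh hU hV hUc ha h0 haU hbV hK hL hn hm hD hKa hLb
  obtain ⟨h3, -⟩ := hS.swap.slope_equations hh hg hV hU hVc hb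
    (fun x hx y hy => by rw [add_comm]; exact h0 y hy x hx) hbV haU hL hK hm hn
    (D := D) (by rw [hD]; ring) (t := t') (t' := t) (c := c) (s := s)
    (fun x hx => ⟨(hLb x hx).1, by rw [(hLb x hx).2]; ring⟩)
    (fun y hy => ⟨(hKa y hy).1, by rw [(hKa y hy).2]; ring⟩)
  refine ⟨K, α, L, β, s, t, t', c, hK, hL, hKa, hLb, h1, h3, ?_⟩
  rw [hD] at h2
  linear_combination h2 / 2 - r * h3 + r / 2 * h1

end

/-! ### The classification -/

noncomputable section

namespace LocalGeometry

variable {E : Type*} [NormedAddCommGroup E] [NormedSpace ℝ E]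

theorem hessian_affine (G : E → E →L[ℝ] E →L[ℝ] ℝ) {a : E → ℝ} {u : E} (ha : ContDiffAt ℝ 2 a u)
    (s t : ℝ) : hessian G (fun v => s * a v + t) u = s • hessian G a u := by
  have h1 : ∀ᶠ v in nhds u, fderiv ℝ (fun v => s * a v + t) v = s • fderiv ℝ a v := by
    filter_upwards [ha.eventually (by simp)] with v hv
    exact (((hv.differentiableAt (by norm_num)).hasFDerivAt.const_mul s).add_const t).fderiv
  have h2 : fderiv ℝ (fderiv ℝ (fun v => s * a v + t)) u = s • fderiv ℝ (fderiv ℝ a) u := by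
    rw [Filter.EventuallyEq.fderiv_eq h1]
    exact (((ha.fderiv_right (m := 1) (by norm_num)).differentiableAt
      (by norm_num)).hasFDerivAt.const_smul s).fderiv
  ext X Y
  simp only [hessian_apply, smul_apply, h2, h1.self_of_nhds, smul_eq_mul]
  ring

end LocalGeometry

variable {E : Type*} [NormedAddCommGroup E] [NormedSpace ℝ E]
  {M : Type*} [TopologicalSpace M] [ChartedSpace E M]
  {E' : Type*} [NormedAddCommGroup E'] [NormedSpace ℝ E']
  {N : Type*} [TopologicalSpace N] [ChartedSpace E' N]
  {g : BilinField 𝓘(ℝ, E) M} {h : BilinField 𝓘(ℝ, E') N}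
  [FiniteDimensional ℝ E] [FiniteDimensional ℝ E']
  [IsManifold 𝓘(ℝ, E) 4 M] [IsManifold 𝓘(ℝ, E') 4 N]

/-- If `f⁻² (g + h)` is Einstein on `U × V` then `f = a + b` there, and the Einstein equation splits
into components. -/
theorem BilinField.IsEinsteinOn.exists_isSplitEinstein
    (hg : g.IsPseudoRiemannian 3) (hh : h.IsPseudoRiemannian 3)
    (hd : 3 ≤ Module.finrank ℝ E + Module.finrank ℝ E')
    {f : M × N → ℝ} {U : Set M} {V : Set N} (hU : IsOpen U) (hV : IsOpen V)
    (hUc : IsConnected U) (hVc : IsConnected V)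
    (hf : ContMDiffOn (𝓘(ℝ, E).prod 𝓘(ℝ, E')) 𝓘(ℝ, ℝ) 4 f (U ×ˢ V))
    (h0 : ∀ q ∈ U ×ˢ V, f q ≠ 0)
    (hE : (BilinField.conformalProd f g h).IsEinsteinOn (U ×ˢ V)) :
    ∃ (a : M → ℝ) (b : N → ℝ) (lam : ℝ), ContMDiffOn 𝓘(ℝ, E) 𝓘(ℝ, ℝ) 4 a U ∧
      ContMDiffOn 𝓘(ℝ, E') 𝓘(ℝ, ℝ) 4 b V ∧ (∀ y ∈ U, ∀ x ∈ V, f (y, x) = a y + b x) ∧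
      IsSplitEinstein g a U h b V lam := by
  obtain ⟨y₀, hy₀⟩ := hUc.nonempty
  obtain ⟨x₀, hx₀⟩ := hVc.nonempty
  obtain ⟨lam, hE⟩ := hE
  have hsum : ∀ y ∈ U, ∀ x ∈ V, f (y, x) = f (y, x₀) + (f (y₀, x) - f (y₀, x₀)) :=
    fun y hy x hx => hE.eq_add hg hh hd hU hV hUc.isPreconnected hVc.isPreconnected hf h0 hy hy₀ hx
      hx₀
  have ha : ContMDiffOn 𝓘(ℝ, E) 𝓘(ℝ, ℝ) 4 (fun y => f (y, x₀)) U :=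
    hf.comp (contMDiff_id.prodMk contMDiff_const).contMDiffOn fun y hy => ⟨hy, hx₀⟩
  have hb : ContMDiffOn 𝓘(ℝ, E') 𝓘(ℝ, ℝ) 4 (fun x => f (y₀, x) - f (y₀, x₀)) V :=
    (hf.comp (contMDiff_const.prodMk contMDiff_id).contMDiffOn fun x hx => ⟨hy₀, hx⟩).sub
      contMDiffOn_const
  exact ⟨_, _, lam, ha, hb, hsum, hE.isSplitEinstein hg hh hU hV ha hb hsum h0⟩

theorem BilinField.conformalProd_eq_warpedProdFst {f : M × N → ℝ} {φ : M → ℝ}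
    (hf : ∀ y x, f (y, x) = φ y) : BilinField.conformalProd f g h =
      BilinField.warpedProdFst (g.scale fun y => (φ y ^ 2)⁻¹) (fun y => (φ y)⁻¹) h := by
  funext p
  refine ContinuousLinearMap.ext fun X => ContinuousLinearMap.ext fun Y => ?_
  have hp : f p = φ p.1 := hf p.1 p.2
  change (f p ^ 2)⁻¹ * (BilinField.prod g h p X Y) = _ + (φ p.1)⁻¹ ^ 2 * _
  rw [BilinField.prod_apply, hp, inv_pow, mul_add]
  rfl

theorem BilinField.conformalProd_eq_warpedProdSnd {f : M × N → ℝ} {ψ : N → ℝ}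
    (hf : ∀ y x, f (y, x) = ψ x) : BilinField.conformalProd f g h =
      BilinField.warpedProdSnd g (fun x => (ψ x)⁻¹) (h.scale fun x => (ψ x ^ 2)⁻¹) := by
  funext p
  refine ContinuousLinearMap.ext fun X => ContinuousLinearMap.ext fun Y => ?_
  have hp : f p = ψ p.2 := hf p.1 p.2
  change (f p ^ 2)⁻¹ * (BilinField.prod g h p X Y) = (ψ p.2)⁻¹ ^ 2 * _ + _
  rw [BilinField.prod_apply, hp, inv_pow, mul_add]
  rfl

theorem BilinField.IsPseudoRiemannian.laplacian_eq (hg : g.IsPseudoRiemannian 3) {a α : M → ℝ}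
    (ha : g.HessianEq a α) (y : M) : g.laplacian a y = Module.finrank ℝ E * α y := by
  have hu := chartAt_mem_chartDom (E := E) (mem_univ y)
  have := (hg.isMetricOn (chart_mem_atlas E y) isOpen_univ).laplacian_eq hu
    fun X Y => ha _ (chart_mem_atlas E y) _ hu.1 X Y
  rw [extend_symm_chartAt] at this
  exact this

theorem RicciHessEqOn.hessianEq {a K α : M → ℝ} (hK : RicciHessEqOn g a K α univ) :
    g.HessianEq a α := fun e he u hu X Y =>
  (hK e he u (by rwa [chartDom_univ]) X Y).2

theorem RicciHessEqOn.ricciEq {a K α : M → ℝ} (hK : RicciHessEqOn g a K α univ) :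
    g.RicciEq K := fun e he u hu _ X Y =>
  (hK e he u (by rwa [chartDom_univ]) X Y).1

theorem BilinField.HessianEq.affine {a α : M → ℝ} (ha : g.HessianEq a α)
    (hac : ContMDiff 𝓘(ℝ, E) 𝓘(ℝ, ℝ) 4 a) (s t : ℝ) :
    g.HessianEq (fun y => s * a y + t) (fun y => s * α y) := by
  intro e he u hu X Y
  have hu' : u ∈ chartDom e univ := by rwa [chartDom_univ]
  have h1 : ContDiffAt ℝ 4 (a ∘ (e.extend 𝓘(ℝ, E)).symm) u :=
    (hac.contMDiffOn.contDiffOn_chart le_rfl he).contDiffAt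
      ((isOpen_chartDom e isOpen_univ).mem_nhds hu')
  have h2 := LocalGeometry.hessian_affine (g.inChart e) (h1.of_le (by norm_num)) s t
  change LocalGeometry.hessian (g.inChart e)
    (fun v => s * (a ∘ (e.extend 𝓘(ℝ, E)).symm) v + t) u X Y = _
  rw [h2, smul_apply, smul_apply, ha e he u hu X Y, smul_eq_mul, mul_assoc]

theorem BilinField.HessianEq.congr {a α α' : M → ℝ} (ha : g.HessianEq a α)
    (hα : ∀ y, α y = α' y) : g.HessianEq a α' := by
  rwa [← funext hα]

theorem BilinField.RicciEq.congr {ρ ρ' : M → ℝ} (ha : g.RicciEq ρ)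
    (hρ : ∀ y, ρ y = ρ' y) : g.RicciEq ρ' := by
  rwa [← funext hρ]

theorem not_exists_const {X : Type*} {φ : X → ℝ} (h : ∃ y ∈ (univ : Set X), ∃ y' ∈ (univ : Set X),
    φ y ≠ φ y') : ¬ ∃ t, ∀ y, φ y = t := by
  obtain ⟨y, -, y', -, hne⟩ := h
  rintro ⟨t, ht⟩
  exact hne (by rw [ht, ht])

/-- The classification of the Einstein metrics conformal to products. -/
theorem einstein_conformalProd_classification [ConnectedSpace M] [ConnectedSpace N] {n m : ℕ}
    (hn : 1 ≤ n) (hm : 1 ≤ m) (hnm : 3 ≤ n + m) (hnE : Module.finrank ℝ E = n)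
    (hmE : Module.finrank ℝ E' = m) {f : M × N → ℝ}
    (hg : g.IsPseudoRiemannian 3) (hh : h.IsPseudoRiemannian 3)
    (hf : ContMDiff (𝓘(ℝ, E).prod 𝓘(ℝ, E')) 𝓘(ℝ, ℝ) 4 f) (h0 : ∀ p, f p ≠ 0)
    (hE : (BilinField.conformalProd f g h).IsEinstein) :
    ((∃ φ : M → ℝ, (∀ y x, f (y, x) = φ y) ∧
          BilinField.conformalProd f g h =
            BilinField.warpedProdFst (g.scale fun y => (φ y ^ 2)⁻¹) (fun y => (φ y)⁻¹) h ∧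
          h.IsEinstein) ∨
        (∃ ψ : N → ℝ, (∀ y x, f (y, x) = ψ x) ∧
          BilinField.conformalProd f g h =
            BilinField.warpedProdSnd g (fun x => (ψ x)⁻¹) (h.scale fun x => (ψ x ^ 2)⁻¹) ∧
          g.IsEinstein)) ∨
      (∃ (a : M → ℝ) (b : N → ℝ) (k : M → ℝ) (l : N → ℝ),
        ContMDiff 𝓘(ℝ, E) 𝓘(ℝ, ℝ) 4 a ∧ ContMDiff 𝓘(ℝ, E') 𝓘(ℝ, ℝ) 4 b ∧
        (¬ ∃ t, ∀ y, a y = t) ∧ (¬ ∃ t, ∀ x, b x = t) ∧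
        (∀ y x, f (y, x) = a y + b x) ∧
        g.RicciEq (fun y => ((n : ℝ) - 1) * k y) ∧ h.RicciEq (fun x => ((m : ℝ) - 1) * l x) ∧
        g.HessianEq a (fun y => g.laplacian a y / n) ∧
        h.HessianEq b (fun x => h.laplacian b x / m) ∧
        (¬ (n = 2 ∧ m = 2) → ∃ κ c : ℝ, (∀ y, k y = κ) ∧ (∀ x, l x = -κ) ∧
          g.HessianEq a (fun y => -k y * a y + c) ∧ h.HessianEq b (fun x => -l x * b x + c)) ∧
        (n = 2 ∧ m = 2 →
          (∃ κ : ℝ, (∀ y, k y = κ) ∧ (∀ x, l x = -κ)) ∨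
          ((¬ ∃ t, ∀ y, k y = t) ∧ (¬ ∃ t, ∀ x, l x = t) ∧
            ContMDiff 𝓘(ℝ, E) 𝓘(ℝ, ℝ) 2 k ∧ ContMDiff 𝓘(ℝ, E') 𝓘(ℝ, ℝ) 2 l ∧
            g.HessianEq k (fun y => g.laplacian k y / 2) ∧
            h.HessianEq l (fun x => h.laplacian l x / 2)))) := by
  have : Nontrivial E := Module.nontrivial_of_finrank_pos (R := ℝ) (by omega)
  have : Nontrivial E' := Module.nontrivial_of_finrank_pos (R := ℝ) (by omega)
  have hd : 3 ≤ Module.finrank ℝ E + Module.finrank ℝ E' := by omega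
  have hE' : (BilinField.conformalProd f g h).IsEinsteinOn (univ ×ˢ univ) := by
    rw [univ_prod_univ]; exact hE
  obtain ⟨a, b, lam, ha, hb, hsum, hS⟩ := hE'.exists_isSplitEinstein hg hh hd isOpen_univ
    isOpen_univ isConnected_univ isConnected_univ hf.contMDiffOn (fun q _ => h0 q)
  have h0' : ∀ y ∈ (univ : Set M), ∀ x ∈ (univ : Set N), a y + b x ≠ 0 := fun y hy x hx => by
    rw [← hsum y hy x hx]; exact h0 _
  obtain ⟨y₀⟩ : Nonempty M := inferInstance
  obtain ⟨x₀⟩ : Nonempty N := inferInstance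
  by_cases hbV : ∃ x ∈ (univ : Set N), ∃ x' ∈ (univ : Set N), b x ≠ b x'
  swap
  · push Not at hbV
    have hφ : ∀ y x, f (y, x) = a y + b x₀ := fun y x => by
      rw [hsum y (mem_univ _) x (mem_univ _), hbV x (mem_univ _) x₀ (mem_univ _)]
    exact Or.inl (Or.inl ⟨_, hφ, BilinField.conformalProd_eq_warpedProdFst hφ,
      hS.isEinsteinOn_snd ⟨y₀, mem_univ _⟩ h0' ⟨b x₀, fun x _ => hbV x (mem_univ _) x₀ (mem_univ _)⟩
        isOpen_univ⟩)
  by_cases haU : ∃ y ∈ (univ : Set M), ∃ y' ∈ (univ : Set M), a y ≠ a y'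
  swap
  · push Not at haU
    have hψ : ∀ y x, f (y, x) = a y₀ + b x := fun y x => by
      rw [hsum y (mem_univ _) x (mem_univ _), haU y (mem_univ _) y₀ (mem_univ _)]
    exact Or.inl (Or.inr ⟨_, hψ, BilinField.conformalProd_eq_warpedProdSnd hψ,
      hS.swap.isEinsteinOn_snd ⟨x₀, mem_univ _⟩
        (fun x hx y hy => by rw [add_comm]; exact h0' y hy x hx)
        ⟨a y₀, fun y _ => haU y (mem_univ _) y₀ (mem_univ _)⟩ isOpen_univ⟩)
  right
  obtain ⟨K, α, L, β, s, t, t', c, hK, hL, hKa, hLb, hs1, hs2, htt⟩ := hS.exists_structure hd hg hh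
    isOpen_univ isOpen_univ isPreconnected_univ isPreconnected_univ ha hb h0' haU hbV
    (n := n) (m := m) (by rw [hnE]) (by rw [hmE]) rfl
  replace hKa := fun y => hKa y (mem_univ y)
  replace hLb := fun x => hLb x (mem_univ x)
  rw [contMDiffOn_univ] at ha hb
  have hn1 : (1 : ℝ) ≤ n := by exact_mod_cast hn
  have hm1 : (1 : ℝ) ≤ m := by exact_mod_cast hm
  have hD : (0 : ℝ) < n + m - 2 := by
    have : (3 : ℝ) ≤ n + m := by exact_mod_cast hnm
    linarith
  -- the common constant is read off from a factor of dimension at least two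
  obtain ⟨κ, hκ1, hκ2⟩ : ∃ κ : ℝ, t = (n - 1) * κ ∧ t' = -((m - 1) * κ) := by
    by_cases h1 : n = 1
    · have hm2 : (m : ℝ) - 1 ≠ 0 := by
        have : (2 : ℝ) ≤ m := by exact_mod_cast (by omega : 2 ≤ m)
        intro h; linarith
      subst h1
      refine ⟨-(t' / (m - 1)), ?_, by field_simp⟩
      have : ((m : ℝ) - 1) * t = 0 := by
        simp only [Nat.cast_one, sub_self, zero_mul, add_zero] at htt; exact htt
      simp [(mul_eq_zero.1 this).resolve_left hm2]
    · have hn2 : (n : ℝ) - 1 ≠ 0 := by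
        have : (2 : ℝ) ≤ n := by exact_mod_cast (by omega : 2 ≤ n)
        intro h; linarith
      refine ⟨t / (n - 1), by field_simp, ?_⟩
      field_simp
      linarith
  have hs_cases : ¬(n = 2 ∧ m = 2) → s = 0 := by
    intro hne
    by_cases h2 : n = 2
    · have : (m : ℝ) - 2 ≠ 0 := fun h => hne ⟨h2, by
        have : (m : ℝ) = 2 := by linarith
        exact_mod_cast this⟩
      exact (mul_eq_zero.1 hs2).resolve_left this
    · have : (n : ℝ) - 2 ≠ 0 := fun h => h2 (by
        have : (n : ℝ) = 2 := by linarith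
        exact_mod_cast this)
      exact (mul_eq_zero.1 hs1).resolve_left this
  have hHa := hK.hessianEq
  have hHb := hL.hessianEq
  -- for a factor of dimension one the Ricci equation is void and the curvature is chosen to be `±κ`
  refine ⟨a, b, fun y => if n = 1 then κ else K y / (n - 1),
    fun x => if m = 1 then -κ else L x / (m - 1), ha, hb, not_exists_const haU, not_exists_const hbV,
    fun y x => hsum y (mem_univ _) x (mem_univ _), hK.ricciEq.congr fun y => ?_,
    hL.ricciEq.congr fun x => ?_, hHa.congr fun y => ?_, hHb.congr fun x => ?_, fun hne => ?_,
    ?_⟩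
  · by_cases h1 : n = 1
    · have hs0 := hs_cases (by omega)
      simp [(hKa y).1, hs0, hκ1, h1]
    · have hn2 : (n : ℝ) - 1 ≠ 0 := by
        have : (2 : ℝ) ≤ n := by exact_mod_cast (by omega : 2 ≤ n)
        intro h; linarith
      simp only [if_neg h1]
      field_simp
  · by_cases h1 : m = 1
    · have hs0 := hs_cases (by omega)
      simp [(hLb x).1, hs0, hκ2, h1]
    · have hn2 : (m : ℝ) - 1 ≠ 0 := by
        have : (2 : ℝ) ≤ m := by exact_mod_cast (by omega : 2 ≤ m)
        intro h; linarith
      simp only [if_neg h1]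
      field_simp
  · rw [hg.laplacian_eq hHa, hnE]
    field_simp
  · rw [hh.laplacian_eq hHb, hmE]
    field_simp
  · have hs0 := hs_cases hne
    have hk : ∀ y, (if n = 1 then κ else K y / ((n : ℝ) - 1)) = κ := by
      intro y
      split_ifs with h1
      · rfl
      · have hn2 : (n : ℝ) - 1 ≠ 0 := by
          have : (2 : ℝ) ≤ n := by exact_mod_cast (by omega : 2 ≤ n)
          intro h; linarith
        rw [(hKa y).1, hs0, hκ1]
        field_simp
        ring
    have hl : ∀ x, (if m = 1 then -κ else L x / ((m : ℝ) - 1)) = -κ := by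
      intro x
      split_ifs with h1
      · rfl
      · have hn2 : (m : ℝ) - 1 ≠ 0 := by
          have : (2 : ℝ) ≤ m := by exact_mod_cast (by omega : 2 ≤ m)
          intro h; linarith
        rw [(hLb x).1, hs0, hκ2]
        field_simp
        ring
    refine ⟨κ, c / (n + m - 2), hk, hl, hHa.congr fun y => ?_, hHb.congr fun x => ?_⟩
    · simp only [hk]
      have := (hKa y).2
      rw [hs0, hκ1, hκ2] at this
      field_simp
      linarith
    · simp only [hl]
      have := (hLb x).2
      rw [hs0, hκ1, hκ2] at this
      field_simp
      linarith
  · rintro ⟨rfl, rfl⟩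
    have hk : (fun y => if (2 : ℕ) = 1 then κ else K y / (((2 : ℕ) : ℝ) - 1)) =
        fun y => s * a y + t := by
      funext y
      rw [if_neg (by norm_num), (hKa y).1]
      norm_num
    have hl : (fun x => if (2 : ℕ) = 1 then -κ else L x / (((2 : ℕ) : ℝ) - 1)) =
        fun x => s * b x + t' := by
      funext y
      rw [if_neg (by norm_num), (hLb y).1]
      norm_num
    rw [hk, hl]
    by_cases hs0 : s = 0
    · left
      refine ⟨κ, fun y => ?_, fun x => ?_⟩
      · simp only [hs0, hκ1]; norm_num
      · simp only [hs0, hκ2]; norm_num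
    · right
      have hka := hHa.affine ha s t
      have hlb := hHb.affine hb s t'
      refine ⟨?_, ?_, ?_, ?_, hka.congr fun y => ?_, hlb.congr fun x => ?_⟩
      · rintro ⟨r, hr⟩
        refine not_exists_const haU ⟨(r - t) / s, fun y => ?_⟩
        have := hr y
        field_simp
        linarith
      · rintro ⟨r, hr⟩
        refine not_exists_const hbV ⟨(r - t') / s, fun y => ?_⟩
        have := hr y
        field_simp
        linarith
      · exact ((contMDiff_const.mul ha).add contMDiff_const).of_le (by norm_num)
      · exact ((contMDiff_const.mul hb).add contMDiff_const).of_le (by norm_num)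
      · rw [hg.laplacian_eq hka, hnE]
        norm_num
      · rw [hh.laplacian_eq hlb, hmE]
        norm_num

end

/-! ### Converse statements -/

noncomputable section

variable {E : Type*} [NormedAddCommGroup E] [NormedSpace ℝ E]
  {M : Type*} [TopologicalSpace M] [ChartedSpace E M]
  {E' : Type*} [NormedAddCommGroup E'] [NormedSpace ℝ E']
  {N : Type*} [TopologicalSpace N] [ChartedSpace E' N]

/-- The squared norm of the gradient of a function on a pseudo-Riemannian manifold, defined without
reference to charts. -/
def BilinField.gradSq (g : BilinField 𝓘(ℝ, E) M) (a : M → ℝ) (p : M) : ℝ :=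
  let d : E →L[ℝ] ℝ := mfderiv 𝓘(ℝ, E) 𝓘(ℝ, ℝ) a p
  let B : E →L[ℝ] E →L[ℝ] ℝ := g p
  d (B.inverse d)

variable {g : BilinField 𝓘(ℝ, E) M} {h : BilinField 𝓘(ℝ, E') N}
  [FiniteDimensional ℝ E] [FiniteDimensional ℝ E']
  [IsManifold 𝓘(ℝ, E) 4 M] [IsManifold 𝓘(ℝ, E') 4 N]

theorem BilinField.IsPseudoRiemannian.isInvertible {r : WithTop ℕ∞} (hg : g.IsPseudoRiemannian r)
    (p : M) : ContinuousLinearMap.IsInvertible (show E →L[ℝ] E →L[ℝ] ℝ from g p) :=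
  LocalGeometry.isInvertible_of_nondegenerate fun X hX => hg.nondegenerate p X hX

omit [FiniteDimensional ℝ E] [FiniteDimensional ℝ E'] in
theorem eq_zero_of_forall_add_eq_zero {B : E →L[ℝ] E →L[ℝ] ℝ} {B' : E' →L[ℝ] E' →L[ℝ] ℝ}
    (hB : ∀ X, (∀ Y, B X Y = 0) → X = 0) (hB' : ∀ X, (∀ Y, B' X Y = 0) → X = 0) {X : E × E'}
    (hX : ∀ Y : E × E', B X.1 Y.1 + B' X.2 Y.2 = 0) : X = 0 :=
  Prod.ext (hB _ fun Y => by simpa using hX (Y, 0)) (hB' _ fun Y => by simpa using hX (0, Y))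

theorem fderiv_chart_comp {a : M → ℝ} {e : OpenPartialHomeomorph M E} (he : e ∈ atlas E M) {u : E}
    (hu : u ∈ (e.extend 𝓘(ℝ, E)).target)
    (ha : MDifferentiableAt 𝓘(ℝ, E) 𝓘(ℝ, ℝ) a ((e.extend 𝓘(ℝ, E)).symm u)) (X : E) :
    fderiv ℝ (a ∘ (e.extend 𝓘(ℝ, E)).symm) u X =
      mfderiv 𝓘(ℝ, E) 𝓘(ℝ, ℝ) a ((e.extend 𝓘(ℝ, E)).symm u)
        (mfderiv 𝓘(ℝ, E) 𝓘(ℝ, E) (e.extend 𝓘(ℝ, E)).symm u X) := by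
  have h1 := ha.hasMFDerivAt.comp u (mdifferentiableAt_extend_symm he hu).hasMFDerivAt
  have h2 := h1.mfderiv
  rw [mfderiv_eq_fderiv] at h2
  exact congrArg (fun T : E →L[ℝ] ℝ => T X) h2

theorem BilinField.IsPseudoRiemannian.gradSq_inChart (hg : g.IsPseudoRiemannian 3) {a : M → ℝ}
    {e : OpenPartialHomeomorph M E} (he : e ∈ atlas E M) {u : E}
    (hu : u ∈ (e.extend 𝓘(ℝ, E)).target)
    (ha : MDifferentiableAt 𝓘(ℝ, E) 𝓘(ℝ, ℝ) a ((e.extend 𝓘(ℝ, E)).symm u)) :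
    LocalGeometry.gradSq (g.inChart e) (a ∘ (e.extend 𝓘(ℝ, E)).symm) u =
      g.gradSq a ((e.extend 𝓘(ℝ, E)).symm u) := by
  have hG := hg.isMetricOn he isOpen_univ
  have hu' : u ∈ chartDom e univ := by rwa [chartDom_univ]
  set T := mfderiv 𝓘(ℝ, E) 𝓘(ℝ, E) (e.extend 𝓘(ℝ, E)).symm u with hT
  set v := LocalGeometry.sharp (g.inChart e) u (fderiv ℝ (a ∘ (e.extend 𝓘(ℝ, E)).symm) u) with hv
  let B : E →L[ℝ] E →L[ℝ] ℝ := g ((e.extend 𝓘(ℝ, E)).symm u)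
  let d : E →L[ℝ] ℝ := mfderiv 𝓘(ℝ, E) 𝓘(ℝ, ℝ) a ((e.extend 𝓘(ℝ, E)).symm u)
  have key : B (T v) = d := by
    refine ContinuousLinearMap.ext fun Z => ?_
    obtain ⟨Y, hY⟩ := (isInvertible_mfderiv_extend_symm he hu).surjective Z
    have h1 := congrArg (fun w : E →L[ℝ] ℝ => w Y)
      (hG.apply_sharp hu' (fderiv ℝ (a ∘ (e.extend 𝓘(ℝ, E)).symm) u))
    rw [← hY]
    exact h1.trans (fderiv_chart_comp he hu ha Y)
  have hinv : B.inverse d = T v := by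
    rw [← key]
    exact (hg.isInvertible _).inverse_apply_self _
  change fderiv ℝ (a ∘ (e.extend 𝓘(ℝ, E)).symm) u v = d (B.inverse d)
  rw [hinv]
  exact fderiv_chart_comp he hu ha v

/-- If `∇²a = α g` then `d|∇a|² = 2 α da`. -/
theorem BilinField.HessianEq.hasFDerivAt_gradSq (hg : g.IsPseudoRiemannian 3) {a α : M → ℝ}
    (ha : ContMDiff 𝓘(ℝ, E) 𝓘(ℝ, ℝ) 4 a) (hα : g.HessianEq a α)
    {e : OpenPartialHomeomorph M E} (he : e ∈ atlas E M) {u : E}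
    (hu : u ∈ (e.extend 𝓘(ℝ, E)).target) :
    HasFDerivAt (g.gradSq a ∘ (e.extend 𝓘(ℝ, E)).symm)
      ((2 * α ((e.extend 𝓘(ℝ, E)).symm u)) • fderiv ℝ (a ∘ (e.extend 𝓘(ℝ, E)).symm) u) u := by
  have hG := hg.isMetricOn he isOpen_univ
  have hu' : u ∈ chartDom e univ := by rwa [chartDom_univ]
  have hac : ContDiffAt ℝ 4 (a ∘ (e.extend 𝓘(ℝ, E)).symm) u :=
    (ha.contMDiffOn.contDiffOn_chart le_rfl he).contDiffAt
      ((isOpen_chartDom e isOpen_univ).mem_nhds hu')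
  refine (hG.hasFDerivAt_gradSq hu' (hac.of_le (by norm_num))
    fun X Y => hα e he u hu X Y).congr_of_eventuallyEq ?_
  filter_upwards [(isOpen_extend_target e).mem_nhds hu] with v hv
  exact (hg.gradSq_inChart he hv (ha.mdifferentiableAt (by norm_num))).symm

/-- The first integral of the equation `∇²a = (r a + c) g`. -/
theorem BilinField.HessianEq.exists_gradSq_eq [ConnectedSpace M] (hg : g.IsPseudoRiemannian 3)
    {a : M → ℝ} (ha : ContMDiff 𝓘(ℝ, E) 𝓘(ℝ, ℝ) 4 a) {r c : ℝ}
    (hα : g.HessianEq a fun y => r * a y + c) :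
    ∃ C, ∀ y, g.gradSq a y = r * a y ^ 2 + 2 * c * a y + C := by
  obtain ⟨y₀⟩ : Nonempty M := inferInstance
  refine ⟨g.gradSq a y₀ - (r * a y₀ ^ 2 + 2 * c * a y₀), fun y => ?_⟩
  have key := eq_of_hasFDerivAt_chart_zero (E := E)
    (φ := fun y => g.gradSq a y - (r * a y ^ 2 + 2 * c * a y)) isOpen_univ isPreconnected_univ ?_
    (mem_univ y) (mem_univ y₀)
  · linarith
  intro e he u hu
  have hac : ContDiffAt ℝ 4 (a ∘ (e.extend 𝓘(ℝ, E)).symm) u :=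
    (ha.contMDiffOn.contDiffOn_chart le_rfl he).contDiffAt
      ((isOpen_chartDom e isOpen_univ).mem_nhds hu)
  have h1 := hα.hasFDerivAt_gradSq hg ha he hu.1
  have h2 := (hac.differentiableAt (by norm_num)).hasFDerivAt
  have h3 := h1.sub (((h2.pow 2).const_mul r).add (h2.const_mul (2 * c)))
  refine h3.congr_fderiv ?_
  ext X
  simp
  ring

theorem BilinField.IsPseudoRiemannian.conformalProd (hg : g.IsPseudoRiemannian 3)
    (hh : h.IsPseudoRiemannian 3) {f : M × N → ℝ}
    (hf : ContMDiff (𝓘(ℝ, E).prod 𝓘(ℝ, E')) 𝓘(ℝ, ℝ) 4 f) (h0 : ∀ p, f p ≠ 0) :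
    (BilinField.conformalProd f g h).IsPseudoRiemannian 3 where
  symm p X Y := by
    change (f p ^ 2)⁻¹ * (BilinField.prod g h p X Y) = (f p ^ 2)⁻¹ * (BilinField.prod g h p Y X)
    rw [BilinField.prod_apply, BilinField.prod_apply, hg.symm, hh.symm]
  nondegenerate p X hX := by
    have hX' : ∀ Y : E × E', g p.1 (Prod.fst (show E × E' from X)) Y.1 +
        h p.2 (Prod.snd (show E × E' from X)) Y.2 = 0 := by
      intro Y
      have h1 : (f p ^ 2)⁻¹ * (BilinField.prod g h p X Y) = 0 := hX Y
      have h2 := (BilinField.prod_apply g h p X Y).symm.trans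
        ((mul_eq_zero.1 h1).resolve_left (inv_ne_zero (pow_ne_zero 2 (h0 p))))
      have h4 : mfderiv (𝓘(ℝ, E).prod 𝓘(ℝ, E')) 𝓘(ℝ, E) (Prod.fst : M × N → M) p = _ :=
        mfderiv_fst
      have h5 : mfderiv (𝓘(ℝ, E).prod 𝓘(ℝ, E')) 𝓘(ℝ, E') (Prod.snd : M × N → N) p = _ :=
        mfderiv_snd
      rw [h4, h5] at h2
      exact h2
    exact eq_zero_of_forall_add_eq_zero (E := E) (E' := E') (hg.nondegenerate p.1) (hh.nondegenerate p.2) hX'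
  contDiffOn := by
    rintro _ ⟨e, he, e', he', rfl⟩
    have hF := hf.contMDiffOn (s := univ ×ˢ univ).contDiffOn_chart_prod he he'
    have h1 := ((hg.isMetricOn he isOpen_univ).prod (hh.isMetricOn he' isOpen_univ)).conformal
      (hF.of_le (by norm_num)) (fun q _ => h0 _)
    refine (h1.contDiffOn.congr fun q hq => ?_).mono fun q hq => ?_
    · exact BilinField.inChart_conformalProd g h f he he' ⟨hq.1.1, hq.2.1⟩
    · have := mem_extend_prod_target.1 hq
      rwa [← chartDom_univ, ← chartDom_univ] at this

/-- Sufficient conditions for `(a + b)⁻² (g + h)` to be Einstein, in terms of the factors of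
proportionality of the Ricci tensors and of the Hessians. -/
theorem BilinField.isEinstein_conformalProd (hg : g.IsPseudoRiemannian 3)
    (hh : h.IsPseudoRiemannian 3) {a K α : M → ℝ} {b L β : N → ℝ}
    (ha : ContMDiff 𝓘(ℝ, E) 𝓘(ℝ, ℝ) 4 a) (hb : ContMDiff 𝓘(ℝ, E') 𝓘(ℝ, ℝ) 4 b)
    (hK : g.RicciEq K) (hL : h.RicciEq L) (hα : g.HessianEq a α) (hβ : h.HessianEq b β)
    (h0 : ∀ y x, a y + b x ≠ 0) {n m lam : ℝ} (hn : n = Module.finrank ℝ E)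
    (hm : m = Module.finrank ℝ E')
    (h1 : ∀ y x, (a y + b x) * K y + (n + m - 2) * α y =
      (a y + b x) * L x + (n + m - 2) * β x)
    (h2 : ∀ y x, lam + (n + m - 1) * (g.gradSq a y + h.gradSq b x) =
      (a y + b x) * ((a y + b x) * K y + (n + m - 2) * α y + n * α y + m * β x)) :
    (BilinField.conformalProd (fun p => a p.1 + b p.2) g h).IsEinstein := by
  refine ⟨lam, ?_⟩
  rintro _ ⟨e, he, e', he', rfl⟩ p hp - X Y
  have hp := mem_extend_prod_target.1 hp
  have hp' : p ∈ chartDom e univ ×ˢ chartDom e' univ := by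
    rw [chartDom_univ, chartDom_univ]; exact hp
  have hG := hg.isMetricOn he isOpen_univ
  have hG' := hh.isMetricOn he' isOpen_univ
  have hac := (ha.contMDiffOn (s := univ)).contDiffOn_chart le_rfl he
  have hbc := (hb.contMDiffOn (s := univ)).contDiffOn_chart le_rfl he'
  have hric := hG.ricci_conformal_sum hG' (hac.of_le (by norm_num)) (hbc.of_le (by norm_num))
    (F := fun q => a ((e.extend 𝓘(ℝ, E)).symm q.1) + b ((e'.extend 𝓘(ℝ, E')).symm q.2))
    (fun q _ => rfl) (fun q _ => h0 _ _) hp' X Y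
  have hev : (BilinField.conformalProd (fun p => a p.1 + b p.2) g h).inChart (e.prod e')
      =ᶠ[nhds p] fun q =>
        ((a ((e.extend 𝓘(ℝ, E)).symm q.1) + b ((e'.extend 𝓘(ℝ, E')).symm q.2)) ^ 2)⁻¹ •
          LocalGeometry.prodMetric (g.inChart e) (h.inChart e') q := by
    filter_upwards [((isOpen_extend_target e).prod (isOpen_extend_target e')).mem_nhds
      (show p ∈ _ ×ˢ _ from hp)] with q hq
    rw [BilinField.inChart_conformalProd g h _ he he' hq]
  refine (LocalGeometry.ricci_congr hev X Y).trans (hric.trans ?_)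
  rw [hG.laplacian_eq hp'.1 fun X Y => hα e he p.1 hp.1 X Y,
    hG'.laplacian_eq hp'.2 fun X Y => hβ e' he' p.2 hp.2 X Y,
    hg.gradSq_inChart he hp.1 (ha.mdifferentiableAt (by norm_num)),
    hh.gradSq_inChart he' hp.2 (hb.mdifferentiableAt (by norm_num)),
    hα e he p.1 hp.1, hβ e' he' p.2 hp.2, hK e he p.1 hp.1 (mem_univ _),
    hL e' he' p.2 hp.2 (mem_univ _), hev.self_of_nhds, ← hn, ← hm]
  change _ = lam * ((_ ^ 2)⁻¹ * LocalGeometry.prodMetric _ _ _ _ _)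
  rw [LocalGeometry.prodMetric_apply]
  have e0 := h0 ((e.extend 𝓘(ℝ, E)).symm p.1) ((e'.extend 𝓘(ℝ, E')).symm p.2)
  have e1 := h1 ((e.extend 𝓘(ℝ, E)).symm p.1) ((e'.extend 𝓘(ℝ, E')).symm p.2)
  have e2 := h2 ((e.extend 𝓘(ℝ, E)).symm p.1) ((e'.extend 𝓘(ℝ, E')).symm p.2)
  generalize a ((e.extend 𝓘(ℝ, E)).symm p.1) = a₀ at *
  generalize b ((e'.extend 𝓘(ℝ, E')).symm p.2) = b₀ at *
  generalize K ((e.extend 𝓘(ℝ, E)).symm p.1) = K₀ at *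
  generalize L ((e'.extend 𝓘(ℝ, E')).symm p.2) = L₀ at *
  generalize α ((e.extend 𝓘(ℝ, E)).symm p.1) = α₀ at *
  generalize β ((e'.extend 𝓘(ℝ, E')).symm p.2) = β₀ at *
  generalize g.gradSq a ((e.extend 𝓘(ℝ, E)).symm p.1) = A₀ at *
  generalize h.gradSq b ((e'.extend 𝓘(ℝ, E')).symm p.2) = B₀ at *
  generalize g.inChart e p.1 X.1 Y.1 = G₀ at *
  generalize h.inChart e' p.2 X.2 Y.2 = H₀ at *
  field_simp
  linear_combination (-G₀ - H₀) * e2 - H₀ * (a₀ + b₀) * e1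

/-- Solutions of `∇²a = (-κ a + c) g` and `∇²b = (κ b + c) h` over factors of opposite constant
curvatures yield Einstein metrics. -/
theorem BilinField.isEinstein_conformalProd_of_constant [ConnectedSpace M] [ConnectedSpace N]
    (hg : g.IsPseudoRiemannian 3) (hh : h.IsPseudoRiemannian 3) {a : M → ℝ} {b : N → ℝ}
    {n m κ c : ℝ} (hn : n = Module.finrank ℝ E) (hm : m = Module.finrank ℝ E')
    (ha : ContMDiff 𝓘(ℝ, E) 𝓘(ℝ, ℝ) 4 a) (hb : ContMDiff 𝓘(ℝ, E') 𝓘(ℝ, ℝ) 4 b)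
    (hK : g.RicciEq fun _ => (n - 1) * κ) (hL : h.RicciEq fun _ => (m - 1) * (-κ))
    (hα : g.HessianEq a fun y => -κ * a y + c) (hβ : h.HessianEq b fun x => -(-κ) * b x + c)
    (h0 : ∀ y x, a y + b x ≠ 0) :
    (BilinField.conformalProd (fun p => a p.1 + b p.2) g h).IsEinstein := by
  obtain ⟨C, hC⟩ := hα.exists_gradSq_eq hg ha
  obtain ⟨C', hC'⟩ := hβ.exists_gradSq_eq hh hb
  refine BilinField.isEinstein_conformalProd hg hh ha hb hK hL hα hβ h0 hn hm
    (lam := -(n + m - 1) * (C + C')) (fun y x => ?_) fun y x => ?_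
  · ring
  · rw [hC, hC']
    ring

theorem BilinField.inChart_scale (ρ : M → ℝ) (e : OpenPartialHomeomorph M E) (u : E) :
    (g.scale ρ).inChart e u = ρ ((e.extend 𝓘(ℝ, E)).symm u) • g.inChart e u := rfl

theorem BilinField.IsPseudoRiemannian.scale {ρ : M → ℝ} (hg : g.IsPseudoRiemannian 3)
    (hρ : ContMDiff 𝓘(ℝ, E) 𝓘(ℝ, ℝ) 4 ρ) (h0 : ∀ y, ρ y ≠ 0) :
    (g.scale ρ).IsPseudoRiemannian 3 where
  symm p X Y := by
    change ρ p * g p X Y = ρ p * g p Y X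
    rw [hg.symm]
  nondegenerate p X hX := hg.nondegenerate p X fun Y => by
    have : ρ p * g p X Y = 0 := hX Y
    exact (mul_eq_zero.1 this).resolve_left (h0 p)
  contDiffOn e he := by
    have h1 := (hρ.contMDiffOn (s := univ)).contDiffOn_chart le_rfl he
    rw [chartDom_univ] at h1
    have h2 := (h1.of_le (m := 3) (by norm_num)).smul (hg.contDiffOn e he)
    exact h2.congr fun u _ => inChart_scale ρ e u

theorem BilinField.IsPseudoRiemannian.exists_warpedProdFst_eq (hg : g.IsPseudoRiemannian 3)
    {φ : M → ℝ} (hφ : ContMDiff 𝓘(ℝ, E) 𝓘(ℝ, ℝ) 4 φ) (h0 : ∀ y, 0 < φ y) :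
    ∃ (g' : BilinField 𝓘(ℝ, E) M) (f : M → ℝ), g'.IsPseudoRiemannian 3 ∧
      ContMDiff 𝓘(ℝ, E) 𝓘(ℝ, ℝ) 4 f ∧ (∀ y, 0 < f y) ∧
      BilinField.warpedProdFst g φ h = BilinField.conformalProd (fun p => f p.1) g' h := by
  have hinv : ContMDiff 𝓘(ℝ, E) 𝓘(ℝ, ℝ) 4 fun y => (φ y)⁻¹ := hφ.inv₀ fun y => (h0 y).ne'
  refine ⟨g.scale fun y => (φ y)⁻¹ ^ 2, fun y => (φ y)⁻¹,
    hg.scale (hinv.pow 2) fun y => pow_ne_zero 2 (inv_ne_zero (h0 y).ne'), hinv,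
    fun y => inv_pos.2 (h0 y), ?_⟩
  funext p
  refine ContinuousLinearMap.ext fun X => ContinuousLinearMap.ext fun Y => ?_
  have hp := (h0 p.1).ne'
  change g p.1 _ _ + φ p.1 ^ 2 * h p.2 _ _ =
    ((φ p.1)⁻¹ ^ 2)⁻¹ * ((φ p.1)⁻¹ ^ 2 * g p.1 _ _ + h p.2 _ _)
  field_simp

theorem BilinField.IsPseudoRiemannian.exists_warpedProdSnd_eq (hh : h.IsPseudoRiemannian 3)
    {ψ : N → ℝ} (hψ : ContMDiff 𝓘(ℝ, E') 𝓘(ℝ, ℝ) 4 ψ) (h0 : ∀ x, 0 < ψ x) :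
    ∃ (h' : BilinField 𝓘(ℝ, E') N) (f : N → ℝ), h'.IsPseudoRiemannian 3 ∧
      ContMDiff 𝓘(ℝ, E') 𝓘(ℝ, ℝ) 4 f ∧ (∀ x, 0 < f x) ∧
      BilinField.warpedProdSnd g ψ h = BilinField.conformalProd (fun p => f p.2) g h' := by
  have hinv : ContMDiff 𝓘(ℝ, E') 𝓘(ℝ, ℝ) 4 fun y => (ψ y)⁻¹ := hψ.inv₀ fun y => (h0 y).ne'
  refine ⟨h.scale fun y => (ψ y)⁻¹ ^ 2, fun y => (ψ y)⁻¹,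
    hh.scale (hinv.pow 2) fun y => pow_ne_zero 2 (inv_ne_zero (h0 y).ne'), hinv,
    fun y => inv_pos.2 (h0 y), ?_⟩
  funext p
  refine ContinuousLinearMap.ext fun X => ContinuousLinearMap.ext fun Y => ?_
  have hp := (h0 p.2).ne'
  change ψ p.2 ^ 2 * g p.1 _ _ + h p.2 _ _ =
    ((ψ p.2)⁻¹ ^ 2)⁻¹ * (g p.1 _ _ + (ψ p.2)⁻¹ ^ 2 * h p.2 _ _)
  field_simp

end

/-! ### An example with factors of non-constant curvature -/

noncomputable section

namespace LocalGeometry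

/-- The model space of surfaces. -/
abbrev Plane : Type := EuclideanSpace ℝ (Fin 2)

/-- The `i`-th coordinate of the plane. -/
abbrev coord (i : Fin 2) : Plane →L[ℝ] ℝ := EuclideanSpace.proj i

/-- The `i`-th coordinate vector of the plane. -/
abbrev vec (i : Fin 2) : Plane := EuclideanSpace.single i 1

theorem eq_zero_of_coord {X : Plane} (h0 : X 0 = 0) (h1 : X 1 = 0) : X = 0 := by
  ext i; fin_cases i
  · exact h0
  · exact h1

end LocalGeometry

namespace NonConstantCurvature

open LocalGeometry

/-- The metric `e^{-x} dx² + e^{3x} dy²`, of Gaussian curvature `-3 e^x`. -/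
def metric (u : Plane) : Plane →L[ℝ] Plane →L[ℝ] ℝ :=
  Real.exp (-(u 0)) • (coord 0).smulRight (coord 0) +
    Real.exp (3 * u 0) • (coord 1).smulRight (coord 1)

theorem metric_apply (u X Y : Plane) :
    metric u X Y = Real.exp (-(u 0)) * (X 0 * Y 0) + Real.exp (3 * u 0) * (X 1 * Y 1) := by
  simp [metric]

theorem hasFDerivAt_coord (i : Fin 2) (u : Plane) :
    HasFDerivAt (fun v : Plane => v i) (coord i) u := (coord i).hasFDerivAt

theorem hasFDerivAt_exp_coord (r : ℝ) (u : Plane) :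
    HasFDerivAt (fun v : Plane => Real.exp (r * v 0)) ((Real.exp (r * u 0) * r) • coord 0) u := by
  rw [mul_smul]
  exact ((hasFDerivAt_coord 0 u).const_mul r).exp

theorem contDiff_exp_coord (r : ℝ) {n : WithTop ℕ∞} :
    ContDiff ℝ n (fun v : Plane => Real.exp (r * v 0)) :=
  Real.contDiff_exp.comp (contDiff_const.mul (coord 0).contDiff)

theorem metric_eq : metric = fun u => Real.exp (-1 * u 0) • (coord 0).smulRight (coord 0) +
    Real.exp (3 * u 0) • (coord 1).smulRight (coord 1) := by
  funext u; simp [metric]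

theorem contDiff_metric {n : WithTop ℕ∞} : ContDiff ℝ n metric := by
  rw [metric_eq]
  exact ((contDiff_exp_coord _).smul contDiff_const).add
    ((contDiff_exp_coord _).smul contDiff_const)

theorem isMetricOn_metric : IsMetricOn metric univ where
  isOpen := isOpen_univ
  contDiffOn := contDiff_metric.contDiffOn
  symm u _ X Y := by rw [metric_apply, metric_apply]; ring
  nondegenerate u _ X h := by
    have h0 := h (vec 0)
    have h1 := h (vec 1)
    simp [metric_apply] at h0 h1
    exact eq_zero_of_coord h0 h1

theorem fderiv_metric_apply (u X Y Z : Plane) : fderiv ℝ metric u X Y Z =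
    X 0 * (-Real.exp (-(u 0)) * (Y 0 * Z 0) + 3 * Real.exp (3 * u 0) * (Y 1 * Z 1)) := by
  have h := ((hasFDerivAt_exp_coord (-1) u).smul_const ((coord 0).smulRight (coord 0))).add
    ((hasFDerivAt_exp_coord 3 u).smul_const ((coord 1).smulRight (coord 1)))
  rw [metric_eq]
  refine (congrArg (fun T : Plane →L[ℝ] Plane →L[ℝ] Plane →L[ℝ] ℝ => T X Y Z) h.fderiv).trans ?_
  simp
  ring

/-- The constant part of the Christoffel symbols of the metric `e^{-x} dx² + e^{3x} dy²`. -/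
def christoffelConst : Plane →L[ℝ] Plane →L[ℝ] Plane :=
  (coord 0).smulRight ((coord 0).smulRight ((-(1 / 2) : ℝ) • vec 0)
    + (coord 1).smulRight ((3 / 2 : ℝ) • vec 1))
    + (coord 1).smulRight ((coord 0).smulRight ((3 / 2 : ℝ) • vec 1))

/-- The coefficient of `e^{4x}` in the Christoffel symbols of the metric
`e^{-x} dx² + e^{3x} dy²`. -/
def christoffelExp : Plane →L[ℝ] Plane →L[ℝ] Plane :=
  (coord 1).smulRight ((coord 1).smulRight ((-(3 / 2) : ℝ) • vec 0))

theorem christoffelConst_apply (X Y : Plane) : christoffelConst X Y =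
    (-(1 / 2) * (X 0 * Y 0)) • vec 0 + (3 / 2 * (X 0 * Y 1 + X 1 * Y 0)) • vec 1 := by
  ext i; fin_cases i <;> simp [christoffelConst] <;> ring

theorem christoffelExp_apply (X Y : Plane) : christoffelExp X Y =
    (-(3 / 2) * (X 1 * Y 1)) • vec 0 := by
  ext i; fin_cases i <;> simp [christoffelExp]; ring

theorem christoffel_metric :
    christoffel metric = fun u => christoffelConst + Real.exp (4 * u 0) • christoffelExp := by
  funext u
  refine ContinuousLinearMap.ext fun X => ContinuousLinearMap.ext fun Y => ?_
  refine isMetricOn_metric.christoffel_eq (mem_univ u) fun Z => ?_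
  have h4 : Real.exp (3 * u 0) = Real.exp (-(u 0)) * Real.exp (4 * u 0) := by
    rw [← Real.exp_add]; ring_nf
  rw [christoffelFirst_apply, fderiv_metric_apply, fderiv_metric_apply, fderiv_metric_apply,
    metric_apply, add_apply, add_apply, smul_apply, smul_apply, christoffelConst_apply,
    christoffelExp_apply, h4]
  simp
  ring

theorem fderiv_christoffel_metric_apply (u X Y Z : Plane) :
    fderiv ℝ (christoffel metric) u X Y Z =
      (4 * Real.exp (4 * u 0) * X 0) • christoffelExp Y Z := by
  have h := ((hasFDerivAt_exp_coord 4 u).smul_const christoffelExp).const_add christoffelConst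
  rw [christoffel_metric, h.fderiv]
  simp
  ring_nf

theorem ricci_metric (u X Y : Plane) :
    ricci metric u X Y = -3 * Real.exp (u 0) * metric u X Y := by
  have h4 : Real.exp (4 * u 0) = Real.exp (u 0) * Real.exp (3 * u 0) := by
    rw [← Real.exp_add]; ring_nf
  have h1 : Real.exp (u 0) * Real.exp (-(u 0)) = 1 := by
    rw [← Real.exp_add]; simp
  rw [ricci, LinearMap.trace_eq_sum_inner _ (EuclideanSpace.basisFun (Fin 2) ℝ), metric_apply]
  simp only [ricciEndo, riemann, fderiv_christoffel_metric_apply]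
  simp only [christoffel_metric, add_apply,
    smul_apply, christoffelConst_apply, christoffelExp_apply, Fin.sum_univ_two]
  simp [EuclideanSpace.inner_single_left]
  rw [h4]
  linear_combination (3 * X 0 * Y 0) * h1

/-- The conformal factor of the example is `e^x + e^{x'}`. -/
def expCoord (u : Plane) : ℝ := Real.exp (u 0)

theorem hasFDerivAt_expCoord (u : Plane) : HasFDerivAt expCoord (Real.exp (u 0) • coord 0) u :=
  (hasFDerivAt_coord 0 u).exp

theorem contDiff_expCoord {n : WithTop ℕ∞} : ContDiff ℝ n expCoord :=
  Real.contDiff_exp.comp (coord 0).contDiff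

theorem hessian_expCoord (u X Y : Plane) :
    hessian metric expCoord u X Y = 3 / 2 * Real.exp (u 0) ^ 2 * metric u X Y := by
  have h4 : Real.exp (4 * u 0) = Real.exp (u 0) * Real.exp (3 * u 0) := by
    rw [← Real.exp_add]; ring_nf
  have h1 : Real.exp (u 0) * Real.exp (-(u 0)) = 1 := by
    rw [← Real.exp_add]; simp
  have hd : fderiv ℝ expCoord = fun v => Real.exp (v 0) • coord 0 :=
    funext fun v => (hasFDerivAt_expCoord v).fderiv
  have hdd : HasFDerivAt (fderiv ℝ expCoord)
      ((Real.exp (u 0) • coord 0).smulRight (coord 0)) u := by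
    rw [hd]
    exact (hasFDerivAt_expCoord u).smul_const (coord 0)
  rw [hessian_apply, hdd.fderiv, hd, christoffel_metric, metric_apply]
  simp only [add_apply, smul_apply, christoffelConst_apply, christoffelExp_apply]
  simp
  rw [h4]
  linear_combination (-(3 / 2) * Real.exp (u 0) * X 0 * Y 0) * h1

theorem gradSq_expCoord (u : Plane) : gradSq metric expCoord u = Real.exp (u 0) ^ 3 := by
  have h1 : Real.exp (u 0) * Real.exp (-(u 0)) = 1 := by
    rw [← Real.exp_add]; simp
  have hs : sharp metric u (Real.exp (u 0) • coord 0) = Real.exp (u 0) ^ 2 • vec 0 := by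
    refine isMetricOn_metric.ext_apply (mem_univ u) fun Z => ?_
    rw [isMetricOn_metric.apply_sharp (mem_univ u), metric_apply]
    simp
    linear_combination (-Real.exp (u 0) * Z 0) * h1
  rw [gradSq, (hasFDerivAt_expCoord u).fderiv, hs]
  simp
  ring

/-- The metric `e^{-x} dx² + e^{3x} dy²` as a tensor field on the manifold `ℝ²`. -/
def field : BilinField (𝓡 2) Plane := metric

theorem inChart_field {e : OpenPartialHomeomorph Plane Plane} (he : e ∈ atlas Plane Plane) :
    field.inChart e = metric := by
  rw [chartedSpaceSelf_atlas] at he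
  subst he
  funext u
  refine ContinuousLinearMap.ext fun X => ContinuousLinearMap.ext fun Y => ?_
  have hs : (((OpenPartialHomeomorph.refl Plane).extend (𝓡 2)).symm : Plane → Plane) = id := by
    ext u; simp
  rw [BilinField.inChart_apply, hs, mfderiv_id]
  rfl

theorem extend_symm_atlas {e : OpenPartialHomeomorph Plane Plane} (he : e ∈ atlas Plane Plane) :
    ((e.extend (𝓡 2)).symm : Plane → Plane) = id := by
  rw [chartedSpaceSelf_atlas] at he
  subst he
  ext u; simp

theorem isPseudoRiemannian_field {r : WithTop ℕ∞} : field.IsPseudoRiemannian r where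
  symm p X Y := isMetricOn_metric.symm p (mem_univ p) X Y
  nondegenerate p X h := isMetricOn_metric.nondegenerate p (mem_univ p) X h
  contDiffOn e he := by
    rw [inChart_field he]
    exact contDiff_metric.contDiffOn

theorem ricciEq_field : field.RicciEq fun u => -3 * Real.exp (u 0) := by
  intro e he u _ _ X Y
  rw [inChart_field he, extend_symm_atlas he]
  exact ricci_metric u X Y

theorem hessianEq_expCoord : field.HessianEq expCoord fun u => 3 / 2 * Real.exp (u 0) ^ 2 := by
  intro e he u _ X Y
  rw [inChart_field he, extend_symm_atlas he]
  exact hessian_expCoord u X Y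

theorem gradSq_field (u : Plane) : field.gradSq expCoord u = Real.exp (u 0) ^ 3 := by
  have he : OpenPartialHomeomorph.refl Plane ∈ atlas Plane Plane := by
    rw [chartedSpaceSelf_atlas]
  have h := isPseudoRiemannian_field.gradSq_inChart (a := expCoord) he (u := u) (by simp)
    (by
      rw [mdifferentiableAt_iff_differentiableAt]
      exact contDiff_expCoord.differentiable (n := 1) (by norm_num) _)
  rw [inChart_field he, extend_symm_atlas he] at h
  exact h.symm.trans (gradSq_expCoord u)

theorem not_const_curvature : ¬ ∃ t, ∀ y : Plane, -3 * Real.exp (y 0) = t := by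
  rintro ⟨t, ht⟩
  have h0 := ht 0
  have h1 := ht (vec 0)
  simp at h0 h1
  have : Real.exp 1 = 1 := by linarith
  simp at this

theorem exists_einstein :
    ∃ (g h : BilinField (𝓡 2) Plane) (f : Plane × Plane → ℝ) (k l : Plane → ℝ),
      g.IsPseudoRiemannian ∞ ∧ h.IsPseudoRiemannian ∞ ∧
      ContMDiff ((𝓡 2).prod (𝓡 2)) 𝓘(ℝ, ℝ) ∞ f ∧ (∀ p, f p ≠ 0) ∧
      g.RicciEq k ∧ h.RicciEq l ∧ (¬ ∃ t, ∀ y, k y = t) ∧ (¬ ∃ t, ∀ x, l x = t) ∧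
      (BilinField.conformalProd f g h).IsEinstein := by
  have hsm {r : WithTop ℕ∞} : ContMDiff (𝓡 2) 𝓘(ℝ, ℝ) r expCoord :=
    contDiff_expCoord.contMDiff
  refine ⟨field, field, fun p => expCoord p.1 + expCoord p.2, _, _, isPseudoRiemannian_field,
    isPseudoRiemannian_field, ?_, fun p => ?_, ricciEq_field, ricciEq_field, not_const_curvature,
    not_const_curvature, ?_⟩
  · exact (hsm.comp contMDiff_fst).add (hsm.comp contMDiff_snd)
  · exact (add_pos (Real.exp_pos _) (Real.exp_pos _)).ne'
  · refine BilinField.isEinstein_conformalProd isPseudoRiemannian_field isPseudoRiemannian_field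
      hsm hsm ricciEq_field ricciEq_field hessianEq_expCoord hessianEq_expCoord
      (fun y x => (add_pos (Real.exp_pos _) (Real.exp_pos _)).ne') (n := 2) (m := 2) (lam := 0)
      (by simp) (by simp) (fun y x => ?_) fun y x => ?_
    · simp only [expCoord]; ring
    · rw [gradSq_field, gradSq_field]
      simp only [expCoord]; ring

end NonConstantCurvature

end

/-! ### Half-translation coordinates -/

section HalfTranslation

open Filter Topology

variable {X : Type*} [TopologicalSpace X]

/-- A family of local coordinates `(u, φ)` on a space `X`, whose first coordinate is a given function
`u` and whose second coordinate is unique up to sign and additive constants. -/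
structure IsHalfTranslationAtlas (A : Set (OpenPartialHomeomorph X (ℝ × ℝ))) (u : X → ℝ) :
    Prop where
  fst_eq : ∀ Ψ ∈ A, ∀ y ∈ Ψ.source, (Ψ y).1 = u y
  compat : ∀ Ψ ∈ A, ∀ Ψ' ∈ A, ∀ y, y ∈ Ψ.source → y ∈ Ψ'.source →
    ∃ σ : ℝ, σ ^ 2 = 1 ∧ ∀ᶠ z in 𝓝 y, (Ψ' z).2 - (Ψ' y).2 = σ * ((Ψ z).2 - (Ψ y).2)

/-- The curve `γ` is parametrized by `s`: up to sign and additive constants, `s` is the second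
coordinate along `γ`. -/
structure IsAngularCurve (A : Set (OpenPartialHomeomorph X (ℝ × ℝ))) (γ : ℝ → X) (s : ℝ → ℝ) :
    Prop where
  continuous : Continuous γ
  exists_eq : ∀ θ₀, ∃ Ψ ∈ A, γ θ₀ ∈ Ψ.source ∧ ∃ σ : ℝ, σ ^ 2 = 1 ∧
    ∀ᶠ θ in 𝓝 θ₀, (Ψ (γ θ)).2 - (Ψ (γ θ₀)).2 = σ * (s θ - s θ₀)

variable {A : Set (OpenPartialHomeomorph X (ℝ × ℝ))} {u : X → ℝ}

/-- On a compact set covered by the coordinates, the coordinate rectangles have a uniform size. -/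
theorem exists_uniform_ball {S : Set X} (hS : IsCompact S)
    (hcov : ∀ x ∈ S, ∃ Ψ ∈ A, x ∈ Ψ.source) :
    ∃ ε > 0, ∀ x ∈ S, ∃ Ψ ∈ A, x ∈ Ψ.source ∧ Metric.ball (Ψ x) ε ⊆ Ψ.target := by
  refine hS.induction_on (p := fun S => ∃ ε > 0, ∀ x ∈ S, ∃ Ψ ∈ A, x ∈ Ψ.source ∧
    Metric.ball (Ψ x) ε ⊆ Ψ.target) ⟨1, one_pos, by simp⟩ ?_ ?_ ?_
  · rintro S T hST ⟨ε, hε, h⟩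
    exact ⟨ε, hε, fun x hx => h x (hST hx)⟩
  · rintro S T ⟨ε, hε, h⟩ ⟨ε', hε', h'⟩
    refine ⟨min ε ε', lt_min hε hε', ?_⟩
    rintro x (hx | hx)
    · obtain ⟨Ψ, hΨ, h1, h2⟩ := h x hx
      exact ⟨Ψ, hΨ, h1, (Metric.ball_subset_ball (min_le_left _ _)).trans h2⟩
    · obtain ⟨Ψ, hΨ, h1, h2⟩ := h' x hx
      exact ⟨Ψ, hΨ, h1, (Metric.ball_subset_ball (min_le_right _ _)).trans h2⟩
  · intro x hx
    obtain ⟨Ψ, hΨ, hxΨ⟩ := hcov x hx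
    obtain ⟨r, hr, hball⟩ := Metric.isOpen_iff.1 Ψ.open_target _ (Ψ.map_source hxΨ)
    refine ⟨{y | y ∈ Ψ.source ∧ Ψ y ∈ Metric.ball (Ψ x) (r / 2)}, mem_nhdsWithin_of_mem_nhds
      ((Ψ.open_source.mem_nhds hxΨ |> Filter.inter_mem <| (Ψ.continuousAt hxΨ).preimage_mem_nhds
        (Metric.ball_mem_nhds _ (half_pos hr)))), r / 2, half_pos hr, ?_⟩
    rintro y ⟨hy, hyr⟩
    exact ⟨Ψ, hΨ, hy, (Metric.ball_subset_ball' (by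
      rw [Metric.mem_ball] at hyr; linarith)).trans hball⟩

/-- Two lifts of the segment from `u x` to `t`, along which the second coordinates of two charts are
constant, end at the same point: the change of coordinates preserves these curves, so that the set on
which the lifts agree is open and closed. -/
theorem IsHalfTranslationAtlas.symm_eq_symm [T2Space X] (hA : IsHalfTranslationAtlas A u)
    {Ψ Ψ' : OpenPartialHomeomorph X (ℝ × ℝ)} (hΨ : Ψ ∈ A) (hΨ' : Ψ' ∈ A) {x : X}
    (hx : x ∈ Ψ.source) (hx' : x ∈ Ψ'.source) {I : Set ℝ} (hI : IsPreconnected I)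
    (hIx : u x ∈ I) (ht : ∀ t ∈ I, (t, (Ψ x).2) ∈ Ψ.target)
    (ht' : ∀ t ∈ I, (t, (Ψ' x).2) ∈ Ψ'.target) {t : ℝ} (htI : t ∈ I) :
    Ψ.symm (t, (Ψ x).2) = Ψ'.symm (t, (Ψ' x).2) := by
  have hcont {Φ : OpenPartialHomeomorph X (ℝ × ℝ)} (h : ∀ t ∈ I, (t, (Φ x).2) ∈ Φ.target) :
      ContinuousOn (fun t => Φ.symm (t, (Φ x).2)) I :=
    Φ.continuousOn_symm.comp (by fun_prop) h
  have : PreconnectedSpace I := isPreconnected_iff_preconnectedSpace.1 hI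
  have hc1 := continuousOn_iff_continuous_domRestrict.1 (hcont ht)
  have hc2 := continuousOn_iff_continuous_domRestrict.1 (hcont ht')
  have hclosed : IsClosed {t : I | Ψ.symm (t, (Ψ x).2) = Ψ'.symm (t, (Ψ' x).2)} :=
    isClosed_eq hc1 hc2
  have hopen : IsOpen {t : I | Ψ.symm (t, (Ψ x).2) = Ψ'.symm (t, (Ψ' x).2)} := by
    rw [isOpen_iff_mem_nhds]
    intro t₀ h0
    have h0 : Ψ.symm (t₀, (Ψ x).2) = Ψ'.symm (t₀, (Ψ' x).2) := h0
    have hy := Ψ.map_target (ht t₀ t₀.2)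
    have hy' := Ψ'.map_target (ht' t₀ t₀.2)
    rw [← h0] at hy'
    obtain ⟨σ, -, hσ⟩ := hA.compat Ψ hΨ Ψ' hΨ' _ hy hy'
    have hev := (hc1.continuousAt (x := t₀)).eventually
      (hσ.and (Ψ'.open_source.mem_nhds hy'))
    filter_upwards [hev] with t h
    obtain ⟨h1, h2⟩ := h
    simp only [domRestrict_apply] at h1 h2
    have e1 : Ψ (Ψ.symm (t, (Ψ x).2)) = (↑t, (Ψ x).2) := Ψ.right_inv (ht t t.2)
    have e2 : Ψ (Ψ.symm (t₀, (Ψ x).2)) = (↑t₀, (Ψ x).2) := Ψ.right_inv (ht t₀ t₀.2)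
    have e3 : Ψ' (Ψ.symm (t₀, (Ψ x).2)) = (↑t₀, (Ψ' x).2) := by
      rw [h0]; exact Ψ'.right_inv (ht' t₀ t₀.2)
    rw [e1, e2, e3] at h1
    have e4 : Ψ' (Ψ.symm (t, (Ψ x).2)) = (↑t, (Ψ' x).2) := by
      refine Prod.ext ?_ (by simp at h1; linarith)
      rw [hA.fst_eq Ψ' hΨ' _ h2, ← hA.fst_eq Ψ hΨ _ (Ψ.map_target (ht t t.2)), e1]
    change Ψ.symm (t, (Ψ x).2) = Ψ'.symm (t, (Ψ' x).2)
    rw [← e4, Ψ'.left_inv h2]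
  have huniv := IsClopen.eq_univ ⟨hclosed, hopen⟩ ⟨⟨u x, hIx⟩, by
    have e1 : ((u x, (Ψ x).2) : ℝ × ℝ) = Ψ x := by rw [← hA.fst_eq Ψ hΨ x hx]
    have e2 : ((u x, (Ψ' x).2) : ℝ × ℝ) = Ψ' x := by rw [← hA.fst_eq Ψ' hΨ' x hx']
    change Ψ.symm (u x, (Ψ x).2) = Ψ'.symm (u x, (Ψ' x).2)
    rw [e1, e2, Ψ.left_inv hx, Ψ'.left_inv hx']⟩
  have := huniv.ge (mem_univ (⟨t, htI⟩ : I))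
  exact this

/-- Moving an angular curve to nearby levels of `u` along the curves on which the second coordinate is
constant. -/
theorem IsHalfTranslationAtlas.exists_move [T2Space X] (hA : IsHalfTranslationAtlas A u) {S : Set X}
    {ε : ℝ} (hε : ∀ x ∈ S, ∃ Ψ ∈ A, x ∈ Ψ.source ∧ Metric.ball (Ψ x) ε ⊆ Ψ.target)
    {γ : ℝ → X} {s w : ℝ → ℝ} (hγ : IsAngularCurve A γ s) (hγS : ∀ θ, γ θ ∈ S)
    (hu : Continuous (u ∘ γ)) (hw : Continuous w) (hwε : ∀ θ, |w θ - u (γ θ)| < ε) {T : ℝ}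
    (hγT : ∀ θ, γ (θ + T) = γ θ) (hwT : ∀ θ, w (θ + T) = w θ) :
    ∃ γ' : ℝ → X, IsAngularCurve A γ' s ∧ (∀ θ, u (γ' θ) = w θ) ∧ ∀ θ, γ' (θ + T) = γ' θ := by
  have : Nonempty (OpenPartialHomeomorph X (ℝ × ℝ)) := ⟨(hε _ (hγS 0)).choose⟩
  choose! Φ hΦA hΦx hΦb using hε
  have htgt : ∀ x ∈ S, ∀ t b, |t - u x| < ε → |b - (Φ x x).2| < ε → (t, b) ∈ (Φ x).target := by
    intro x hx t b ht hb
    refine hΦb x hx ?_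
    rw [Metric.mem_ball, Prod.dist_eq, max_lt_iff, Real.dist_eq, Real.dist_eq,
      hA.fst_eq _ (hΦA x hx) x (hΦx x hx)]
    exact ⟨ht, hb⟩
  have hε0 : 0 < ε := (abs_nonneg _).trans_lt (hwε 0)
  set γ' : ℝ → X := fun θ => (Φ (γ θ)).symm (w θ, (Φ (γ θ) (γ θ)).2) with hγ'
  -- near `θ₀` the new curve is computed in the coordinates at `γ θ₀`
  have hloc : ∀ θ₀, ∀ᶠ θ in 𝓝 θ₀, (w θ, (Φ (γ θ₀) (γ θ)).2) ∈ (Φ (γ θ₀)).target ∧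
      γ' θ = (Φ (γ θ₀)).symm (w θ, (Φ (γ θ₀) (γ θ)).2) := by
    intro θ₀
    have c1 := hγ.continuous.continuousAt.preimage_mem_nhds
      ((Φ (γ θ₀)).open_source.mem_nhds (hΦx _ (hγS θ₀)))
    have c2 : ∀ᶠ θ in 𝓝 θ₀, |u (γ θ) - u (γ θ₀)| < ε :=
      ((hu.sub continuous_const).abs).continuousAt.eventually (Iio_mem_nhds (by simpa using hε0))
    have c3 : ∀ᶠ θ in 𝓝 θ₀, |w θ - u (γ θ₀)| < ε :=
      ((hw.sub continuous_const).abs).continuousAt.eventually (Iio_mem_nhds (hwε θ₀))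
    have c4 : ∀ᶠ θ in 𝓝 θ₀, |(Φ (γ θ₀) (γ θ)).2 - (Φ (γ θ₀) (γ θ₀)).2| < ε := by
      have : ContinuousAt (fun θ => |(Φ (γ θ₀) (γ θ)).2 - (Φ (γ θ₀) (γ θ₀)).2|) θ₀ :=
        ((continuous_snd.continuousAt.comp (((Φ (γ θ₀)).continuousAt
          (hΦx _ (hγS θ₀))).comp hγ.continuous.continuousAt)).sub continuousAt_const).abs
      exact this.eventually (Iio_mem_nhds (by simpa using hε0))
    filter_upwards [c1, c2, c3, c4] with θ h1 h2 h3 h4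
    refine ⟨htgt _ (hγS θ₀) _ _ h3 h4, ?_⟩
    refine hA.symm_eq_symm (hΦA _ (hγS θ)) (hΦA _ (hγS θ₀)) (hΦx _ (hγS θ)) h1
      (I := uIcc (u (γ θ)) (w θ)) isPreconnected_uIcc left_mem_uIcc ?_ ?_ right_mem_uIcc
    · intro t ht
      refine htgt _ (hγS θ) _ _ ?_ (by simpa using hε0)
      refine lt_of_le_of_lt ?_ (hwε θ)
      exact abs_sub_left_of_mem_uIcc ht
    · intro t ht
      refine htgt _ (hγS θ₀) _ _ ?_ h4
      rw [abs_lt] at h2 h3 ⊢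
      rcases le_total (u (γ θ)) (w θ) with hle | hle
      · rw [uIcc_of_le hle, mem_Icc] at ht
        constructor <;> linarith [ht.1, ht.2]
      · rw [uIcc_of_ge hle, mem_Icc] at ht
        constructor <;> linarith [ht.1, ht.2]
  have hcoord : ∀ θ₀, ∀ᶠ θ in 𝓝 θ₀, γ' θ ∈ (Φ (γ θ₀)).source ∧
      Φ (γ θ₀) (γ' θ) = (w θ, (Φ (γ θ₀) (γ θ)).2) := by
    intro θ₀
    filter_upwards [hloc θ₀] with θ h
    rw [h.2]
    exact ⟨(Φ (γ θ₀)).map_target h.1, (Φ (γ θ₀)).right_inv h.1⟩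
  refine ⟨γ', ⟨?_, fun θ₀ => ?_⟩, fun θ => ?_, fun θ => ?_⟩
  · rw [continuous_iff_continuousAt]
    intro θ₀
    have h1 : ContinuousAt (fun θ => (Φ (γ θ₀)).symm (w θ, (Φ (γ θ₀) (γ θ)).2)) θ₀ := by
      refine ContinuousAt.comp (g := (Φ (γ θ₀)).symm)
        ((Φ (γ θ₀)).continuousAt_symm (hloc θ₀).self_of_nhds.1) ?_
      exact hw.continuousAt.prodMk (continuous_snd.continuousAt.comp (((Φ (γ θ₀)).continuousAt
          (hΦx _ (hγS θ₀))).comp hγ.continuous.continuousAt))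
    exact h1.congr ((hloc θ₀).mono fun θ h => h.2.symm)
  · obtain ⟨Ψ, hΨ, h1, σ, hσ, hev⟩ := hγ.exists_eq θ₀
    obtain ⟨τ, hτ, hev'⟩ := hA.compat Ψ hΨ _ (hΦA _ (hγS θ₀)) _ h1 (hΦx _ (hγS θ₀))
    refine ⟨Φ (γ θ₀), hΦA _ (hγS θ₀), (hcoord θ₀).self_of_nhds.1, τ * σ, by
      rw [mul_pow, hτ, hσ, one_mul], ?_⟩
    filter_upwards [hcoord θ₀, hev, hγ.continuous.continuousAt.eventually hev'] with θ e1 e2 e3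
    rw [e1.2, (hcoord θ₀).self_of_nhds.2, e3, e2, mul_assoc]
  · have h := (hcoord θ).self_of_nhds
    rw [← hA.fst_eq _ (hΦA _ (hγS θ)) _ h.1, h.2]
  · simp only [hγ', hγT, hwT]

/-- Periodic angular curves can be moved to any level of `u`. -/
theorem IsHalfTranslationAtlas.exists_level_curve [T2Space X] (hA : IsHalfTranslationAtlas A u)
    {c₁ c₂ : ℝ} (hS : IsCompact (u ⁻¹' Icc c₁ c₂)) (hcov : ∀ x, u x ∈ Icc c₁ c₂ →
      ∃ Ψ ∈ A, x ∈ Ψ.source) (huc : Continuous u)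
    {γ : ℝ → X} {s : ℝ → ℝ} (hγ : IsAngularCurve A γ s) (hγS : ∀ θ, u (γ θ) ∈ Icc c₁ c₂)
    {T : ℝ} (hγT : ∀ θ, γ (θ + T) = γ θ) {v : ℝ} (hv : v ∈ Icc c₁ c₂) :
    ∃ γ' : ℝ → X, IsAngularCurve A γ' s ∧ (∀ θ, u (γ' θ) = v) ∧ ∀ θ, γ' (θ + T) = γ' θ := by
  obtain ⟨ε, hε, hball⟩ := exists_uniform_ball hS hcov
  obtain ⟨n, hn⟩ := exists_nat_gt ((c₂ - c₁) / ε)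
  have hc : 0 ≤ c₂ - c₁ := by linarith [hv.1, hv.2]
  have hn0 : (0 : ℝ) < n := lt_of_le_of_lt (div_nonneg hc hε.le) hn
  -- interpolate linearly between `u ∘ γ` and the constant level in `n` steps
  set w : ℕ → ℝ → ℝ := fun k θ => u (γ θ) + (k / n) * (v - u (γ θ)) with hw
  have hwS : ∀ k ≤ n, ∀ θ, w k θ ∈ Icc c₁ c₂ := by
    intro k hk θ
    have h1 : (k : ℝ) / n ≤ 1 := by rw [div_le_one hn0]; exact_mod_cast hk
    have := (convex_Icc c₁ c₂).add_smul_sub_mem (hγS θ) hv (t := (k : ℝ) / n)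
      ⟨by positivity, h1⟩
    simpa [hw] using this
  have key : ∀ k ≤ n, ∃ γ' : ℝ → X, IsAngularCurve A γ' s ∧ (∀ θ, u (γ' θ) = w k θ) ∧
      ∀ θ, γ' (θ + T) = γ' θ := by
    intro k
    induction k with
    | zero => exact fun _ => ⟨γ, hγ, fun θ => by simp [hw], hγT⟩
    | succ k ih =>
      intro hk
      obtain ⟨γ₁, h1, h2, h3⟩ := ih (by omega)
      refine hA.exists_move hball h1 (fun θ => ?_) (huc.comp h1.continuous) ?_ (fun θ => ?_) h3
        fun θ => by simp only [hw, hγT]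
      · rw [mem_preimage, h2]; exact hwS k (by omega) θ
      · have := huc.comp hγ.continuous
        exact this.add (continuous_const.mul (continuous_const.sub this))
      · have e1 : w (k + 1) θ - u (γ₁ θ) = (v - u (γ θ)) / n := by
          rw [h2]; simp only [hw]; push_cast; ring
        have e2 : |v - u (γ θ)| ≤ c₂ - c₁ := by
          have := hγS θ
          rw [abs_le]; constructor <;> linarith [this.1, this.2, hv.1, hv.2]
        rw [e1, abs_div, abs_of_pos hn0, div_lt_iff₀ hn0]
        rw [div_lt_iff₀ hε] at hn
        linarith
  obtain ⟨γ', h1, h2, h3⟩ := key n le_rfl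
  refine ⟨γ', h1, fun θ => ?_, h3⟩
  rw [h2]
  simp only [hw]
  field_simp
  ring

end HalfTranslation

/-! ### The angular form of a function on a surface -/

noncomputable section

namespace LocalGeometry

/-- The standard area form of the plane. -/
def areaForm : Plane →L[ℝ] Plane →L[ℝ] ℝ :=
  (coord 0).smulRight (coord 1) - (coord 1).smulRight (coord 0)

theorem areaForm_apply (X Y : Plane) : areaForm X Y = X 0 * Y 1 - X 1 * Y 0 := by
  simp [areaForm]

/-- The determinant of a bilinear form in the standard basis of the plane. -/
def gramDet (B : Plane →L[ℝ] Plane →L[ℝ] ℝ) : ℝ :=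
  B (vec 0) (vec 0) * B (vec 1) (vec 1) - B (vec 0) (vec 1) * B (vec 1) (vec 0)

theorem eq_coord_sum (X : Plane) : X = X 0 • vec 0 + X 1 • vec 1 := by
  ext i; fin_cases i <;> simp

theorem map_eq_coord {F : Type*} [AddCommGroup F] [Module ℝ F] [TopologicalSpace F]
    (L : Plane →L[ℝ] F) (X : Plane) : L X = X 0 • L (vec 0) + X 1 • L (vec 1) := by
  conv_lhs => rw [eq_coord_sum X]
  rw [map_add, map_smul, map_smul]

theorem bilin_eq_coord (B : Plane →L[ℝ] Plane →L[ℝ] ℝ) (X Y : Plane) :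
    B X Y = X 0 * Y 0 * B (vec 0) (vec 0) + X 0 * Y 1 * B (vec 0) (vec 1)
      + X 1 * Y 0 * B (vec 1) (vec 0) + X 1 * Y 1 * B (vec 1) (vec 1) := by
  rw [map_eq_coord B X, add_apply, smul_apply, smul_apply, map_eq_coord (B (vec 0)) Y,
    map_eq_coord (B (vec 1)) Y]
  simp only [smul_eq_mul]
  ring

theorem gramDet_mul_areaForm_sq {B : Plane →L[ℝ] Plane →L[ℝ] ℝ} (hB : ∀ X Y, B X Y = B Y X)
    (X Y : Plane) : gramDet B * areaForm X Y ^ 2 = B X X * B Y Y - B X Y ^ 2 := by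
  rw [bilin_eq_coord B X X, bilin_eq_coord B Y Y, bilin_eq_coord B X Y, gramDet, areaForm_apply,
    hB (vec 1) (vec 0)]
  ring

theorem gramDet_pos {B : Plane →L[ℝ] Plane →L[ℝ] ℝ} (hB : ∀ X Y, B X Y = B Y X)
    (hpos : ∀ X, X ≠ 0 → 0 < B X X) : 0 < gramDet B := by
  have h0 : 0 < B (vec 0) (vec 0) := hpos _ (by simp)
  have h1 := hpos (B (vec 0) (vec 1) • vec 0 - B (vec 0) (vec 0) • vec 1) fun h => by
    have := congrArg (fun X : Plane => X 1) h
    simp at this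
    exact h0.ne' this
  rw [bilin_eq_coord] at h1
  simp at h1
  rw [hB (vec 1) (vec 0)] at h1
  have h2 : 0 < B (vec 0) (vec 0) * gramDet B := by
    rw [gramDet, hB (vec 1) (vec 0)]
    linarith
  exact pos_of_mul_pos_right h2 h0.le

/-- The star of the differential of `a`: the form `Y ↦ √det G · [∇a, Y]`. -/
def starDiff (G : Plane → Plane →L[ℝ] Plane →L[ℝ] ℝ) (a : Plane → ℝ) (u : Plane) :
    Plane →L[ℝ] ℝ :=
  √(gramDet (G u)) • areaForm (sharp G u (fderiv ℝ a u))

/-- The angular form `*da / |∇a|²` of a function `a`. It is closed where the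
Hessian of `a` is a multiple of the metric. -/
def angularForm (G : Plane → Plane →L[ℝ] Plane →L[ℝ] ℝ) (a : Plane → ℝ) (u : Plane) :
    Plane →L[ℝ] ℝ :=
  (gradSq G a u)⁻¹ • starDiff G a u

/-- The vector obtained from the gradient of `a` by a rotation through a right angle. -/
def conjGrad (G : Plane → Plane →L[ℝ] Plane →L[ℝ] ℝ) (a : Plane → ℝ) (u : Plane) : Plane :=
  (√(gramDet (G u)))⁻¹ • (fderiv ℝ a u (vec 0) • vec 1 - fderiv ℝ a u (vec 1) • vec 0)

variable {G : Plane → Plane →L[ℝ] Plane →L[ℝ] ℝ} {Ω : Set Plane} {a : Plane → ℝ} {u : Plane}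

theorem fderiv_conjGrad : fderiv ℝ a u (conjGrad G a u) = 0 := by
  simp [conjGrad]
  right
  ring

theorem starDiff_conjGrad (hD : 0 < gramDet (G u)) :
    starDiff G a u (conjGrad G a u) = gradSq G a u := by
  have h := map_eq_coord (fderiv ℝ a u) (sharp G u (fderiv ℝ a u))
  have hD' : √(gramDet (G u)) ≠ 0 := (Real.sqrt_pos.2 hD).ne'
  rw [gradSq, h, starDiff, smul_apply, areaForm_apply, conjGrad]
  simp
  field_simp

theorem angularForm_conjGrad (hD : 0 < gramDet (G u)) (hP : gradSq G a u ≠ 0) :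
    angularForm G a u (conjGrad G a u) = 1 := by
  rw [angularForm, smul_apply, starDiff_conjGrad hD, smul_eq_mul, inv_mul_cancel₀ hP]

namespace IsMetricOn

theorem starDiff_sq (hG : IsMetricOn G Ω) (hu : u ∈ Ω) (hD : 0 < gramDet (G u)) (v : Plane) :
    starDiff G a u v ^ 2 = gradSq G a u * G u v v - fderiv ℝ a u v ^ 2 := by
  have h := gramDet_mul_areaForm_sq (hG.symm u hu) (sharp G u (fderiv ℝ a u)) v
  rw [hG.apply_sharp hu] at h
  rw [starDiff, smul_apply, smul_eq_mul, mul_pow, Real.sq_sqrt hD.le, h, gradSq]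

theorem angularForm_sq (hG : IsMetricOn G Ω) (hu : u ∈ Ω) (hD : 0 < gramDet (G u)) (v : Plane) :
    angularForm G a u v ^ 2 =
      (gradSq G a u * G u v v - fderiv ℝ a u v ^ 2) / gradSq G a u ^ 2 := by
  rw [angularForm, smul_apply, smul_eq_mul, mul_pow, hG.starDiff_sq hu hD]
  ring

theorem hasFDerivAt_gramDet (hG : IsMetricOn G Ω) (hu : u ∈ Ω) :
    HasFDerivAt (fun v => gramDet (G v)) ((2 * gramDet (G u)) •
      ((coord 0).comp ((christoffel G u).flip (vec 0)) +
        (coord 1).comp ((christoffel G u).flip (vec 1)))) u := by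
  have h := ((hG.hasFDerivAt_apply hu (vec 0) (vec 0)).mul
    (hG.hasFDerivAt_apply hu (vec 1) (vec 1))).sub
    ((hG.hasFDerivAt_apply hu (vec 0) (vec 1)).mul (hG.hasFDerivAt_apply hu (vec 1) (vec 0)))
  refine h.congr_fderiv ?_
  ext X
  have hs := hG.symm u hu (vec 1) (vec 0)
  simp only [gramDet, sub_apply, add_apply, smul_apply, ContinuousLinearMap.flip_apply,
    hG.fderiv_apply hu, ContinuousLinearMap.comp_apply, smul_eq_mul]
  rw [hG.symm u hu (vec 0) (christoffel G u X (vec 0)),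
    hG.symm u hu (vec 0) (christoffel G u X (vec 1)),
    hG.symm u hu (vec 1) (christoffel G u X (vec 0)),
    hG.symm u hu (vec 1) (christoffel G u X (vec 1))]
  simp only [map_eq_coord (G u) (christoffel G u X _), add_apply, smul_apply, smul_eq_mul]
  simp only [hs, PiLp.proj_apply]
  ring

theorem hasFDerivAt_sqrt_gramDet (hG : IsMetricOn G Ω) (hu : u ∈ Ω) (hD : 0 < gramDet (G u)) :
    HasFDerivAt (fun v => √(gramDet (G v))) (√(gramDet (G u)) •
      ((coord 0).comp ((christoffel G u).flip (vec 0)) +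
        (coord 1).comp ((christoffel G u).flip (vec 1)))) u := by
  refine ((hG.hasFDerivAt_gramDet hu).sqrt hD.ne').congr_fderiv ?_
  have hD' : √(gramDet (G u)) ≠ 0 := (Real.sqrt_pos.2 hD).ne'
  rw [smul_smul]
  congr 1
  field_simp
  rw [Real.sq_sqrt hD.le]

theorem hasFDerivAt_grad (hG : IsMetricOn G Ω) (hu : u ∈ Ω) (ha : ContDiffAt ℝ 2 a u) {σ : ℝ}
    (h : ∀ X Y, hessian G a u X Y = σ * G u X Y) :
    HasFDerivAt (fun v => sharp G v (fderiv ℝ a v)) (σ • ContinuousLinearMap.id ℝ Plane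
      - (christoffel G u).flip (sharp G u (fderiv ℝ a u))) u := by
  have hd := ((ha.fderiv_right (m := 1) (by norm_num)).differentiableAt (by norm_num)).hasFDerivAt
  refine (hG.hasFDerivAt_sharp hu hd).congr_fderiv ?_
  congr 1
  refine ContinuousLinearMap.ext fun X => ?_
  refine hG.ext_apply hu fun Z => ?_
  change G u (sharp G u (hessian G a u X)) Z = _
  rw [hG.apply_sharp hu, h]
  simp

theorem hasFDerivAt_starDiff (hG : IsMetricOn G Ω) (hu : u ∈ Ω) (hD : 0 < gramDet (G u))
    (ha : ContDiffAt ℝ 2 a u) {σ : ℝ} (h : ∀ X Y, hessian G a u X Y = σ * G u X Y) :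
    HasFDerivAt (starDiff G a) (√(gramDet (G u)) • (σ • areaForm +
      (ContinuousLinearMap.compL ℝ Plane Plane ℝ (areaForm (sharp G u (fderiv ℝ a u)))).comp
        (christoffel G u))) u := by
  have h1 := (hG.hasFDerivAt_sqrt_gramDet hu hD).smul
    (areaForm.hasFDerivAt.comp u (hG.hasFDerivAt_grad hu ha h))
  refine h1.congr_fderiv ?_
  ext X Y
  simp only [add_apply, smul_apply, ContinuousLinearMap.smulRight_apply,
    ContinuousLinearMap.comp_apply, sub_apply, ContinuousLinearMap.flip_apply,
    ContinuousLinearMap.compL_apply, areaForm_apply, ContinuousLinearMap.id_apply, smul_eq_mul,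
    Function.comp_apply, PiLp.sub_apply, PiLp.smul_apply, PiLp.proj_apply]
  generalize sharp G u (fderiv ℝ a u) = W
  rw [map_eq_coord (christoffel G u X) W, map_eq_coord (christoffel G u X) Y]
  simp
  ring

/-- If the Hessian of `a` is a multiple of the metric, the angular form is closed. -/
theorem fderiv_angularForm_symm (hG : IsMetricOn G Ω) (hu : u ∈ Ω) (hD : 0 < gramDet (G u))
    (ha : ContDiffAt ℝ 2 a u) {σ : ℝ} (h : ∀ X Y, hessian G a u X Y = σ * G u X Y)
    (hP : gradSq G a u ≠ 0) : DifferentiableAt ℝ (angularForm G a) u ∧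
      ∀ X Y, fderiv ℝ (angularForm G a) u X Y = fderiv ℝ (angularForm G a) u Y X := by
  have h1 := ((hasDerivAt_inv hP).comp_hasFDerivAt u (hG.hasFDerivAt_gradSq hu ha h)).smul
    (hG.hasFDerivAt_starDiff hu hD ha h)
  have h2 : HasFDerivAt (angularForm G a) _ u := h1
  refine ⟨h2.differentiableAt, fun X Y => ?_⟩
  have hda := map_eq_coord (fderiv ℝ a u)
  have hgs : gradSq G a u = fderiv ℝ a u (sharp G u (fderiv ℝ a u)) := rfl
  rw [hda (sharp G u (fderiv ℝ a u))] at hgs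
  rw [h2.fderiv]
  simp only [add_apply, smul_apply, ContinuousLinearMap.smulRight_apply,
    ContinuousLinearMap.comp_apply, Function.comp_apply, starDiff,
    ContinuousLinearMap.compL_apply, areaForm_apply, smul_eq_mul, hG.christoffel_symm hu Y X]
  rw [hda X, hda Y]
  simp only [smul_eq_mul] at hgs ⊢
  field_simp
  rw [hgs]
  ring

end IsMetricOn

end LocalGeometry

end

/-! ### Critical points -/

noncomputable section

open Filter Topology Asymptotics

/-- A map on a ball whose derivative is bounded by a multiple of the map vanishes if it vanishes at the
centre. -/
theorem eq_zero_of_norm_fderiv_le {E F : Type*} [NormedAddCommGroup E] [NormedSpace ℝ E]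
    [NormedAddCommGroup F] [NormedSpace ℝ F] {f : E → F} {f' : E → E →L[ℝ] F} {x₀ : E} {r L : ℝ}
    (hf : ∀ x ∈ Metric.ball x₀ r, HasFDerivAt f (f' x) x)
    (hL : ∀ x ∈ Metric.ball x₀ r, ‖f' x‖ ≤ L * ‖f x‖) (h0 : f x₀ = 0) {x : E}
    (hx : x ∈ Metric.ball x₀ r) : f x = 0 := by
  have hmem : ∀ t ∈ Icc (0 : ℝ) 1, x₀ + t • (x - x₀) ∈ Metric.ball x₀ r := fun t ht => by
    have hr : 0 < r := Metric.pos_of_mem_ball hx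
    exact (convex_ball x₀ r).add_smul_sub_mem (Metric.mem_ball_self hr) hx ht
  have hline : ∀ t : ℝ, HasDerivAt (fun t : ℝ => x₀ + t • (x - x₀)) (x - x₀) t := fun t => by
    simpa using ((hasDerivAt_id t).smul_const (x - x₀)).const_add x₀
  have hd : ∀ t ∈ Icc (0 : ℝ) 1, HasDerivAt (fun t : ℝ => f (x₀ + t • (x - x₀)))
      (f' (x₀ + t • (x - x₀)) (x - x₀)) t := fun t ht =>
    (hf _ (hmem t ht)).comp_hasDerivAt t (hline t)
  have := eq_zero_of_abs_deriv_le_mul_abs_self_of_eq_zero_right (K := L * ‖x - x₀‖) (a := 0)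
    (b := 1) (fun t ht => (hd t ht).continuousAt.continuousWithinAt)
    (fun t ht => (hd t (Ico_subset_Icc_self ht)).hasDerivWithinAt) (by simpa using h0)
    (fun t ht => ?_) 1 (right_mem_Icc.2 zero_le_one)
  · simpa using this
  · refine (ContinuousLinearMap.le_opNorm _ _).trans ?_
    have := mul_le_mul_of_nonneg_right (hL _ (hmem t (Ico_subset_Icc_self ht)))
      (norm_nonneg (x - x₀))
    linarith

/-- The product of two differentiable maps at a common zero, to second order. -/
theorem HasFDerivAt.isLittleO_apply {E F : Type*} [NormedAddCommGroup E] [NormedSpace ℝ E]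
    [NormedAddCommGroup F] [NormedSpace ℝ F] {f : E → F →L[ℝ] ℝ} {g : E → F}
    {f' : E →L[ℝ] F →L[ℝ] ℝ} {g' : E →L[ℝ] F} {x₀ : E} (hf : HasFDerivAt f f' x₀)
    (hg : HasFDerivAt g g' x₀) (hf0 : f x₀ = 0) (hg0 : g x₀ = 0) :
    (fun x => f x (g x) - f' (x - x₀) (g' (x - x₀))) =o[𝓝 x₀] fun x => ‖x - x₀‖ * ‖x - x₀‖ := by
  have h1 : (fun x => f x - f' (x - x₀)) =o[𝓝 x₀] fun x => ‖x - x₀‖ := by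
    simpa [hf0] using hf.isLittleO.norm_right
  have h2 : (fun x => g x - g' (x - x₀)) =o[𝓝 x₀] fun x => ‖x - x₀‖ := by
    simpa [hg0] using hg.isLittleO.norm_right
  have h3 : g =O[𝓝 x₀] fun x => ‖x - x₀‖ := by
    simpa [hg0] using hg.isBigO_sub.norm_right
  have h4 : (fun x => f' (x - x₀)) =O[𝓝 x₀] fun x => ‖x - x₀‖ :=
    (f'.isBigO_sub (𝓝 x₀) x₀).norm_right
  have e1 : (fun x => (f x - f' (x - x₀)) (g x)) =o[𝓝 x₀] fun x => ‖x - x₀‖ * ‖x - x₀‖ :=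
    (IsBigO.of_norm_le (g := fun x => ‖f x - f' (x - x₀)‖ * ‖g x‖)
      fun x => ContinuousLinearMap.le_opNorm _ _).trans_isLittleO
      (h1.norm_left.mul_isBigO h3.norm_left)
  have e2 : (fun x => f' (x - x₀) (g x - g' (x - x₀))) =o[𝓝 x₀]
      fun x => ‖x - x₀‖ * ‖x - x₀‖ :=
    (IsBigO.of_norm_le (g := fun x => ‖f' (x - x₀)‖ * ‖g x - g' (x - x₀)‖)
      fun x => ContinuousLinearMap.le_opNorm _ _).trans_isLittleO
      (h4.norm_left.mul_isLittleO h2.norm_left)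
  refine (e1.add e2).congr_left fun x => ?_
  rw [sub_apply, (f' (x - x₀)).map_sub]
  ring

theorem IsLocalMax.fderiv_fderiv_nonpos {E : Type*} [NormedAddCommGroup E] [NormedSpace ℝ E]
    {a : E → ℝ} {u : E} (h : IsLocalMax a u) (ha : ContDiffAt ℝ 2 a u) (v : E) :
    fderiv ℝ (fderiv ℝ a) u v v ≤ 0 := by
  by_contra! hpos
  set l : ℝ → E := fun t => u + t • v with hl
  have hl0 : l 0 = u := by simp [hl]
  have hlc : ContinuousAt l 0 := by
    have : Continuous l := by fun_prop
    exact this.continuousAt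
  have hld : ∀ t, HasDerivAt l v t := fun t => by
    have := ((hasDerivAt_id t).smul_const v).const_add u
    rwa [one_smul] at this
  have hev : ∀ᶠ t in 𝓝 (0 : ℝ), deriv (a ∘ l) t = fderiv ℝ a (l t) v := by
    have := hlc.eventually (hl0 ▸ ha.eventually (by simp))
    filter_upwards [this] with t ht
    exact (((ht.differentiableAt (by norm_num)).hasFDerivAt).comp_hasDerivAt t (hld t)).deriv
  have hd2 : HasDerivAt (fun t => fderiv ℝ a (l t) v) (fderiv ℝ (fderiv ℝ a) u v v) 0 := by
    have h1 := ((ha.fderiv_right (m := 1) (by norm_num)).differentiableAt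
      (by norm_num)).hasFDerivAt
    rw [← hl0] at h1
    have h2 := (h1.comp_hasDerivAt 0 (hld 0)).clm_apply (hasDerivAt_const 0 v)
    rw [hl0] at h2
    simpa using h2
  have hdd : deriv (deriv (a ∘ l)) 0 = fderiv ℝ (fderiv ℝ a) u v v := by
    rw [EventuallyEq.deriv_eq hev, hd2.deriv]
  have hd0 : deriv (a ∘ l) 0 = 0 := by
    rw [hev.self_of_nhds, hl0, h.fderiv_eq_zero]; simp
  have hcont : ContinuousAt (a ∘ l) 0 :=
    ContinuousAt.comp (by rw [hl0]; exact ha.continuousAt) hlc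
  have hmin := isLocalMin_of_deriv_deriv_pos (hdd ▸ hpos) hd0 hcont
  have hmax : IsLocalMax (a ∘ l) 0 := by
    have := hlc.eventually (hl0 ▸ h)
    filter_upwards [this] with t ht
    simpa [hl0] using ht
  -- a local minimum which is a local maximum has a constant neighbourhood
  have hconst : (a ∘ l) =ᶠ[𝓝 0] fun _ => (a ∘ l) 0 := by
    filter_upwards [hmin, hmax] with t h1 h2 using le_antisymm h2 h1
  have : deriv (deriv (a ∘ l)) 0 = 0 := by
    rw [EventuallyEq.deriv_eq hconst.deriv]
    simp
  rw [hdd] at this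
  exact hpos.ne' this

namespace LocalGeometry

/-- An orientation preserving isometry of a Euclidean plane with `ℂ`: the imaginary part of
`conj (c z) * c v` is the area form of `B`. -/
theorem exists_complexCoord {B : Plane →L[ℝ] Plane →L[ℝ] ℝ} (hB : ∀ X Y, B X Y = B Y X)
    (hpos : ∀ X, X ≠ 0 → 0 < B X X) : ∃ c : Plane ≃L[ℝ] ℂ, (∀ z, ‖c z‖ ^ 2 = B z z) ∧
      ∀ z v, (starRingEnd ℂ (c z) * c v).im = √(gramDet B) * areaForm z v := by
  set p := B (vec 0) (vec 0) with hp
  have h0 : 0 < p := hpos _ (by simp)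
  have hs : √p ≠ 0 := (Real.sqrt_pos.2 h0).ne'
  have hs2 : √p ^ 2 = p := Real.sq_sqrt h0.le
  have hD2 : √(gramDet B) ^ 2 = gramDet B := Real.sq_sqrt (gramDet_pos hB hpos).le
  have hDp : gramDet B = p * B (vec 1) (vec 1) - B (vec 0) (vec 1) ^ 2 := by
    rw [gramDet, hB (vec 1) (vec 0), hp]; ring
  let f : Plane →L[ℝ] ℂ := ((√p)⁻¹ • B (vec 0)).smulRight (1 : ℂ) +
    ((√(gramDet B) / √p) • coord 1).smulRight Complex.I
  have hre : ∀ z, (f z).re = (√p)⁻¹ * (p * z 0 + B (vec 0) (vec 1) * z 1) := fun z => by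
    simp [f, map_eq_coord (B (vec 0)) z, ← hp]; ring_nf; simp
  have him : ∀ z, (f z).im = √(gramDet B) / √p * z 1 := fun z => by simp [f]
  have hnorm : ∀ z, ‖f z‖ ^ 2 = B z z := fun z => by
    rw [Complex.sq_norm, Complex.normSq_apply, hre, him, bilin_eq_coord B z z, hB (vec 1) (vec 0),
      ← hp]
    have e : (√p)⁻¹ * (p * z 0 + B (vec 0) (vec 1) * z 1) *
        ((√p)⁻¹ * (p * z 0 + B (vec 0) (vec 1) * z 1)) +
        √(gramDet B) / √p * z 1 * (√(gramDet B) / √p * z 1) =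
        ((p * z 0 + B (vec 0) (vec 1) * z 1) ^ 2 + √(gramDet B) ^ 2 * z 1 ^ 2) / √p ^ 2 := by
      field_simp
    rw [e, hs2, hD2, hDp]
    field_simp
    ring
  have hinj : Function.Injective f := by
    rw [injective_iff_map_eq_zero]
    intro z hz
    by_contra hne
    have := hpos z hne
    rw [← hnorm z, hz] at this
    simp at this
  let e : Plane ≃ₗ[ℝ] ℂ := LinearMap.linearEquivOfInjective (f : Plane →ₗ[ℝ] ℂ) hinj
    (by simp [Complex.finrank_real_complex])
  have he : ∀ z, e.toContinuousLinearEquiv z = f z := fun z => rfl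
  refine ⟨e.toContinuousLinearEquiv, fun z => by rw [he, hnorm], fun z v => ?_⟩
  rw [he, he, Complex.mul_im, Complex.conj_re, Complex.conj_im, hre, hre, him, him, areaForm_apply]
  have e2 : (√p)⁻¹ * (p * z 0 + B (vec 0) (vec 1) * z 1) * (√(gramDet B) / √p * v 1) +
      -(√(gramDet B) / √p * z 1) * ((√p)⁻¹ * (p * v 0 + B (vec 0) (vec 1) * v 1)) =
      √(gramDet B) * (p * (z 0 * v 1 - z 1 * v 0)) / √p ^ 2 := by
    field_simp
    ring
  rw [e2, hs2]
  field_simp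

variable {G : Plane → Plane →L[ℝ] Plane →L[ℝ] ℝ} {Ω : Set Plane} {a : Plane → ℝ} {u : Plane}

/-- The derivative of the rotated gradient at a critical point. -/
theorem IsMetricOn.hasFDerivAt_conjGrad (hG : IsMetricOn G Ω) (hu : u ∈ Ω)
    (hpos : ∀ X, X ≠ 0 → 0 < G u X X) (ha : ContDiffAt ℝ 2 a u) {σ : ℝ}
    (h : ∀ X Y, hessian G a u X Y = σ * G u X Y) (h0 : fderiv ℝ a u = 0) :
    ∃ C : Plane →L[ℝ] Plane, HasFDerivAt (conjGrad G a) C u ∧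
      ∀ z, √(gramDet (G u)) * areaForm z (C z) = σ * G u z z := by
  have hD := gramDet_pos (hG.symm u hu) hpos
  have hs := (Real.sqrt_pos.2 hD).ne'
  have hd := ((ha.fderiv_right (m := 1) (by norm_num)).differentiableAt (by norm_num)).hasFDerivAt
  have hd' : ∀ i : Fin 2, HasFDerivAt (fun x => fderiv ℝ a x (vec i))
      ((fderiv ℝ (fderiv ℝ a) u).flip (vec i)) u := fun i => by
    refine (hd.clm_apply (hasFDerivAt_const (vec i) u)).congr_fderiv ?_
    ext; simp
  have hH : ∀ X Y, fderiv ℝ (fderiv ℝ a) u X Y = σ * G u X Y := fun X Y => by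
    rw [← h X Y, hessian_apply, h0]; simp
  have h1 := ((hasDerivAt_inv hs).comp_hasFDerivAt u (hG.hasFDerivAt_sqrt_gramDet hu hD)).smul
    (((hd' 0).smul_const (vec 1)).sub ((hd' 1).smul_const (vec 0)))
  refine ⟨_, h1, fun z => ?_⟩
  rw [map_eq_coord (G u z) z]
  simp [areaForm_apply, h0, hH]
  field_simp

/-- The velocity of the rotated gradient field around a critical point, at which the Hessian is
`σ G`, approaches `σ`. -/
theorem IsMetricOn.conjGrad_isLittleO (hG : IsMetricOn G Ω) (hu : u ∈ Ω)
    (hpos : ∀ X, X ≠ 0 → 0 < G u X X) (ha : ContDiffAt ℝ 2 a u) {σ : ℝ}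
    (h : ∀ X Y, hessian G a u X Y = σ * G u X Y) (h0 : fderiv ℝ a u = 0) {c : Plane ≃L[ℝ] ℂ}
    (hc : ∀ z, ‖c z‖ ^ 2 = G u z z)
    (hc' : ∀ z v, (starRingEnd ℂ (c z) * c v).im = √(gramDet (G u)) * areaForm z v)
    {η : ℝ} (hη : 0 < η) : ∀ᶠ x in 𝓝 u,
      |(starRingEnd ℂ (c (x - u)) * c (conjGrad G a x)).im - σ * ‖c (x - u)‖ ^ 2| ≤
        η * ‖c (x - u)‖ ^ 2 := by
  obtain ⟨C, hC, hCz⟩ := hG.hasFDerivAt_conjGrad hu hpos ha h h0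
  have hX0 : conjGrad G a u = 0 := by simp [conjGrad, h0]
  have h1 : (fun x => c (conjGrad G a x - C (x - u))) =o[𝓝 u] fun x => c (x - u) := by
    have h2 : (fun x => conjGrad G a x - C (x - u)) =o[𝓝 u] fun x => x - u := by
      simpa [hX0] using hC.isLittleO
    exact ((c : Plane →L[ℝ] ℂ).isBigO_comp _ _).trans_isLittleO
      (h2.trans_isBigO (c.isBigO_sub_rev (𝓝 u) u))
  filter_upwards [h1.bound hη] with x hx
  have e1 : (starRingEnd ℂ (c (x - u)) * c (conjGrad G a x)).im - σ * ‖c (x - u)‖ ^ 2 =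
      (starRingEnd ℂ (c (x - u)) * c (conjGrad G a x - C (x - u))).im := by
    rw [hc, ← hCz, ← hc', map_sub c (conjGrad G a x), mul_sub, Complex.sub_im]
  rw [e1]
  refine (Complex.abs_im_le_norm _).trans ?_
  rw [norm_mul, RCLike.norm_conj]
  have := mul_le_mul_of_nonneg_left hx (norm_nonneg (c (x - u)))
  linarith [sq (‖c (x - u)‖)]

/-- The behaviour of `*da` and of `|∇a|²` near a critical point. -/
theorem IsMetricOn.starDiff_isLittleO (hG : IsMetricOn G Ω) (hu : u ∈ Ω)
    (hpos : ∀ X, X ≠ 0 → 0 < G u X X) (ha : ContDiffAt ℝ 2 a u) {σ : ℝ}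
    (h : ∀ X Y, hessian G a u X Y = σ * G u X Y) (h0 : fderiv ℝ a u = 0) {c : Plane ≃L[ℝ] ℂ}
    (hc : ∀ z, ‖c z‖ ^ 2 = G u z z)
    (hc' : ∀ z v, (starRingEnd ℂ (c z) * c v).im = √(gramDet (G u)) * areaForm z v)
    {η : ℝ} (hη : 0 < η) : ∀ᶠ x in 𝓝 u,
      |starDiff G a x (c.symm (Complex.I * c (x - u))) - σ * ‖c (x - u)‖ ^ 2| ≤
        η * ‖c (x - u)‖ ^ 2 ∧
      |gradSq G a x - σ ^ 2 * ‖c (x - u)‖ ^ 2| ≤ η * ‖c (x - u)‖ ^ 2 := by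
  have hD := gramDet_pos (hG.symm u hu) hpos
  have hd := ((ha.fderiv_right (m := 1) (by norm_num)).differentiableAt (by norm_num)).hasFDerivAt
  have hW0 : sharp G u (fderiv ℝ a u) = 0 := by simp [h0]
  have hbig : (fun x => ‖x - u‖ * ‖x - u‖) =O[𝓝 u] fun x => ‖c (x - u)‖ ^ 2 := by
    have := (c.isBigO_sub_rev (𝓝 u) u).norm_norm
    simpa [sq] using this.mul this
  let J : Plane →L[ℝ] Plane := (c.symm : ℂ →L[ℝ] Plane).comp
    ((ContinuousLinearMap.mul ℝ ℂ Complex.I).comp (c : Plane →L[ℝ] ℂ))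
  have hJ : HasFDerivAt (fun x => J (x - u)) J u := by
    have := J.hasFDerivAt.comp u ((hasFDerivAt_id u).sub_const u)
    rwa [ContinuousLinearMap.comp_id] at this
  have h1 := (hG.hasFDerivAt_starDiff hu hD ha h).isLittleO_apply hJ
    (by simp [starDiff, hW0]) (by simp)
  have h2 := hd.isLittleO_apply (hG.hasFDerivAt_grad hu ha h) h0 hW0
  filter_upwards [(h1.trans_isBigO hbig).bound hη, (h2.trans_isBigO hbig).bound hη] with x e1 e2
  have hn : ‖(‖c (x - u)‖ ^ 2)‖ = ‖c (x - u)‖ ^ 2 := by simp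
  have hH : ∀ X Y, fderiv ℝ (fderiv ℝ a) u X Y = σ * G u X Y := fun X Y => by
    rw [← h X Y, hessian_apply, h0]; simp
  rw [hn, Real.norm_eq_abs] at e1 e2
  constructor
  · have h3 : (starRingEnd ℂ (c (x - u)) * c (J (x - u))).im = ‖c (x - u)‖ ^ 2 := by
      change (starRingEnd ℂ (c (x - u)) * c (c.symm (Complex.I * c (x - u)))).im = _
      rw [c.apply_symm_apply]
      generalize c (x - u) = w
      simp [Complex.sq_norm, Complex.normSq_apply]
    have h4 : (√(gramDet (G u)) • (σ • areaForm + (ContinuousLinearMap.compL ℝ Plane Plane ℝ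
        (areaForm (sharp G u (fderiv ℝ a u)))).comp (christoffel G u))) (x - u) (J (x - u)) =
        σ * ‖c (x - u)‖ ^ 2 := by
      rw [← h3, hc', hW0]
      generalize J (x - u) = w
      generalize x - u = z
      simp only [smul_apply, map_zero, ContinuousLinearMap.zero_comp, smul_eq_mul,
        add_zero]
      ring
    rw [h4] at e1
    exact e1
  · have h4 : fderiv ℝ (fderiv ℝ a) u (x - u) ((σ • ContinuousLinearMap.id ℝ Plane
        - (christoffel G u).flip (sharp G u (fderiv ℝ a u))) (x - u)) =
        σ ^ 2 * ‖c (x - u)‖ ^ 2 := by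
      rw [hH, hW0, hc]
      generalize x - u = z
      simp
      ring
    rw [h4] at e2
    exact e2

/-- A function is constant near a critical point if its Hessian factor is bounded there by the
distance of the function from the critical value: the pair `(a - k, da)` then satisfies a linear
differential inequality. -/
theorem IsMetricOn.eventually_eq_of_critical (hG : IsMetricOn G Ω) (hu : u ∈ Ω)
    (ha : ContDiffAt ℝ 3 a u) {σ : Plane → ℝ} {L k : ℝ}
    (h : ∀ x ∈ Ω, ∀ X Y, hessian G a x X Y = σ x * G x X Y)
    (hσ : ∀ᶠ x in 𝓝 u, |σ x| ≤ L * |a x - k|) (h0 : fderiv ℝ a u = 0) (hk : a u = k) :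
    ∀ᶠ x in 𝓝 u, a x = k := by
  have hGb := (hG.contDiffAt hu).continuousAt.norm.eventually
    (Iio_mem_nhds (lt_add_one ‖G u‖))
  have hCb := (hG.contDiffAt_christoffel hu).continuousAt.norm.eventually
    (Iio_mem_nhds (lt_add_one ‖christoffel G u‖))
  obtain ⟨r, hr, hball⟩ := Metric.eventually_nhds_iff_ball.1
    (hGb.and (hCb.and (hσ.and ((ha.eventually (by simp)).and (hG.isOpen.mem_nhds hu)))))
  have hLnn : 0 ≤ |L| := abs_nonneg L
  set N := max 1 (|L| * (‖G u‖ + 1) + (‖christoffel G u‖ + 1)) with hN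
  have hmain : ∀ x ∈ Metric.ball u r, (a x - k, fderiv ℝ a x) = (0 : ℝ × (Plane →L[ℝ] ℝ)) := by
    intro x hx
    refine eq_zero_of_norm_fderiv_le (x₀ := u) (r := r) (L := N)
      (f := fun x => (a x - k, fderiv ℝ a x))
      (f' := fun x => (fderiv ℝ a x).prod (fderiv ℝ (fderiv ℝ a) x)) ?_ ?_ ?_ hx
    · intro x hx
      have hax := (hball x hx).2.2.2.1
      exact (((hax.differentiableAt (by norm_num)).hasFDerivAt).sub_const k).prodMk
        ((hax.fderiv_right (m := 2) (by norm_num)).differentiableAt (by norm_num)).hasFDerivAt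
    · intro x hx
      obtain ⟨b1, b2, b3, -, hxΩ⟩ := hball x hx
      have b1 : ‖G x‖ < ‖G u‖ + 1 := b1
      have b2 : ‖christoffel G x‖ < ‖christoffel G u‖ + 1 := b2
      rw [ContinuousLinearMap.opNorm_prod, Prod.norm_def, Prod.norm_def]
      set m := max ‖a x - k‖ ‖fderiv ℝ a x‖ with hm
      have hm1 : |a x - k| ≤ m := le_max_left _ _
      have hm2 : ‖fderiv ℝ a x‖ ≤ m := le_max_right _ _
      have hm0 : 0 ≤ m := (abs_nonneg _).trans hm1
      have hσm : |σ x| ≤ |L| * m :=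
        b3.trans ((mul_le_mul_of_nonneg_right (le_abs_self L) (abs_nonneg _)).trans
          (mul_le_mul_of_nonneg_left hm1 hLnn))
      refine max_le ?_ ?_
      · calc ‖fderiv ℝ a x‖ ≤ 1 * m := by rw [one_mul]; exact hm2
          _ ≤ N * m := mul_le_mul_of_nonneg_right (le_max_left _ _) hm0
      · have hDD : ∀ X Y, fderiv ℝ (fderiv ℝ a) x X Y =
            σ x * G x X Y + fderiv ℝ a x (christoffel G x X Y) := fun X Y => by
          rw [← h x hxΩ, hessian_apply]; ring
        refine ContinuousLinearMap.opNorm_le_bound₂ _ (by positivity) fun X Y => ?_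
        rw [hDD]
        have c1 : ‖G x X Y‖ ≤ (‖G u‖ + 1) * ‖X‖ * ‖Y‖ :=
          ((G x).le_opNorm₂ X Y).trans (by gcongr)
        have c2 : ‖christoffel G x X Y‖ ≤ (‖christoffel G u‖ + 1) * ‖X‖ * ‖Y‖ :=
          ((christoffel G x).le_opNorm₂ X Y).trans (by gcongr)
        calc ‖σ x * G x X Y + fderiv ℝ a x (christoffel G x X Y)‖
            ≤ |σ x| * ‖G x X Y‖ + ‖fderiv ℝ a x‖ * ‖christoffel G x X Y‖ := by
              refine (norm_add_le _ _).trans (add_le_add ?_ (ContinuousLinearMap.le_opNorm _ _))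
              rw [norm_mul, Real.norm_eq_abs]
          _ ≤ (|L| * m) * ((‖G u‖ + 1) * ‖X‖ * ‖Y‖)
              + m * ((‖christoffel G u‖ + 1) * ‖X‖ * ‖Y‖) := by gcongr
          _ = (|L| * (‖G u‖ + 1) + (‖christoffel G u‖ + 1)) * m * ‖X‖ * ‖Y‖ := by ring
          _ ≤ N * m * ‖X‖ * ‖Y‖ := by gcongr; exact le_max_right _ _
    · simp [hk, h0]
  filter_upwards [Metric.ball_mem_nhds u hr] with x hx
  have := congrArg Prod.fst (hmain x hx)
  simp at this
  linarith

end LocalGeometry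

end

/-! ### Angular coordinates on surfaces -/

noncomputable section

open Filter Topology

namespace LocalGeometry

variable {G : Plane → Plane →L[ℝ] Plane →L[ℝ] ℝ} {Ω : Set Plane} {a : Plane → ℝ} {u : Plane}

/-- The differential and the angular form of a function form a coframe where the gradient does not
vanish. -/
theorem IsMetricOn.exists_coframe (hG : IsMetricOn G Ω) (hu : u ∈ Ω)
    (hpos : ∀ X, X ≠ 0 → 0 < G u X X) (hP : gradSq G a u ≠ 0) :
    ∃ L : Plane ≃L[ℝ] ℝ × ℝ, (L : Plane →L[ℝ] ℝ × ℝ) =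
      (fderiv ℝ a u).prod (angularForm G a u) := by
  have hinj : Function.Injective ((fderiv ℝ a u).prod (angularForm G a u)) := by
    rw [injective_iff_map_eq_zero]
    intro v hv
    obtain ⟨h1, h2⟩ := Prod.ext_iff.1 hv
    have h1 : fderiv ℝ a u v = 0 := h1
    have h2 : angularForm G a u v = 0 := h2
    have h3 := hG.angularForm_sq (a := a) hu (gramDet_pos (hG.symm u hu) hpos) v
    rw [h2, h1] at h3
    by_contra hne
    have := (hpos v hne).ne'
    field_simp at h3
    simp at h3
    exact this (h3.resolve_left hP)
  let e : Plane ≃ₗ[ℝ] ℝ × ℝ := LinearMap.linearEquivOfInjective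
    ((fderiv ℝ a u).prod (angularForm G a u) : Plane →ₗ[ℝ] ℝ × ℝ) hinj (by simp)
  exact ⟨e.toContinuousLinearEquiv, by ext v <;> rfl⟩

/-- Where the gradient of `a` does not vanish, `a` is the first of two local coordinates, the
differential of the second of which is the angular form of `a`. -/
theorem IsMetricOn.exists_angular_coordinates (hG : IsMetricOn G Ω) (hu : u ∈ Ω)
    (hpos : ∀ x ∈ Ω, ∀ X, X ≠ 0 → 0 < G x X X) (ha : ContDiffOn ℝ 3 a Ω) {σ : Plane → ℝ}
    (h : ∀ x ∈ Ω, ∀ X Y, hessian G a x X Y = σ x * G x X Y) (hP : gradSq G a u ≠ 0) :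
    ∃ Φ : OpenPartialHomeomorph Plane (ℝ × ℝ), u ∈ Φ.source ∧ Φ.source ⊆ Ω ∧
      (∀ x, (Φ x).1 = a x) ∧ (∀ x ∈ Φ.source, gradSq G a x ≠ 0) ∧
      (∀ x ∈ Φ.source, HasFDerivAt (fun x => (Φ x).2) (angularForm G a x) x) ∧
      ContDiffOn ℝ 1 (fun x => (Φ x).2) Φ.source := by
  have haAt : ∀ x ∈ Ω, ContDiffAt ℝ 3 a x := fun x hx => ha.contDiffAt (hG.isOpen.mem_nhds hx)
  have hPc : ContinuousAt (gradSq G a) u :=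
    (hG.hasFDerivAt_gradSq hu ((haAt u hu).of_le (by norm_num)) (h u hu)).continuousAt
  have hΩ : ∀ᶠ x in 𝓝 u, x ∈ Ω := hG.isOpen.mem_nhds hu
  obtain ⟨r, hr, hball⟩ := Metric.eventually_nhds_iff_ball.1 (hΩ.and (hPc.eventually (isOpen_ne.mem_nhds hP)))
  have hform : ∀ x ∈ Metric.ball u r, DifferentiableAt ℝ (angularForm G a) x ∧
      ∀ X Y, fderiv ℝ (angularForm G a) x X Y = fderiv ℝ (angularForm G a) x Y X := fun x hx =>
    hG.fderiv_angularForm_symm (hball x hx).1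
      (gramDet_pos (hG.symm x (hball x hx).1) (hpos x (hball x hx).1))
      ((haAt x (hball x hx).1).of_le (by norm_num)) (h x (hball x hx).1) (hball x hx).2
  obtain ⟨φ, hφ⟩ := (convex_ball u r).exists_forall_hasFDerivAt_of_fderiv_symmetric
    Metric.isOpen_ball (fun x hx => (hform x hx).1.differentiableWithinAt)
    (fun x hx => (hform x hx).2)
  have hu' : u ∈ Metric.ball u r := Metric.mem_ball_self hr
  obtain ⟨L, hL⟩ := hG.exists_coframe hu (hpos u hu) hP
  have hstrict : HasStrictFDerivAt (fun x => (a x, φ x)) (L : Plane →L[ℝ] ℝ × ℝ) u := by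
    rw [hL]
    refine hasStrictFDerivAt_of_hasFDerivAt_of_continuousAt
      (f' := fun x => (fderiv ℝ a x).prod (angularForm G a x)) ?_ ?_
    · filter_upwards [Metric.ball_mem_nhds u hr] with x hx
      exact ((haAt x (hball x hx).1).differentiableAt (by norm_num)).hasFDerivAt.prodMk (hφ x hx)
    · have h1 : ContinuousAt (fderiv ℝ a) u :=
        ((haAt u hu).fderiv_right (m := 1) (by norm_num)).continuousAt
      exact (ContinuousLinearMap.prodₗᵢ (𝕜 := ℝ) (E := Plane) (F := ℝ) (G := ℝ) ℝ).continuous.continuousAt.comp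
        (h1.prodMk (hform u hu').1.continuousAt)
  let Φ := (hstrict.toOpenPartialHomeomorph _).restrOpen (Metric.ball u r) Metric.isOpen_ball
  have hΦ : ∀ x, Φ x = (a x, φ x) := fun x => rfl
  have hsrc : Φ.source ⊆ Metric.ball u r := fun x hx => hx.2
  refine ⟨Φ, ⟨hstrict.mem_toOpenPartialHomeomorph_source, hu'⟩,
    fun x hx => (hball x (hsrc hx)).1, fun x => rfl, fun x hx => (hball x (hsrc hx)).2,
    fun x hx => hφ x (hsrc hx), fun x hx => ?_⟩
  refine ContDiffAt.contDiffWithinAt (contDiffAt_one_iff.2 ⟨angularForm G a, Metric.ball u r,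
    Metric.isOpen_ball.mem_nhds (hsrc hx), fun y hy => ?_, hφ⟩)
  exact (hform y hy).1.continuousAt.continuousWithinAt

/-- Two linear forms with the same square agree up to sign. -/
theorem eq_smul_of_sq_eq {F : Type*} [NormedAddCommGroup F] [NormedSpace ℝ F] {ξ ω' : F →L[ℝ] ℝ}
    (h : ∀ v, ξ v ^ 2 = ω' v ^ 2) {w : F} {σ : ℝ} (hσ : σ ^ 2 = 1) (h1 : 0 < ω' w)
    (h2 : 0 < σ * ξ w) : ξ = σ • ω' := by
  have hw : σ * ξ w = ω' w := by
    have : (σ * ξ w) ^ 2 = ω' w ^ 2 := by rw [mul_pow, hσ, h, one_mul]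
    exact (sq_eq_sq₀ h2.le h1.le).1 this
  ext v
  have hp : ξ v * ξ w = ω' v * ω' w := by
    have := h (v + w)
    rw [map_add, map_add] at this
    linarith [h v, h w, add_sq (ξ v) (ξ w), add_sq (ω' v) (ω' w)]
  have e : (ξ v - σ * ω' v) * ω' w = 0 := by
    linear_combination σ * hp - ξ v * hw
  have := (mul_eq_zero.1 e).resolve_right h1.ne'
  simp
  linarith

end LocalGeometry

open LocalGeometry

variable {M : Type*} [TopologicalSpace M] [ChartedSpace Plane M]

/-- The local coordinates `(u, φ)` on a surface such that `dφ` is, up to sign, the angular form of `u`.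
The sign being left open, the condition on `dφ` is stated for its square. -/
def angularAtlas (g : BilinField 𝓘(ℝ, Plane) M) (u : M → ℝ) :
    Set (OpenPartialHomeomorph M (ℝ × ℝ)) :=
  {Ψ | (∀ y ∈ Ψ.source, (Ψ y).1 = u y) ∧
    ContMDiffOn 𝓘(ℝ, Plane) 𝓘(ℝ, ℝ) 1 (fun y => (Ψ y).2) Ψ.source ∧
    ∀ y ∈ Ψ.source, g.gradSq u y ≠ 0 ∧ ∀ v : TangentSpace 𝓘(ℝ, Plane) y,
      (show ℝ from mfderiv 𝓘(ℝ, Plane) 𝓘(ℝ, ℝ) (fun y => (Ψ y).2) y v) ^ 2 =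
        (g.gradSq u y * g y v v - (show ℝ from mfderiv 𝓘(ℝ, Plane) 𝓘(ℝ, ℝ) u y v) ^ 2) /
          g.gradSq u y ^ 2}

/-- A positive definite metric on a surface, together with a function whose Hessian is a multiple of
the metric, the factor being a given function `β` of the function itself. -/
structure IsConcircular [IsManifold 𝓘(ℝ, Plane) 4 M] (g : BilinField 𝓘(ℝ, Plane) M) (u : M → ℝ)
    (β : ℝ → ℝ) : Prop where
  isPseudoRiemannian : g.IsPseudoRiemannian 3
  pos : ∀ (p : M) (X : TangentSpace 𝓘(ℝ, Plane) p), X ≠ 0 → 0 < g p X X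
  contMDiff : ContMDiff 𝓘(ℝ, Plane) 𝓘(ℝ, ℝ) 4 u
  hessianEq : g.HessianEq u fun y => β (u y)

namespace IsConcircular

variable [IsManifold 𝓘(ℝ, Plane) 4 M] {g : BilinField 𝓘(ℝ, Plane) M} {u : M → ℝ} {β : ℝ → ℝ}
  (hc : IsConcircular g u β)
include hc

theorem isMetricOn {e : OpenPartialHomeomorph M Plane} (he : e ∈ atlas Plane M) :
    IsMetricOn (g.inChart e) (e.extend 𝓘(ℝ, Plane)).target := by
  rw [← chartDom_univ]; exact hc.isPseudoRiemannian.isMetricOn he isOpen_univ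

theorem inChart_pos {e : OpenPartialHomeomorph M Plane} (he : e ∈ atlas Plane M) {x : Plane}
    (hx : x ∈ (e.extend 𝓘(ℝ, Plane)).target) {X : Plane} (hX : X ≠ 0) :
    0 < g.inChart e x X X := by
  rw [BilinField.inChart_apply]
  refine hc.pos _ _ fun h => hX ?_
  exact (isInvertible_mfderiv_extend_symm he hx).injective (h.trans (map_zero _).symm)

theorem contDiffOn {e : OpenPartialHomeomorph M Plane} (he : e ∈ atlas Plane M) :
    ContDiffOn ℝ 4 (u ∘ (e.extend 𝓘(ℝ, Plane)).symm) (e.extend 𝓘(ℝ, Plane)).target := by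
  rw [← chartDom_univ]; exact (hc.contMDiff.contMDiffOn (s := univ)).contDiffOn_chart le_rfl he

theorem contDiffAt {e : OpenPartialHomeomorph M Plane} (he : e ∈ atlas Plane M) {x : Plane}
    (hx : x ∈ (e.extend 𝓘(ℝ, Plane)).target) :
    ContDiffAt ℝ 4 (u ∘ (e.extend 𝓘(ℝ, Plane)).symm) x :=
  (hc.contDiffOn he).contDiffAt ((isOpen_extend_target e).mem_nhds hx)

theorem mdifferentiableAt (y : M) : MDifferentiableAt 𝓘(ℝ, Plane) 𝓘(ℝ, ℝ) u y :=
  hc.contMDiff.mdifferentiableAt (by norm_num)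

theorem gramDet_pos {e : OpenPartialHomeomorph M Plane} (he : e ∈ atlas Plane M) {x : Plane}
    (hx : x ∈ (e.extend 𝓘(ℝ, Plane)).target) : 0 < gramDet (g.inChart e x) :=
  LocalGeometry.gramDet_pos ((hc.isMetricOn he).symm x hx) fun _ => hc.inChart_pos he hx

theorem gradSq_inChart {e : OpenPartialHomeomorph M Plane} (he : e ∈ atlas Plane M) {x : Plane}
    (hx : x ∈ (e.extend 𝓘(ℝ, Plane)).target) :
    gradSq (g.inChart e) (u ∘ (e.extend 𝓘(ℝ, Plane)).symm) x =
      g.gradSq u ((e.extend 𝓘(ℝ, Plane)).symm x) :=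
  hc.isPseudoRiemannian.gradSq_inChart he hx (hc.mdifferentiableAt _)

theorem continuousAt_angularForm {e : OpenPartialHomeomorph M Plane} (he : e ∈ atlas Plane M)
    {x : Plane} (hx : x ∈ (e.extend 𝓘(ℝ, Plane)).target)
    (hP : g.gradSq u ((e.extend 𝓘(ℝ, Plane)).symm x) ≠ 0) :
    ContinuousAt (angularForm (g.inChart e) (u ∘ (e.extend 𝓘(ℝ, Plane)).symm)) x :=
  ((hc.isMetricOn he).fderiv_angularForm_symm hx (hc.gramDet_pos he hx)
    ((hc.contDiffAt he hx).of_le (by norm_num)) (hc.hessianEq e he x hx)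
    (by rwa [hc.gradSq_inChart he hx])).1.continuousAt

/-- In any chart the differential of the angular coordinate is the angular form, up to a locally
constant sign. -/
theorem exists_hasFDerivAt_snd {Ψ : OpenPartialHomeomorph M (ℝ × ℝ)} (hΨ : Ψ ∈ angularAtlas g u)
    {e : OpenPartialHomeomorph M Plane} (he : e ∈ atlas Plane M) {x₀ : Plane}
    (hx₀ : x₀ ∈ chartDom e Ψ.source) : ∃ σ : ℝ, σ ^ 2 = 1 ∧ ∀ᶠ x in 𝓝 x₀,
      HasFDerivAt ((fun y => (Ψ y).2) ∘ (e.extend 𝓘(ℝ, Plane)).symm)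
        (σ • angularForm (g.inChart e) (u ∘ (e.extend 𝓘(ℝ, Plane)).symm) x) x := by
  obtain ⟨-, hsm, hsq⟩ := hΨ
  have hO := isOpen_chartDom e Ψ.open_source
  have hd : ContDiffOn ℝ 1 ((fun y => (Ψ y).2) ∘ (e.extend 𝓘(ℝ, Plane)).symm)
      (chartDom e Ψ.source) := hsm.contDiffOn_chart (by norm_num) he
  have hsq' : ∀ x ∈ chartDom e Ψ.source, ∀ w,
      fderiv ℝ ((fun y => (Ψ y).2) ∘ (e.extend 𝓘(ℝ, Plane)).symm) x w ^ 2 =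
        angularForm (g.inChart e) (u ∘ (e.extend 𝓘(ℝ, Plane)).symm) x w ^ 2 := by
    intro x hx w
    have h1 := (hsq _ hx.2).2 (mfderiv 𝓘(ℝ, Plane) 𝓘(ℝ, Plane) (e.extend 𝓘(ℝ, Plane)).symm x w)
    have hmd : MDifferentiableAt 𝓘(ℝ, Plane) 𝓘(ℝ, ℝ) (fun y => (Ψ y).2)
        ((e.extend 𝓘(ℝ, Plane)).symm x) :=
      (hsm.contMDiffAt (Ψ.open_source.mem_nhds hx.2)).mdifferentiableAt (by norm_num)
    rw [(hc.isMetricOn he).angularForm_sq hx.1 (hc.gramDet_pos he hx.1),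
      hc.gradSq_inChart he hx.1, fderiv_chart_comp he hx.1 (hc.mdifferentiableAt _),
      fderiv_chart_comp he hx.1 hmd]
    exact h1
  have hP := (hsq _ hx₀.2).1
  have hωc := hc.continuousAt_angularForm he hx₀.1 hP
  have hξc : ContinuousAt
      (fderiv ℝ ((fun y => (Ψ y).2) ∘ (e.extend 𝓘(ℝ, Plane)).symm)) x₀ :=
    ((hd.contDiffAt (hO.mem_nhds hx₀)).fderiv_right (m := 0) (by norm_num)).continuousAt
  set w := conjGrad (g.inChart e) (u ∘ (e.extend 𝓘(ℝ, Plane)).symm) x₀ with hw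
  have hω1 : angularForm (g.inChart e) (u ∘ (e.extend 𝓘(ℝ, Plane)).symm) x₀ w = 1 :=
    angularForm_conjGrad (hc.gramDet_pos he hx₀.1) (by rwa [hc.gradSq_inChart he hx₀.1])
  set σ := fderiv ℝ ((fun y => (Ψ y).2) ∘ (e.extend 𝓘(ℝ, Plane)).symm) x₀ w with hσ
  have hσ1 : σ ^ 2 = 1 := by rw [hσ, hsq' x₀ hx₀, hω1, one_pow]
  have c1 : ContinuousAt (fun x =>
      angularForm (g.inChart e) (u ∘ (e.extend 𝓘(ℝ, Plane)).symm) x w) x₀ :=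
    hωc.clm_apply continuousAt_const
  have c2 : ContinuousAt (fun x =>
      σ * fderiv ℝ ((fun y => (Ψ y).2) ∘ (e.extend 𝓘(ℝ, Plane)).symm) x w) x₀ :=
    continuousAt_const.mul (hξc.clm_apply continuousAt_const)
  refine ⟨σ, hσ1, ?_⟩
  filter_upwards [c1.eventually (lt_mem_nhds (a := 0) (by beta_reduce; rw [hω1]; exact one_pos)),
    c2.eventually (lt_mem_nhds (a := 0) (by beta_reduce; rw [← hσ, ← sq, hσ1]; exact one_pos)),
    hO.mem_nhds hx₀] with x h1 h2 hx
  rw [← eq_smul_of_sq_eq (hsq' x hx) hσ1 h1 h2]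
  exact ((hd.contDiffAt (hO.mem_nhds hx)).differentiableAt (by norm_num)).hasFDerivAt

theorem isHalfTranslationAtlas : IsHalfTranslationAtlas (angularAtlas g u) u where
  fst_eq Ψ hΨ := hΨ.1
  compat Ψ hΨ Ψ' hΨ' y hy hy' := by
    have he := chart_mem_atlas Plane y
    obtain ⟨σ, hσ, h1⟩ := hc.exists_hasFDerivAt_snd hΨ he (chartAt_mem_chartDom hy)
    obtain ⟨σ', hσ', h2⟩ := hc.exists_hasFDerivAt_snd hΨ' he (chartAt_mem_chartDom hy')
    refine ⟨σ' * σ, by rw [mul_pow, hσ, hσ', one_mul], ?_⟩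
    obtain ⟨r, hr, hball⟩ := Metric.eventually_nhds_iff_ball.1 (h1.and h2)
    set x₀ := (chartAt Plane y).extend 𝓘(ℝ, Plane) y with hx₀
    set s := ((chartAt Plane y).extend 𝓘(ℝ, Plane)).symm with hs
    have hconst : ∀ x ∈ Metric.ball x₀ r,
        ((Ψ' (s x)).2 - σ' * σ * (Ψ (s x)).2) = (Ψ' (s x₀)).2 - σ' * σ * (Ψ (s x₀)).2 := by
      intro x hx
      have hd : ∀ x ∈ Metric.ball x₀ r, HasFDerivAt
          (fun x => (Ψ' (s x)).2 - σ' * σ * (Ψ (s x)).2) (0 : Plane →L[ℝ] ℝ) x := by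
        intro x hx
        refine ((hball x hx).2.sub ((hball x hx).1.const_mul (σ' * σ))).congr_fderiv ?_
        rw [smul_smul, mul_assoc, ← sq, hσ, mul_one, sub_self]
      refine (convex_ball x₀ r).is_const_of_fderivWithin_eq_zero (𝕜 := ℝ)
        (fun v hv => (hd v hv).differentiableAt.differentiableWithinAt) ?_ hx
        (Metric.mem_ball_self hr)
      intro v hv
      rw [fderivWithin_of_isOpen Metric.isOpen_ball hv, (hd v hv).fderiv]
    have hcont : ContinuousAt (chartAt Plane y) y :=
      (chartAt Plane y).continuousAt (mem_chart_source Plane y)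
    filter_upwards [(chartAt Plane y).open_source.mem_nhds (mem_chart_source Plane y),
      hcont.preimage_mem_nhds (Metric.ball_mem_nhds _ hr)] with z hz1 hz2
    have h3 := hconst (chartAt Plane y z) (by simpa [hx₀] using hz2)
    have e1 : s (chartAt Plane y z) = z := by
      rw [hs, extend_symm_eq]; exact (chartAt Plane y).left_inv hz1
    have e2 : s x₀ = y := extend_symm_chartAt y
    rw [e1, e2] at h3
    linarith

theorem exists_mem_angularAtlas {y : M} (hy : g.gradSq u y ≠ 0) :
    ∃ Ψ ∈ angularAtlas g u, y ∈ Ψ.source := by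
  have he := chart_mem_atlas Plane y
  have hx₀ := (chartAt_mem_chartDom (E := Plane) (mem_univ y)).1
  obtain ⟨Φ, hΦ0, hΦΩ, hΦ1, hΦP, hΦd, hΦc⟩ := (hc.isMetricOn he).exists_angular_coordinates hx₀
    (fun x hx X => hc.inChart_pos he hx) ((hc.contDiffOn he).of_le (by norm_num))
    (hc.hessianEq _ he) (by rwa [hc.gradSq_inChart he hx₀, extend_symm_chartAt])
  set e := chartAt Plane y with hedef
  have hsymm : ∀ z ∈ e.source, (e.extend 𝓘(ℝ, Plane)).symm (e z) = z := fun z hz => by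
    rw [extend_symm_eq]; exact e.left_inv hz
  have hval : ∀ z, (e.trans Φ) z = Φ (e z) := fun z => rfl
  have hmem : ∀ z ∈ (e.trans Φ).source, z ∈ e.source ∧ e z ∈ Φ.source := fun z hz => by
    rwa [OpenPartialHomeomorph.trans_source] at hz
  have hsm : ContMDiffOn 𝓘(ℝ, Plane) 𝓘(ℝ, ℝ) 1 (fun z => (Φ (e z)).2) (e.trans Φ).source := by
    have h1 : ContMDiffOn 𝓘(ℝ, Plane) 𝓘(ℝ, Plane) 1 e e.source :=
      (contMDiffOn_of_mem_maximalAtlas (n := 4)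
        (IsManifold.subset_maximalAtlas he)).of_le (by norm_num)
    exact (contMDiffOn_iff_contDiffOn.2 hΦc).comp (h1.mono fun z hz => (hmem z hz).1)
      fun z hz => (hmem z hz).2
  refine ⟨e.trans Φ, ⟨fun z hz => ?_, hsm, fun z hz => ?_⟩, ?_⟩
  · rw [hval, hΦ1, Function.comp_apply, hsymm z (hmem z hz).1]
  · have hz1 := hΦΩ (hmem z hz).2
    have hP := hΦP _ (hmem z hz).2
    rw [hc.gradSq_inChart he hz1, hsymm z (hmem z hz).1] at hP
    refine ⟨hP, fun v => ?_⟩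
    have hmd : MDifferentiableAt 𝓘(ℝ, Plane) 𝓘(ℝ, ℝ) (fun z => (Φ (e z)).2)
        ((e.extend 𝓘(ℝ, Plane)).symm (e z)) := by
      rw [hsymm z (hmem z hz).1]
      exact (hsm.contMDiffAt ((e.trans Φ).open_source.mem_nhds hz)).mdifferentiableAt
        (by norm_num)
    have hev : (fun z => (Φ (e z)).2) ∘ (e.extend 𝓘(ℝ, Plane)).symm =ᶠ[𝓝 (e z)]
        fun x => (Φ x).2 := by
      filter_upwards [(isOpen_extend_target e).mem_nhds hz1] with x hx
      rw [extend_target_eq] at hx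
      rw [Function.comp_apply, extend_symm_eq, e.right_inv hx]
    have hfd := ((hΦd _ (hmem z hz).2).congr_of_eventuallyEq hev).fderiv
    have key : ∀ w : Plane, (show ℝ from mfderiv 𝓘(ℝ, Plane) 𝓘(ℝ, ℝ) (fun z => (Φ (e z)).2)
        ((e.extend 𝓘(ℝ, Plane)).symm (e z))
        (mfderiv 𝓘(ℝ, Plane) 𝓘(ℝ, Plane) (e.extend 𝓘(ℝ, Plane)).symm (e z) w)) ^ 2 =
        (g.gradSq u ((e.extend 𝓘(ℝ, Plane)).symm (e z)) * g ((e.extend 𝓘(ℝ, Plane)).symm (e z))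
          (mfderiv 𝓘(ℝ, Plane) 𝓘(ℝ, Plane) (e.extend 𝓘(ℝ, Plane)).symm (e z) w)
          (mfderiv 𝓘(ℝ, Plane) 𝓘(ℝ, Plane) (e.extend 𝓘(ℝ, Plane)).symm (e z) w) -
        (show ℝ from mfderiv 𝓘(ℝ, Plane) 𝓘(ℝ, ℝ) u ((e.extend 𝓘(ℝ, Plane)).symm (e z))
          (mfderiv 𝓘(ℝ, Plane) 𝓘(ℝ, Plane) (e.extend 𝓘(ℝ, Plane)).symm (e z) w)) ^ 2) /
        g.gradSq u ((e.extend 𝓘(ℝ, Plane)).symm (e z)) ^ 2 := by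
      intro w
      have h1 := (hc.isMetricOn he).angularForm_sq
        (a := u ∘ (e.extend 𝓘(ℝ, Plane)).symm) hz1 (hc.gramDet_pos he hz1) w
      rw [← hfd, hc.gradSq_inChart he hz1, fderiv_chart_comp he hz1 hmd,
        fderiv_chart_comp he hz1 (hc.mdifferentiableAt _)] at h1
      exact h1
    obtain ⟨w, hw⟩ := (isInvertible_mfderiv_extend_symm he hz1).surjective
      (show TangentSpace 𝓘(ℝ, Plane) ((e.extend 𝓘(ℝ, Plane)).symm (e z)) from v)
    have := key w
    rw [hw] at this
    generalize hy' : (e.extend 𝓘(ℝ, Plane)).symm (e z) = z' at this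
    rw [hsymm z (hmem z hz).1] at hy'
    subst hy'
    exact this
  · rw [OpenPartialHomeomorph.trans_source]
    exact ⟨mem_chart_source Plane y, by simpa using hΦ0⟩

end IsConcircular

end

/-! ### Angular curves -/

noncomputable section

open Filter Topology

/-- A function of a real variable whose derivative vanishes near a point is constant there. -/
theorem eventually_eq_of_hasDerivAt_zero {f : ℝ → ℝ} {θ₀ : ℝ}
    (h : ∀ᶠ θ in 𝓝 θ₀, HasDerivAt f 0 θ) : ∀ᶠ θ in 𝓝 θ₀, f θ = f θ₀ := by
  obtain ⟨r, hr, hball⟩ := Metric.eventually_nhds_iff_ball.1 h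
  filter_upwards [Metric.ball_mem_nhds θ₀ hr] with θ hθ
  refine (convex_ball θ₀ r).is_const_of_fderivWithin_eq_zero (𝕜 := ℝ)
    (fun v hv => (hball v hv).differentiableAt.differentiableWithinAt) ?_ hθ
    (Metric.mem_ball_self hr)
  intro v hv
  rw [fderivWithin_of_isOpen Metric.isOpen_ball hv, (hball v hv).hasFDerivAt.fderiv]
  ext
  simp

/-- The mean angular velocity of a closed curve in the punctured complex plane, parametrized by an
interval of length `2π`, is an integer, and it is attained. -/
theorem exists_im_deriv_div_eq_intCast {w w' : ℝ → ℂ} (hw : ∀ θ, HasDerivAt w (w' θ) θ)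
    (hw' : Continuous w') (h0 : ∀ θ, w θ ≠ 0) (hper : w (2 * Real.pi) = w 0) :
    ∃ θ, ∃ k : ℤ, (w' θ / w θ).im = k := by
  have hwc : Continuous w := continuous_iff_continuousAt.2 fun θ => (hw θ).continuousAt
  have hc : Continuous fun θ => w' θ / w θ := hw'.div hwc h0
  let I : ℝ → ℂ := fun θ => ∫ t in (0 : ℝ)..θ, w' t / w t
  have hI : ∀ θ, HasDerivAt I (w' θ / w θ) θ := fun θ => hc.integral_hasStrictDerivAt 0 θ |>.hasDerivAt
  have hI0 : I 0 = 0 := intervalIntegral.integral_same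
  have hd : ∀ θ, HasDerivAt (fun θ => w θ * Complex.exp (-I θ)) 0 θ := by
    intro θ
    refine ((hw θ).mul (hI θ).neg.cexp).congr_deriv ?_
    have := h0 θ
    field_simp
    ring
  have hconst : w (2 * Real.pi) * Complex.exp (-I (2 * Real.pi)) = w 0 * Complex.exp (-I 0) :=
    is_const_of_deriv_eq_zero (fun θ => (hd θ).differentiableAt) (fun θ => (hd θ).deriv) _ _
  rw [hper, hI0, neg_zero, Complex.exp_zero] at hconst
  obtain ⟨k, hk⟩ := Complex.exp_eq_one_iff.1 (mul_left_cancel₀ (h0 0) hconst)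
  have him : ∀ θ, HasDerivAt (fun θ => (I θ).im) ((w' θ / w θ).im) θ := fun θ =>
    (Complex.imCLM.hasFDerivAt.comp_hasDerivAt θ (hI θ))
  obtain ⟨θ, -, hθ⟩ := exists_hasDerivAt_eq_slope (fun θ => (I θ).im) (fun θ => (w' θ / w θ).im)
    Real.two_pi_pos (fun θ _ => (him θ).continuousAt.continuousWithinAt) fun θ _ => him θ
  refine ⟨θ, -k, ?_⟩
  have h2 : (I (2 * Real.pi)).im = -(k * (2 * Real.pi)) := by
    have := congrArg Complex.im hk
    simp at this
    linarith
  rw [hθ, h2, hI0]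
  have := Real.two_pi_pos.ne'
  push_cast
  simp
  field_simp

open LocalGeometry

variable {M : Type*} [TopologicalSpace M] [ChartedSpace Plane M]

namespace IsConcircular

variable [IsManifold 𝓘(ℝ, Plane) 4 M] {g : BilinField 𝓘(ℝ, Plane) M} {u : M → ℝ} {β : ℝ → ℝ}
  (hc : IsConcircular g u β)
include hc

/-- A curve in a chart domain is an angular curve for the integral of the angular form along it. -/
theorem isAngularCurve {e : OpenPartialHomeomorph M Plane} (he : e ∈ atlas Plane M)
    {ζ ζ' : ℝ → Plane} (hζ : ∀ θ, HasDerivAt ζ (ζ' θ) θ)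
    (hζe : ∀ θ, ζ θ ∈ (e.extend 𝓘(ℝ, Plane)).target)
    (hP : ∀ θ, g.gradSq u ((e.extend 𝓘(ℝ, Plane)).symm (ζ θ)) ≠ 0) {s : ℝ → ℝ} {τ : ℝ}
    (hτ : τ ^ 2 = 1) (hs : ∀ θ, HasDerivAt s
      (τ * angularForm (g.inChart e) (u ∘ (e.extend 𝓘(ℝ, Plane)).symm) (ζ θ) (ζ' θ)) θ) :
    IsAngularCurve (angularAtlas g u) (fun θ => (e.extend 𝓘(ℝ, Plane)).symm (ζ θ)) s where
  continuous := by
    refine continuous_iff_continuousAt.2 fun θ => ?_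
    refine ContinuousAt.comp (f := ζ) ?_ (hζ θ).continuousAt
    rw [extend_symm_eq]
    exact e.continuousAt_symm (by have := hζe θ; rwa [extend_target_eq] at this)
  exists_eq θ₀ := by
    obtain ⟨Ψ, hΨ, hmem⟩ := hc.exists_mem_angularAtlas (hP θ₀)
    obtain ⟨σ, hσ, hev⟩ := hc.exists_hasFDerivAt_snd hΨ he ⟨hζe θ₀, hmem⟩
    refine ⟨Ψ, hΨ, hmem, σ * τ, by rw [mul_pow, hσ, hτ, one_mul], ?_⟩
    have hd : ∀ᶠ θ in 𝓝 θ₀, HasDerivAt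
        (fun θ => (Ψ ((e.extend 𝓘(ℝ, Plane)).symm (ζ θ))).2 - σ * τ * s θ) 0 θ := by
      filter_upwards [(hζ θ₀).continuousAt.eventually hev] with θ hθ
      refine ((hθ.comp_hasDerivAt θ (hζ θ)).sub ((hs θ).const_mul (σ * τ))).congr_deriv ?_
      rw [smul_apply, smul_eq_mul]
      linear_combination (-σ * angularForm (g.inChart e)
        (u ∘ (e.extend 𝓘(ℝ, Plane)).symm) (ζ θ) (ζ' θ)) * hτ
    filter_upwards [eventually_eq_of_hasDerivAt_zero hd] with θ hθ
    linarith

/-- Around a critical point at which the factor `β` is negative, small circles are angular curves of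
angular velocity less than `1 / b`, where `b` is less than the absolute value of the factor. -/
theorem exists_angular_circle {p : M} {m b : ℝ} (hm : β (u p) = -m) (hb : 0 < b) (hbm : b < m)
    (hcrit : fderiv ℝ (u ∘ ((chartAt Plane p).extend 𝓘(ℝ, Plane)).symm)
      ((chartAt Plane p).extend 𝓘(ℝ, Plane) p) = 0) :
    ∃ (γ : ℝ → M) (s s' : ℝ → ℝ), IsAngularCurve (angularAtlas g u) γ s ∧
      (∀ θ, γ (θ + 2 * Real.pi) = γ θ) ∧ (∀ θ, g.gradSq u (γ θ) ≠ 0) ∧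
      (∀ θ, HasDerivAt s (s' θ) θ) ∧ Continuous s' ∧ (∀ θ, 0 < s' θ) ∧ ∀ θ, b * s' θ < 1 := by
  have he := chart_mem_atlas Plane p
  have hx₀ := (chartAt_mem_chartDom (E := Plane) (mem_univ p)).1
  have hsx₀ : ((chartAt Plane p).extend 𝓘(ℝ, Plane)).symm
      ((chartAt Plane p).extend 𝓘(ℝ, Plane) p) = p := extend_symm_chartAt p
  set e := chartAt Plane p with hedef
  set x₀ := e.extend 𝓘(ℝ, Plane) p with hx₀def
  have hG := hc.isMetricOn he
  set a := u ∘ (e.extend 𝓘(ℝ, Plane)).symm with ha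
  have hpos : ∀ X, X ≠ 0 → 0 < g.inChart e x₀ X X := fun X => hc.inChart_pos he hx₀
  obtain ⟨c, hcn, hci⟩ := exists_complexCoord (hG.symm x₀ hx₀) hpos
  have hhess : ∀ X Y, hessian (g.inChart e) a x₀ X Y = (-m) * g.inChart e x₀ X Y := by
    intro X Y
    rw [← hm, ← hsx₀]
    exact hc.hessianEq e he x₀ hx₀ X Y
  -- the bounds below make `(m + η) / (m² - η) < 1 / b`
  obtain ⟨η, hη, hη1, hη2⟩ : ∃ η > 0, η < m ∧ η * (b + 1) < m * (m - b) := by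
    have h1 : 0 < m * (m - b) / (b + 1) := by
      have : 0 < m - b := by linarith
      have : 0 < m := by linarith
      positivity
    obtain ⟨η, h2, h3⟩ := exists_between (lt_min (by linarith : 0 < m) h1)
    refine ⟨η, h2, h3.trans_le (min_le_left _ _), ?_⟩
    have := h3.trans_le (min_le_right _ _)
    rwa [lt_div_iff₀ (by linarith)] at this
  have hΩ : ∀ᶠ x in 𝓝 x₀, x ∈ (e.extend 𝓘(ℝ, Plane)).target := hG.isOpen.mem_nhds hx₀
  have hest := (hG.starDiff_isLittleO hx₀ hpos ((hc.contDiffAt he hx₀).of_le (by norm_num)) hhess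
    hcrit hcn hci hη).and hΩ
  have hcs : Tendsto (fun w : ℂ => x₀ + c.symm w) (𝓝 0) (𝓝 x₀) := by
    have : ContinuousAt (fun w : ℂ => x₀ + c.symm w) 0 :=
      (continuous_const.add c.symm.continuous).continuousAt
    simpa [ContinuousAt] using this
  obtain ⟨r, hr, hball⟩ := Metric.eventually_nhds_iff_ball.1 (hcs.eventually hest)
  set δ := r / 2 with hδ
  have hδ0 : 0 < δ := by positivity
  set z : ℝ → ℂ := fun θ => δ * Complex.exp (θ * Complex.I) with hz
  have hzn : ∀ θ, ‖z θ‖ = δ := fun θ => by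
    simp [hz, Complex.norm_exp_ofReal_mul_I, abs_of_pos hδ0]
  have hzd : ∀ θ, HasDerivAt z (Complex.I * z θ) θ := fun θ => by
    have h1 : HasDerivAt (fun θ : ℝ => (θ : ℂ) * Complex.I) Complex.I θ := by
      simpa using (Complex.ofRealCLM.hasDerivAt (x := θ)).mul_const Complex.I
    refine (h1.cexp.const_mul (δ : ℂ)).congr_deriv ?_
    simp only [hz]; ring
  have hzball : ∀ θ, z θ ∈ Metric.ball (0 : ℂ) r := fun θ => by
    rw [mem_ball_zero_iff, hzn]; linarith
  set ζ : ℝ → Plane := fun θ => x₀ + c.symm (z θ) with hζ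
  set ζ' : ℝ → Plane := fun θ => c.symm (Complex.I * z θ) with hζ'
  have hζd : ∀ θ, HasDerivAt ζ (ζ' θ) θ := fun θ => by
    have := (c.symm : ℂ →L[ℝ] Plane).hasFDerivAt.comp_hasDerivAt θ (hzd θ)
    exact this.const_add x₀
  have hζc : Continuous ζ := continuous_iff_continuousAt.2 fun θ => (hζd θ).continuousAt
  have hζ'c : Continuous ζ' := c.symm.continuous.comp
    (continuous_const.mul (continuous_iff_continuousAt.2 fun θ => (hzd θ).continuousAt))
  have hcz : ∀ θ, c (ζ θ - x₀) = z θ := fun θ => by simp [hζ]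
  have hbd : ∀ θ, (|starDiff (g.inChart e) a (ζ θ) (ζ' θ) - (-m) * δ ^ 2| ≤ η * δ ^ 2 ∧
      |gradSq (g.inChart e) a (ζ θ) - (-m) ^ 2 * δ ^ 2| ≤ η * δ ^ 2) ∧
      ζ θ ∈ (e.extend 𝓘(ℝ, Plane)).target := by
    intro θ
    have := hball (z θ) (hzball θ)
    change (|starDiff (g.inChart e) a (ζ θ) (c.symm (Complex.I * c (ζ θ - x₀)))
      - (-m) * ‖c (ζ θ - x₀)‖ ^ 2| ≤ η * ‖c (ζ θ - x₀)‖ ^ 2 ∧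
      |gradSq (g.inChart e) a (ζ θ) - (-m) ^ 2 * ‖c (ζ θ - x₀)‖ ^ 2| ≤
        η * ‖c (ζ θ - x₀)‖ ^ 2) ∧ _ at this
    rw [hcz, hzn] at this
    exact this
  have hδ2 : 0 < δ ^ 2 := by positivity
  have hA : ∀ θ, 0 < -starDiff (g.inChart e) a (ζ θ) (ζ' θ) ∧
      -starDiff (g.inChart e) a (ζ θ) (ζ' θ) ≤ (m + η) * δ ^ 2 := fun θ => by
    have := abs_le.1 (hbd θ).1.1
    constructor <;> nlinarith
  have hPb : ∀ θ, (m ^ 2 - η) * δ ^ 2 ≤ gradSq (g.inChart e) a (ζ θ) := fun θ => by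
    have := abs_le.1 (hbd θ).1.2
    nlinarith
  have hmη : b * (m + η) < m ^ 2 - η := by linarith
  have hPpos : ∀ θ, 0 < gradSq (g.inChart e) a (ζ θ) := fun θ => by
    refine lt_of_lt_of_le (mul_pos (lt_trans ?_ hmη) hδ2) (hPb θ)
    have : 0 < m + η := by linarith
    positivity
  have hPne : ∀ θ, g.gradSq u ((e.extend 𝓘(ℝ, Plane)).symm (ζ θ)) ≠ 0 := fun θ => by
    rw [← hc.gradSq_inChart he (hbd θ).2]; exact (hPpos θ).ne'
  set s' : ℝ → ℝ := fun θ => (-1) * angularForm (g.inChart e) a (ζ θ) (ζ' θ) with hs'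
  have hs'c : Continuous s' := by
    refine continuous_const.mul (continuous_iff_continuousAt.2 fun θ => ?_)
    have h1 : ContinuousAt (fun θ => angularForm (g.inChart e) a (ζ θ)) θ :=
      ContinuousAt.comp (f := ζ) (hc.continuousAt_angularForm he (hbd θ).2 (hPne θ))
        hζc.continuousAt
    exact h1.clm_apply hζ'c.continuousAt
  have hs'eq : ∀ θ, s' θ =
      -starDiff (g.inChart e) a (ζ θ) (ζ' θ) / gradSq (g.inChart e) a (ζ θ) := fun θ => by
    simp only [hs', angularForm, smul_apply, smul_eq_mul]
    ring
  have hsd : ∀ θ, HasDerivAt (fun θ => ∫ t in (0 : ℝ)..θ, s' t) (s' θ) θ := fun θ =>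
    (hs'c.integral_hasStrictDerivAt 0 θ).hasDerivAt
  refine ⟨_, _, s', hc.isAngularCurve he hζd (fun θ => (hbd θ).2) hPne (τ := -1) (by norm_num) hsd,
    fun θ => ?_, hPne, hsd, hs'c, fun θ => ?_, fun θ => ?_⟩
  · have : z (θ + 2 * Real.pi) = z θ := by
      simp only [hz]
      push_cast
      rw [add_mul, Complex.exp_add, Complex.exp_two_pi_mul_I, mul_one]
    simp only [hζ, this]
  · rw [hs'eq]; exact div_pos (hA θ).1 (hPpos θ)
  · rw [hs'eq, ← mul_div_assoc, div_lt_one (hPpos θ)]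
    calc b * -starDiff (g.inChart e) a (ζ θ) (ζ' θ) ≤ b * ((m + η) * δ ^ 2) :=
          mul_le_mul_of_nonneg_left (hA θ).2 hb.le
      _ = b * (m + η) * δ ^ 2 := by ring
      _ < (m ^ 2 - η) * δ ^ 2 := mul_lt_mul_of_pos_right hmη hδ2
      _ ≤ _ := hPb θ

/-- In a chart, the velocity of an angular curve in a level set is a multiple of the rotated
gradient. -/
theorem exists_hasDerivAt_level_curve {γ : ℝ → M} {s s' : ℝ → ℝ}
    (hγ : IsAngularCurve (angularAtlas g u) γ s) (hs : ∀ θ, HasDerivAt s (s' θ) θ) {v : ℝ}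
    (hv : ∀ θ, u (γ θ) = v) {e : OpenPartialHomeomorph M Plane} (he : e ∈ atlas Plane M) {θ₀ : ℝ}
    (h₀ : γ θ₀ ∈ e.source) : ∃ σ : ℝ, σ ^ 2 = 1 ∧ ∀ᶠ θ in 𝓝 θ₀, HasDerivAt (fun θ => e (γ θ))
      ((σ * s' θ) • conjGrad (g.inChart e) (u ∘ (e.extend 𝓘(ℝ, Plane)).symm) (e (γ θ))) θ := by
  obtain ⟨Ψ, hΨ, hmem, τ, hτ, hev⟩ := hγ.exists_eq θ₀
  have hmem' : ∀ θ, γ θ ∈ e.source → γ θ ∈ Ψ.source → e (γ θ) ∈ chartDom e Ψ.source := by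
    intro θ h1 h2
    refine ⟨by rw [extend_target_eq]; exact e.map_source h1, ?_⟩
    rw [mem_preimage, extend_symm_eq, e.left_inv h1]; exact h2
  obtain ⟨σ, hσ, hfd⟩ := hc.exists_hasFDerivAt_snd hΨ he (hmem' θ₀ h₀ hmem)
  have hecont : ContinuousAt (fun θ => e (γ θ)) θ₀ :=
    ContinuousAt.comp (f := γ) (e.continuousAt h₀) hγ.continuous.continuousAt
  have hσ0 : σ ≠ 0 := fun h => by rw [h] at hσ; norm_num at hσ
  refine ⟨σ * τ, by rw [mul_pow, hσ, hτ, one_mul], ?_⟩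
  filter_upwards [hev.eventually_nhds, hecont.eventually hfd,
    (hγ.continuous.continuousAt (x := θ₀)).eventually (e.open_source.mem_nhds h₀),
    (hγ.continuous.continuousAt (x := θ₀)).eventually (Ψ.open_source.mem_nhds hmem)]
    with θ h1 h2 h3 h4
  have hx := hmem' θ h3 h4
  have hxs : (e.extend 𝓘(ℝ, Plane)).symm (e (γ θ)) = γ θ := by
    rw [extend_symm_eq, e.left_inv h3]
  have hP : gradSq (g.inChart e) (u ∘ (e.extend 𝓘(ℝ, Plane)).symm) (e (γ θ)) ≠ 0 := by
    rw [hc.gradSq_inChart he hx.1, hxs]; exact (hΨ.2.2 _ h4).1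
  obtain ⟨L, hL⟩ := (hc.isMetricOn he).exists_coframe hx.1
    (fun X => hc.inChart_pos he hx.1) hP
  let L' : Plane ≃L[ℝ] ℝ × ℝ := L.trans ((ContinuousLinearEquiv.refl ℝ ℝ).prodCongr
    (ContinuousLinearEquiv.unitsEquivAut ℝ (Units.mk0 σ hσ0)))
  have hLa : ∀ X, L X = (fderiv ℝ (u ∘ (e.extend 𝓘(ℝ, Plane)).symm) (e (γ θ)) X,
      angularForm (g.inChart e) (u ∘ (e.extend 𝓘(ℝ, Plane)).symm) (e (γ θ)) X) := fun X =>
    congrArg (fun T : Plane →L[ℝ] ℝ × ℝ => T X) hL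
  let Φ := e.symm.trans Ψ
  have hΦs : e (γ θ) ∈ Φ.source := by
    rw [OpenPartialHomeomorph.trans_source]
    exact ⟨e.map_source h3, by rw [mem_preimage, e.left_inv h3]; exact h4⟩
  have hΦd : HasFDerivAt Φ (L' : Plane →L[ℝ] ℝ × ℝ) (e (γ θ)) := by
    have hd : HasFDerivAt (fun x => ((u ∘ (e.extend 𝓘(ℝ, Plane)).symm) x,
        ((fun y => (Ψ y).2) ∘ (e.extend 𝓘(ℝ, Plane)).symm) x))
        ((fderiv ℝ (u ∘ (e.extend 𝓘(ℝ, Plane)).symm) (e (γ θ))).prod (σ •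
          angularForm (g.inChart e) (u ∘ (e.extend 𝓘(ℝ, Plane)).symm) (e (γ θ)))) (e (γ θ)) :=
      ((hc.contDiffAt he hx.1).differentiableAt (by norm_num)).hasFDerivAt.prodMk h2
    refine (hd.congr_of_eventuallyEq ?_).congr_fderiv ?_
    · filter_upwards [Φ.open_source.mem_nhds hΦs] with x hx'
      rw [OpenPartialHomeomorph.trans_source] at hx'
      refine Prod.ext ?_ ?_
      · rw [extend_symm_eq]
        exact hΨ.1 _ hx'.2
      · rw [extend_symm_eq]; rfl
    · refine ContinuousLinearMap.ext fun X => ?_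
      have : L' X = ((L X).1, (L X).2 * σ) := rfl
      refine Eq.trans ?_ this.symm
      rw [hLa]
      refine Prod.ext rfl ?_
      exact mul_comm _ _
  have hΦv : Φ (e (γ θ)) = Ψ (γ θ) := congrArg Ψ (e.left_inv h3)
  have hsymm : HasFDerivAt Φ.symm (L'.symm : ℝ × ℝ →L[ℝ] Plane) (Ψ (γ θ)) := by
    rw [← hΦv]
    refine Φ.hasFDerivAt_symm (Φ.map_source hΦs) ?_
    rw [Φ.left_inv hΦs]; exact hΦd
  have hcurve : HasDerivAt (fun θ' => Ψ (γ θ')) ((0 : ℝ), τ * s' θ) θ := by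
    have h5 : HasDerivAt (fun θ' => (v, (Ψ (γ θ₀)).2 + τ * (s θ' - s θ₀))) ((0 : ℝ), τ * s' θ) θ :=
      (hasDerivAt_const θ v).prodMk ((((hs θ).sub_const _).const_mul τ).const_add _)
    refine h5.congr_of_eventuallyEq ?_
    filter_upwards [h1, hγ.continuous.continuousAt.eventually (Ψ.open_source.mem_nhds h4)]
      with θ' h6 h7
    refine Prod.ext ((hΨ.1 _ h7).trans (hv θ')) ?_
    show (Ψ (γ θ')).2 = (Ψ (γ θ₀)).2 + τ * (s θ' - s θ₀)
    linarith
  have hcomp := hsymm.comp_hasDerivAt θ hcurve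
  refine (hcomp.congr_of_eventuallyEq ?_).congr_deriv ?_
  · filter_upwards [hγ.continuous.continuousAt.eventually (Ψ.open_source.mem_nhds h4)] with θ' h7
    exact (congrArg e (Ψ.left_inv h7)).symm
  · refine (L'.symm_apply_eq).2 ?_
    rw [map_smul]
    have : L' (conjGrad (g.inChart e) (u ∘ (e.extend 𝓘(ℝ, Plane)).symm) (e (γ θ))) =
        ((0 : ℝ), σ) := by
      refine Eq.trans (b := ((L _).1, (L _).2 * σ)) rfl ?_
      rw [hLa, fderiv_conjGrad, angularForm_conjGrad (hc.gramDet_pos he hx.1) hP, one_mul]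
    rw [this]
    refine Prod.ext (by simp) ?_
    show τ * s' θ = σ * τ * s' θ * σ
    linear_combination (-τ * s' θ) * hσ

end IsConcircular

end

/-! ### Level curves near a minimum -/

noncomputable section

open Filter Topology

open LocalGeometry

variable {M : Type*} [TopologicalSpace M] [ChartedSpace Plane M]

namespace IsConcircular

variable [IsManifold 𝓘(ℝ, Plane) 4 M] {g : BilinField 𝓘(ℝ, Plane) M} {u : M → ℝ} {β : ℝ → ℝ}
  (hc : IsConcircular g u β)
include hc

/-- Around a critical point `q` at which the factor `β` is positive, the gradient does not vanish in
a punctured ball, and the rotated gradient turns around the centre at a rate between `0` and a given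
bound for the factor. -/
theorem exists_ball_conjGrad {q : M} {b : ℝ} (h0 : 0 < β (u q)) (hb : β (u q) < b)
    {e : OpenPartialHomeomorph M Plane} (he : e ∈ atlas Plane M) (hq : q ∈ e.source)
    (hcrit : fderiv ℝ (u ∘ (e.extend 𝓘(ℝ, Plane)).symm) (e q) = 0) :
    ∃ c : Plane ≃L[ℝ] ℂ, ∃ r > 0, Metric.closedBall (e q) r ⊆ e.target ∧
      ∀ x ∈ Metric.closedBall (e q) r, x ≠ e q → g.gradSq u (e.symm x) ≠ 0 ∧
        0 < (c (conjGrad (g.inChart e) (u ∘ (e.extend 𝓘(ℝ, Plane)).symm) x) / c (x - e q)).im ∧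
        (c (conjGrad (g.inChart e) (u ∘ (e.extend 𝓘(ℝ, Plane)).symm) x) / c (x - e q)).im < b := by
  have hx₀ : e q ∈ (e.extend 𝓘(ℝ, Plane)).target := by
    rw [extend_target_eq]; exact e.map_source hq
  have hG := hc.isMetricOn he
  have hpos : ∀ X, X ≠ 0 → 0 < g.inChart e (e q) X X := fun X => hc.inChart_pos he hx₀
  obtain ⟨c, hcn, hci⟩ := exists_complexCoord (hG.symm _ hx₀) hpos
  have hhess : ∀ X Y, hessian (g.inChart e) (u ∘ (e.extend 𝓘(ℝ, Plane)).symm) (e q) X Y =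
      β (u q) * g.inChart e (e q) X Y := by
    intro X Y
    have := hc.hessianEq e he _ hx₀ X Y
    rwa [extend_symm_eq, e.left_inv hq] at this
  have hC2 := (hc.contDiffAt he hx₀).of_le (m := 2) (by norm_num)
  set α := β (u q) with hα
  obtain ⟨η, hη, hη1⟩ := exists_between (lt_min (by linarith : 0 < α)
    (lt_min (by linarith : 0 < b - α) (by positivity : 0 < α ^ 2)))
  have hηα := hη1.trans_le (min_le_left _ _)
  have hηb := hη1.trans_le ((min_le_right _ _).trans (min_le_left _ _))
  have hηs := hη1.trans_le ((min_le_right _ _).trans (min_le_right _ _))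
  have hΩ : ∀ᶠ x in 𝓝 (e q), x ∈ e.target := e.open_target.mem_nhds (e.map_source hq)
  obtain ⟨r, hr, hball⟩ := Metric.nhds_basis_closedBall.eventually_iff.1
    (((hG.conjGrad_isLittleO hx₀ hpos hC2 hhess hcrit hcn hci hη).and
      (hG.starDiff_isLittleO hx₀ hpos hC2 hhess hcrit hcn hci hη)).and hΩ)
  refine ⟨c, r, hr, fun x hx => (hball hx).2, fun x hx hne => ?_⟩
  obtain ⟨⟨h1, -, h2⟩, h3⟩ := hball hx
  have hw : c (x - e q) ≠ 0 := by
    rw [Ne, c.map_eq_zero_iff, sub_eq_zero]; exact hne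
  generalize hwdef : c (x - e q) = w at h1 h2 hw ⊢
  have hw2 : 0 < ‖w‖ ^ 2 := by positivity
  generalize hXdef : c (conjGrad (g.inChart e) (u ∘ (e.extend 𝓘(ℝ, Plane)).symm) x) = X at h1 ⊢
  have hdiv : (X / w).im = (starRingEnd ℂ w * X).im / ‖w‖ ^ 2 := by
    rw [Complex.div_im, ← Complex.normSq_eq_norm_sq]
    simp
    ring
  have hx' : x ∈ (e.extend 𝓘(ℝ, Plane)).target := by rw [extend_target_eq]; exact h3
  refine ⟨?_, ?_, ?_⟩
  · have := hc.gradSq_inChart he hx'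
    rw [extend_symm_eq] at this
    rw [← this]
    have := abs_le.1 h2
    have : 0 < (α ^ 2 - η) * ‖w‖ ^ 2 := mul_pos (by linarith) hw2
    rw [extend_symm_eq] at *
    nlinarith
  · rw [hdiv]
    refine div_pos ?_ hw2
    have := abs_le.1 h1
    have : 0 < (α - η) * ‖w‖ ^ 2 := mul_pos (by linarith) hw2
    nlinarith
  · rw [hdiv, div_lt_iff₀ hw2]
    have := abs_le.1 h1
    have : 0 < (b - α - η) * ‖w‖ ^ 2 := mul_pos (by linarith) hw2
    nlinarith

omit hc in
theorem fderiv_chart_eq_zero_of_isMinOn {k : ℝ} (hk : ∀ y, k ≤ u y) {e : OpenPartialHomeomorph M Plane}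
    {x : Plane} (hx : (u ∘ (e.extend 𝓘(ℝ, Plane)).symm) x = k) :
    fderiv ℝ (u ∘ (e.extend 𝓘(ℝ, Plane)).symm) x = 0 := by
  refine IsLocalMin.fderiv_eq_zero (Eventually.of_forall fun y => ?_)
  rw [hx]
  exact hk _

omit hc in
theorem fderiv_chart_eq_zero_of_isMaxOn {k : ℝ} (hk : ∀ y, u y ≤ k) {e : OpenPartialHomeomorph M Plane}
    {x : Plane} (hx : (u ∘ (e.extend 𝓘(ℝ, Plane)).symm) x = k) :
    fderiv ℝ (u ∘ (e.extend 𝓘(ℝ, Plane)).symm) x = 0 := by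
  refine IsLocalMax.fderiv_eq_zero (Eventually.of_forall fun y => ?_)
  rw [hx]
  exact hk _

theorem gradSq_eq_zero {y : M} (h : fderiv ℝ (u ∘ ((chartAt Plane y).extend 𝓘(ℝ, Plane)).symm)
    ((chartAt Plane y).extend 𝓘(ℝ, Plane) y) = 0) : g.gradSq u y = 0 := by
  have := hc.gradSq_inChart (chart_mem_atlas Plane y)
    (chartAt_mem_chartDom (E := Plane) (mem_univ y)).1
  rw [extend_symm_chartAt] at this
  rw [← this, gradSq, h]
  rfl

theorem continuousAt_conjGrad {e : OpenPartialHomeomorph M Plane} (he : e ∈ atlas Plane M)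
    {x : Plane} (hx : x ∈ (e.extend 𝓘(ℝ, Plane)).target) :
    ContinuousAt (conjGrad (g.inChart e) (u ∘ (e.extend 𝓘(ℝ, Plane)).symm)) x := by
  have h1 := ((hc.isMetricOn he).hasFDerivAt_sqrt_gramDet hx (hc.gramDet_pos he hx)).continuousAt
  have h2 : ContinuousAt (fderiv ℝ (u ∘ (e.extend 𝓘(ℝ, Plane)).symm)) x :=
    ((hc.contDiffAt he hx).fderiv_right (m := 0) (by norm_num)).continuousAt
  exact (h1.inv₀ (Real.sqrt_pos.2 (hc.gramDet_pos he hx)).ne').smul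
    (((h2.clm_apply continuousAt_const).smul continuousAt_const).sub
      ((h2.clm_apply continuousAt_const).smul continuousAt_const))

/-- A level set close enough to a nondegenerate minimum contains no closed angular curve whose
angular velocity is less than `1 / b`, if the factor `β` at the minimum is less than `b`: such a curve
would turn around the minimum with an angular velocity between `0` and `1`. -/
theorem not_isAngularCurve_of_mem [T2Space M] {q : M} {b : ℝ} (h0 : 0 < β (u q)) (hb : β (u q) < b)
    (hmin : ∀ y, u q ≤ u y) : ∃ μ > u q, ∃ O ∈ 𝓝 q, ∀ v, u q < v → v < μ →
      ∀ (γ : ℝ → M) (s s' : ℝ → ℝ), IsAngularCurve (angularAtlas g u) γ s → (∀ θ, u (γ θ) = v) →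
      (∀ θ, γ (θ + 2 * Real.pi) = γ θ) → (∀ θ, HasDerivAt s (s' θ) θ) → Continuous s' →
      (∀ θ, 0 < s' θ) → (∀ θ, b * s' θ < 1) → γ 0 ∉ O := by
  have he := chart_mem_atlas Plane q
  have hq := mem_chart_source Plane q
  set e := chartAt Plane q with hedef
  have huq : (u ∘ (e.extend 𝓘(ℝ, Plane)).symm) (e q) = u q := by
    rw [extend_symm_eq, Function.comp_apply, e.left_inv hq]
  obtain ⟨c, r, hr, hrt, hrot⟩ := hc.exists_ball_conjGrad h0 hb he hq
    (fderiv_chart_eq_zero_of_isMinOn hmin huq)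
  have hucont : Continuous u := hc.contMDiff.continuous
  -- the minimum is strict, hence `u` is bounded below by some `μ > u q` on the sphere
  have hgt : ∀ x ∈ Metric.sphere (e q) r, u q < u (e.symm x) := by
    intro x hx
    refine lt_of_le_of_ne (hmin _) fun h => ?_
    refine (hrot x (Metric.sphere_subset_closedBall hx) (Metric.ne_of_mem_sphere hx hr.ne')).1 ?_
    exact hc.gradSq_eq_zero (fderiv_chart_eq_zero_of_isMinOn hmin
      ((congrArg u (extend_symm_chartAt _)).trans h.symm))
  obtain ⟨μ, hμ, hμs⟩ : ∃ μ > u q, ∀ x ∈ Metric.sphere (e q) r, μ ≤ u (e.symm x) :=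
    (isCompact_sphere (e q) r).exists_forall_le' (hucont.comp_continuousOn
      (e.continuousOn_symm.mono (Metric.sphere_subset_closedBall.trans hrt))) hgt
  have hOo : IsOpen (e.source ∩ e ⁻¹' Metric.ball (e q) r) :=
    e.isOpen_inter_preimage Metric.isOpen_ball
  refine ⟨μ, hμ, e.source ∩ e ⁻¹' Metric.ball (e q) r,
    hOo.mem_nhds ⟨hq, Metric.mem_ball_self hr⟩, fun v hv hvμ γ s s' hγ huv hper hs hs'c hs'0 hs'b
      hγ0 => ?_⟩
  have hcl : IsClosed (e.symm '' Metric.closedBall (e q) r) :=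
    ((isCompact_closedBall (e q) r).image_of_continuousOn (e.continuousOn_symm.mono hrt)).isClosed
  -- the level set misses the sphere, so `γ` cannot leave the disc in which it starts
  have hpre : γ ⁻¹' (e.source ∩ e ⁻¹' Metric.ball (e q) r) =
      γ ⁻¹' (e.symm '' Metric.closedBall (e q) r) := by
    ext θ
    constructor
    · rintro ⟨h1, h2⟩
      exact ⟨e (γ θ), Metric.ball_subset_closedBall h2, e.left_inv h1⟩
    · rintro ⟨x, hx, hxθ⟩
      have hxt := hrt hx
      refine ⟨hxθ ▸ e.map_target hxt, ?_⟩
      rw [mem_preimage, ← hxθ, e.right_inv hxt]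
      refine lt_of_le_of_ne (Metric.mem_closedBall.1 hx) fun h => ?_
      have := hμs x h
      rw [hxθ, huv] at this
      linarith
  have hclopen : IsClopen (γ ⁻¹' (e.source ∩ e ⁻¹' Metric.ball (e q) r)) :=
    ⟨by rw [hpre]; exact hcl.preimage hγ.continuous, hOo.preimage hγ.continuous⟩
  have hin : ∀ θ, γ θ ∈ e.source ∩ e ⁻¹' Metric.ball (e q) r := by
    have := hclopen.eq_univ ⟨0, hγ0⟩
    intro θ
    exact (this ▸ mem_univ θ : θ ∈ γ ⁻¹' _)
  have hne : ∀ θ, e (γ θ) ≠ e q := fun θ h => by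
    have := e.injOn (hin θ).1 hq h
    have h2 := huv θ
    rw [this] at h2
    linarith
  choose σ hσ hder using fun θ => hc.exists_hasDerivAt_level_curve hγ hs huv he (hin θ).1
  set X : ℝ → Plane := fun θ =>
    conjGrad (g.inChart e) (u ∘ (e.extend 𝓘(ℝ, Plane)).symm) (e (γ θ)) with hX
  set w : ℝ → ℂ := fun θ => c (e (γ θ) - e q) with hw
  set w' : ℝ → ℂ := fun θ => c ((σ θ * s' θ) • X θ) with hw'
  have hwd : ∀ τ θ : ℝ, HasDerivAt (fun θ => e (γ θ)) (τ • X θ) θ → HasDerivAt w (c (τ • X θ)) θ :=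
    fun τ θ h => (c : Plane →L[ℝ] ℂ).hasFDerivAt.comp_hasDerivAt θ (h.sub_const (e q))
  have hwder : ∀ θ, HasDerivAt w (w' θ) θ := fun θ => hwd _ _ (hder θ).self_of_nhds
  have hecont : Continuous fun θ => e (γ θ) := continuous_iff_continuousAt.2 fun θ =>
    ContinuousAt.comp (f := γ) (e.continuousAt (hin θ).1) hγ.continuous.continuousAt
  have hX' : ∀ θ, ContinuousAt X θ := by
    intro θ
    have hx : e (γ θ) ∈ (e.extend 𝓘(ℝ, Plane)).target := by
      rw [extend_target_eq]; exact e.map_source (hin θ).1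
    exact ContinuousAt.comp (f := fun θ => e (γ θ)) (hc.continuousAt_conjGrad he hx)
      hecont.continuousAt
  have hw'c : Continuous w' := by
    refine continuous_iff_continuousAt.2 fun θ => ?_
    have h1 : ContinuousAt (fun t => c ((σ θ * s' t) • X t)) θ :=
      c.continuous.continuousAt.comp ((continuousAt_const.mul hs'c.continuousAt).smul (hX' θ))
    refine h1.congr ?_
    filter_upwards [hder θ] with t ht
    exact (hwd _ _ ht).unique (hwder t)
  obtain ⟨θ, k, hk⟩ := exists_im_deriv_div_eq_intCast hwder hw'c
    (fun θ => by rw [hw, Ne, c.map_eq_zero_iff, sub_eq_zero]; exact hne θ)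
    (by
      have := hper 0
      rw [zero_add] at this
      simp only [hw, this])
  obtain ⟨-, h1, h2⟩ := hrot _ (Metric.ball_subset_closedBall (hin θ).2) (hne θ)
  have hval : (w' θ / w θ).im = σ θ * (s' θ * (c (X θ) / w θ).im) := by
    simp only [hw', map_smul]
    rw [smul_div_assoc, Complex.smul_im, smul_eq_mul, mul_assoc]
  rw [hval] at hk
  have h3 : 0 < s' θ * (c (X θ) / w θ).im := mul_pos (hs'0 θ) h1
  have h4 : s' θ * (c (X θ) / w θ).im < 1 := by
    have := mul_lt_mul_of_pos_left h2 (hs'0 θ)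
    have := hs'b θ
    linarith
  -- the square of the integer `k` lies strictly between `0` and `1`
  have hksq : (k : ℝ) ^ 2 = (s' θ * (c (X θ) / w θ).im) ^ 2 := by
    rw [← hk, mul_pow, hσ, one_mul]
  have hk1 : (k : ℝ) ^ 2 < 1 := by rw [hksq]; exact pow_lt_one₀ h3.le h4 two_ne_zero
  have hk0 : 0 < (k : ℝ) ^ 2 := by rw [hksq]; positivity
  norm_cast at hk1 hk0
  omega

/-- On a closed surface the factor `β` cannot be smaller, in absolute value, at the minimum of the
function than at its maximum. -/
theorem false_of_lt [T2Space M] [CompactSpace M] {p q : M} (hmin : ∀ y, u q ≤ u y)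
    (hmax : ∀ y, u y ≤ u p) (h0 : 0 < β (u q)) (hlt : β (u q) < -β (u p))
    (hP : ∀ y, u q < u y → u y < u p → g.gradSq u y ≠ 0) : False := by
  obtain ⟨b, hb, hbm⟩ := exists_between hlt
  have hucont : Continuous u := hc.contMDiff.continuous
  obtain ⟨γ, s, s', hγ, hper, hγP, hs, hs'c, hs'0, hs'b⟩ := hc.exists_angular_circle (p := p)
    (m := -β (u p)) (b := b) (by ring) (h0.trans hb) hbm
    (fderiv_chart_eq_zero_of_isMaxOn hmax (congrArg u (extend_symm_chartAt p)))
  have hcomp : IsCompact (range γ) := Function.Periodic.compact_of_continuous hper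
    Real.two_pi_pos.ne' hγ.continuous
  have hgt : ∀ y ∈ range γ, u q < u y := by
    rintro _ ⟨θ, rfl⟩
    refine lt_of_le_of_ne (hmin _) fun h => hγP θ (hc.gradSq_eq_zero ?_)
    exact fderiv_chart_eq_zero_of_isMinOn hmin
      ((congrArg u (extend_symm_chartAt _)).trans h.symm)
  have hlt' : ∀ y ∈ range γ, u y < u p := by
    rintro _ ⟨θ, rfl⟩
    refine lt_of_le_of_ne (hmax _) fun h => hγP θ (hc.gradSq_eq_zero ?_)
    exact fderiv_chart_eq_zero_of_isMaxOn hmax ((congrArg u (extend_symm_chartAt _)).trans h)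
  obtain ⟨c₁, hc₁, h1⟩ := hcomp.exists_forall_le' hucont.continuousOn hgt
  obtain ⟨y₂, hy₂, h2'⟩ := hcomp.exists_isMaxOn (range_nonempty γ) hucont.continuousOn
  obtain ⟨c₂, hc₂, h2⟩ : ∃ c₂ < u p, ∀ y ∈ range γ, u y ≤ c₂ := ⟨u y₂, hlt' _ hy₂, h2'⟩
  have hlevel : ∀ v, u q < v → v ≤ c₁ → ∃ γ' : ℝ → M, IsAngularCurve (angularAtlas g u) γ' s ∧
      (∀ θ, u (γ' θ) = v) ∧ ∀ θ, γ' (θ + 2 * Real.pi) = γ' θ := by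
    intro v hv hvc
    refine hc.isHalfTranslationAtlas.exists_level_curve (c₁ := v) (c₂ := c₂)
      (isClosed_Icc.preimage hucont).isCompact
      (fun x hx => hc.exists_mem_angularAtlas (hP x (hv.trans_le hx.1) (hx.2.trans_lt hc₂)))
      hucont hγ (fun θ => ⟨hvc.trans (h1 _ ⟨θ, rfl⟩), h2 _ ⟨θ, rfl⟩⟩) hper
      ⟨le_rfl, (hvc.trans (h1 _ ⟨0, rfl⟩)).trans (h2 _ ⟨0, rfl⟩)⟩
  -- points on level curves approaching the minimum accumulate at a minimum point `q'`
  set v : ℕ → ℝ := fun j => u q + (c₁ - u q) / (j + 1) with hv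
  have hc₁' : 0 < c₁ - u q := sub_pos.2 hc₁
  have hvpos : ∀ j, u q < v j := fun j => by
    have : 0 < (c₁ - u q) / (j + 1) := by positivity
    simp only [hv]; linarith
  have hvle : ∀ j, v j ≤ c₁ := fun j => by
    have : (c₁ - u q) / (j + 1) ≤ c₁ - u q :=
      div_le_self hc₁'.le (by have := j.cast_nonneg (α := ℝ); linarith)
    simp only [hv]; linarith
  have hvlim : Tendsto v atTop (𝓝 (u q)) := by
    have := (tendsto_one_div_add_atTop_nhds_zero_nat.const_mul (c₁ - u q)).const_add (u q)
    simpa [hv, div_eq_mul_inv] using this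
  choose Γ hΓ hΓv hΓp using fun j => hlevel (v j) (hvpos j) (hvle j)
  obtain ⟨q', hq'⟩ := exists_clusterPt_of_compactSpace (map (fun j => Γ j 0) atTop)
  have huq' : u q' = u q := by
    have h3 : MapClusterPt (u q') atTop fun j => u (Γ j 0) :=
      MapClusterPt.continuousAt_comp hucont.continuousAt hq'
    have h4 : Tendsto (fun j => u (Γ j 0)) atTop (𝓝 (u q)) := by
      simpa only [hΓv] using hvlim
    exact eq_of_nhds_neBot (ClusterPt.mono h3 h4)
  obtain ⟨μ, hμ, O, hO, hfinal⟩ := hc.not_isAngularCurve_of_mem (q := q') (b := b)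
    (by rwa [huq']) (by rwa [huq']) (by rwa [huq'])
  rw [huq'] at hμ hfinal
  have hfreq : ∃ᶠ j in atTop, Γ j 0 ∈ O := hq'.frequently hO
  obtain ⟨j, hj, hjμ⟩ := (hfreq.and_eventually (hvlim.eventually (gt_mem_nhds hμ))).exists
  exact hfinal (v j) (hvpos j) hjμ (Γ j) s s' (hΓ j) (hΓv j) (hΓp j) hs hs'c hs'0 hs'b hj

end IsConcircular

end

/-! ### Definiteness and degenerate critical points -/

noncomputable section

open Filter Topology

namespace LocalGeometry

theorem gramDet_ne_zero {B : Plane →L[ℝ] Plane →L[ℝ] ℝ}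
    (hB : ∀ X, (∀ Y, B X Y = 0) → X = 0) : gramDet B ≠ 0 := by
  intro h
  rw [gramDet] at h
  have hX : B (vec 1) (vec 1) • vec 0 - B (vec 0) (vec 1) • vec 1 = 0 := hB _ fun Y => by
    rw [map_eq_coord (B _) Y]
    simp
    linear_combination Y 0 * h
  have hY : B (vec 1) (vec 0) • vec 0 - B (vec 0) (vec 0) • vec 1 = 0 := hB _ fun Y => by
    rw [map_eq_coord (B _) Y]
    simp
    linear_combination (-Y 1) * h
  have h01 := congrArg (fun v : Plane => v 1) hX
  have h00 := congrArg (fun v : Plane => v 1) hY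
  simp [vec] at h01 h00
  have h3 := hB (vec 0) fun Y => by
    rw [map_eq_coord (B _) Y, h01, h00]; simp
  have := congrArg (fun v : Plane => v 0) h3
  simp [vec] at this

theorem pos_iff {B : Plane →L[ℝ] Plane →L[ℝ] ℝ} (hB : ∀ X Y, B X Y = B Y X) :
    (∀ X, X ≠ 0 → 0 < B X X) ↔ 0 < gramDet B ∧ 0 < B (vec 0) (vec 0) := by
  have hv : vec 0 ≠ 0 := fun h => by
    have := congrArg (fun v : Plane => v 0) h
    simp [vec] at this
  refine ⟨fun h => ⟨gramDet_pos hB h, h _ hv⟩, fun ⟨h1, h2⟩ X hX => ?_⟩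
  have h3 := gramDet_mul_areaForm_sq hB (vec 0) X
  refine pos_of_mul_pos_right (a := B (vec 0) (vec 0)) ?_ h2.le
  have h4 : B (vec 0) (vec 0) * B X X =
      gramDet B * areaForm (vec 0) X ^ 2 + B (vec 0) X ^ 2 := by linarith
  rw [h4]
  have h5 : areaForm (vec 0) X = X 1 := by rw [areaForm_apply]; simp [vec]
  rw [h5]
  by_cases hX1 : X 1 = 0
  · have h6 : B (vec 0) X = X 0 * B (vec 0) (vec 0) := by
      rw [map_eq_coord (B (vec 0)) X, hX1]; simp
    have h7 : X 0 ≠ 0 := fun h => hX (eq_zero_of_coord h hX1)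
    rw [h6]
    positivity
  · positivity

theorem pos_of_nonneg {E : Type*} [NormedAddCommGroup E] [NormedSpace ℝ E]
    {B : E →L[ℝ] E →L[ℝ] ℝ} (hB : ∀ X Y, B X Y = B Y X)
    (hnd : ∀ X, (∀ Y, B X Y = 0) → X = 0) (h : ∀ X, 0 ≤ B X X) {X : E} (hX : X ≠ 0) :
    0 < B X X := by
  refine lt_of_le_of_ne (h X) fun h0 => hX (hnd X fun Y => ?_)
  by_contra hXY
  have := h (Y + (-(B Y Y + 1) / (2 * B X Y)) • X)
  simp [hB Y X, ← h0] at this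
  field_simp at this
  linarith

/-- The Levi-Civita connection does not change when the metric changes sign. -/
theorem IsMetricOn.hessian_neg {E : Type*} [NormedAddCommGroup E] [NormedSpace ℝ E]
    [FiniteDimensional ℝ E] {G : E → E →L[ℝ] E →L[ℝ] ℝ} {Ω : Set E} (hG : IsMetricOn G Ω)
    (hG' : IsMetricOn (fun x => (-1 : ℝ) • G x) Ω) {x : E} (hx : x ∈ Ω) (a : E → ℝ) (X Y : E) :
    hessian (fun x => (-1 : ℝ) • G x) (fun x => -a x) x X Y = -hessian G a x X Y := by
  have hchr : christoffel (fun x => (-1 : ℝ) • G x) x X Y = christoffel G x X Y := by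
    refine hG'.christoffel_eq hx fun Z => ?_
    have hf : fderiv ℝ (fun x => (-1 : ℝ) • G x) x = (-1 : ℝ) • fderiv ℝ G x :=
      ((hG.differentiableAt hx).hasFDerivAt.const_smul (-1 : ℝ)).fderiv
    rw [christoffelFirst_apply, hf, smul_apply, smul_apply, hG.apply_christoffel hx,
      christoffelFirst_apply]
    simp
    ring
  have h1 : fderiv ℝ (fun x => -a x) = fun x => -fderiv ℝ a x := funext fun x => fderiv_fun_neg
  rw [hessian_apply, hessian_apply, hchr, h1, fderiv_fun_neg]
  simp
  ring

end LocalGeometry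

open LocalGeometry

variable {M : Type*} [TopologicalSpace M] [ChartedSpace Plane M] [IsManifold 𝓘(ℝ, Plane) 4 M]
  {g : BilinField 𝓘(ℝ, Plane) M} {u : M → ℝ}

theorem BilinField.inChart_pos_iff {e : OpenPartialHomeomorph M Plane} (he : e ∈ atlas Plane M)
    {x : Plane} (hx : x ∈ (e.extend 𝓘(ℝ, Plane)).target) {y : M}
    (hy : (e.extend 𝓘(ℝ, Plane)).symm x = y) :
    (∀ X, X ≠ 0 → 0 < g.inChart e x X X) ↔
      ∀ X : TangentSpace 𝓘(ℝ, Plane) y, X ≠ 0 → 0 < g y X X := by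
  subst hy
  have hinv := isInvertible_mfderiv_extend_symm he hx
  constructor
  · intro h X hX
    obtain ⟨Y, hY⟩ := hinv.surjective X
    have := (h Y (fun h0 => hX (by rw [← hY, h0]; exact map_zero _))).trans_eq
      (BilinField.inChart_apply g e x Y Y)
    rw [← hY]
    exact this
  · intro h X hX
    rw [BilinField.inChart_apply]
    exact h _ fun h0 => hX (hinv.injective (h0.trans (map_zero _).symm))

/-- A metric on a connected surface which is positive definite at one point is positive definite. -/
theorem BilinField.IsPseudoRiemannian.pos_of_pos [ConnectedSpace M] (hg : g.IsPseudoRiemannian 3)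
    {p : M} (hp : ∀ X : TangentSpace 𝓘(ℝ, Plane) p, X ≠ 0 → 0 < g p X X) (y : M)
    (X : TangentSpace 𝓘(ℝ, Plane) y) (hX : X ≠ 0) : 0 < g y X X := by
  set S : Set M := {y | ∀ X : TangentSpace 𝓘(ℝ, Plane) y, X ≠ 0 → 0 < g y X X} with hS
  -- definiteness is decided by the signs of two continuous functions, the first without zeros
  have key : ∀ y : M, (y ∈ S → ∀ᶠ z in 𝓝 y, z ∈ S) ∧ (y ∉ S → ∀ᶠ z in 𝓝 y, z ∉ S) := by
    intro y
    have he := chart_mem_atlas Plane y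
    have hy := mem_chart_source Plane y
    set e := chartAt Plane y with hedef
    have hG : IsMetricOn (g.inChart e) (e.extend 𝓘(ℝ, Plane)).target := by
      rw [← chartDom_univ]; exact hg.isMetricOn he isOpen_univ
    have htgt : ∀ z ∈ e.source, e z ∈ (e.extend 𝓘(ℝ, Plane)).target := fun z hz => by
      rw [extend_target_eq]; exact e.map_source hz
    have hiff : ∀ z ∈ e.source, (z ∈ S ↔
        0 < gramDet (g.inChart e (e z)) ∧ 0 < g.inChart e (e z) (vec 0) (vec 0)) := by
      intro z hz
      rw [← pos_iff (hG.symm _ (htgt z hz))]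
      refine (BilinField.inChart_pos_iff he (htgt z hz) ?_).symm
      rw [extend_symm_eq, e.left_inv hz]
    have hsrc : ∀ᶠ z in 𝓝 y, z ∈ e.source := e.open_source.mem_nhds hy
    have hc1 : ContinuousAt (fun z => gramDet (g.inChart e (e z))) y :=
      ContinuousAt.comp (f := e) (g := fun x => gramDet (g.inChart e x))
        (hG.hasFDerivAt_gramDet (htgt y hy)).continuousAt (e.continuousAt hy)
    have hc2 : ContinuousAt (fun z => g.inChart e (e z) (vec 0) (vec 0)) y :=
      ContinuousAt.comp (f := e) (g := fun x => g.inChart e x (vec 0) (vec 0))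
        (hG.hasFDerivAt_apply (htgt y hy) (vec 0) (vec 0)).continuousAt (e.continuousAt hy)
    refine ⟨fun hyS => ?_, fun hyS => ?_⟩
    · obtain ⟨h1, h2⟩ := (hiff y hy).1 hyS
      filter_upwards [hsrc, hc1.eventually (lt_mem_nhds h1), hc2.eventually (lt_mem_nhds h2)]
        with z h3 h4 h5
      exact (hiff z h3).2 ⟨h4, h5⟩
    · rw [hiff y hy, not_and_or] at hyS
      have hne := gramDet_ne_zero (hG.nondegenerate _ (htgt y hy))
      rcases lt_or_gt_of_ne hne with h1 | h1
      · filter_upwards [hsrc, hc1.eventually (gt_mem_nhds h1)] with z h3 h4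
        exact fun h => ((hiff z h3).1 h).1.not_gt h4
      · have h2 : g.inChart e (e y) (vec 0) (vec 0) < 0 := by
          refine lt_of_le_of_ne (not_lt.1 (hyS.resolve_left (not_not.2 h1))) fun h => ?_
          rw [gramDet, h, hG.symm _ (htgt y hy) (vec 1) (vec 0)] at h1
          nlinarith [sq_nonneg (g.inChart e (e y) (vec 0) (vec 1))]
        filter_upwards [hsrc, hc2.eventually (gt_mem_nhds h2)] with z h3 h4
        exact fun h => ((hiff z h3).1 h).2.not_gt h4
  have hclopen : IsClopen S :=
    ⟨⟨isOpen_iff_mem_nhds.2 fun y hy => (key y).2 hy⟩,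
      isOpen_iff_mem_nhds.2 fun y hy => (key y).1 hy⟩
  exact (hclopen.eq_univ ⟨p, hp⟩ ▸ mem_univ y : y ∈ S) X hX

/-- If the Hessian of `u` is `(C - u² / 2) g`, and vanishes at a critical point, then `u` is
constant. -/
theorem BilinField.HessianEq.eq_of_critical [ConnectedSpace M] (hg : g.IsPseudoRiemannian 3)
    (hu : ContMDiff 𝓘(ℝ, Plane) 𝓘(ℝ, ℝ) 4 u) {C : ℝ} (h : g.HessianEq u fun y => C - u y ^ 2 / 2)
    {p : M} (hp : fderiv ℝ (u ∘ ((chartAt Plane p).extend 𝓘(ℝ, Plane)).symm) (chartAt Plane p p) = 0)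
    (hC : C = u p ^ 2 / 2) (y : M) : u y = u p := by
  set k := u p with hk
  have hucont : Continuous u := hu.continuous
  have hat : ∀ {e : OpenPartialHomeomorph M Plane}, e ∈ atlas Plane M → ∀ y ∈ e.source,
      ContDiffAt ℝ 4 (u ∘ (e.extend 𝓘(ℝ, Plane)).symm) (e y) := fun {e} he y hy => by
    have h1 := (hu.contMDiffOn (s := univ)).contDiffOn_chart le_rfl he
    rw [chartDom_univ] at h1
    refine h1.contDiffAt ((isOpen_extend_target e).mem_nhds ?_)
    rw [extend_target_eq]; exact e.map_source hy
  have hval : ∀ (e : OpenPartialHomeomorph M Plane), ∀ y ∈ e.source,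
      (u ∘ (e.extend 𝓘(ℝ, Plane)).symm) (e y) = u y := fun e y hy => by
    rw [extend_symm_eq, Function.comp_apply, e.left_inv hy]
  have hloc : ∀ y, u y = k →
      fderiv ℝ (u ∘ ((chartAt Plane y).extend 𝓘(ℝ, Plane)).symm) (chartAt Plane y y) = 0 →
      ∀ᶠ z in 𝓝 y, u z = k := by
    intro y huy hdy
    have he := chart_mem_atlas Plane y
    have hy := mem_chart_source Plane y
    set e := chartAt Plane y with hedef
    have hG : IsMetricOn (g.inChart e) (e.extend 𝓘(ℝ, Plane)).target := by
      rw [← chartDom_univ]; exact hg.isMetricOn he isOpen_univ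
    have hx : e y ∈ (e.extend 𝓘(ℝ, Plane)).target := by
      rw [extend_target_eq]; exact e.map_source hy
    have hev := hG.eventually_eq_of_critical hx ((hat he y hy).of_le (by norm_num))
      (σ := fun x => C - u ((e.extend 𝓘(ℝ, Plane)).symm x) ^ 2 / 2) (L := (|2 * k| + 1) / 2) (k := k)
      (fun x hx => h e he x hx) ?_ hdy ((hval e y hy).trans huy)
    · filter_upwards [(e.continuousAt hy).eventually hev, e.open_source.mem_nhds hy] with z h1 h2
      rwa [hval e z h2] at h1
    · have hc : ContinuousAt (fun x => |(u ∘ (e.extend 𝓘(ℝ, Plane)).symm) x + k|) (e y) :=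
        ((hat he y hy).continuousAt.add continuousAt_const).abs
      have hlt : |(u ∘ (e.extend 𝓘(ℝ, Plane)).symm) (e y) + k| < |2 * k| + 1 := by
        rw [hval e y hy, huy, ← two_mul]; linarith
      filter_upwards [hc.eventually (gt_mem_nhds hlt)] with x hx
      have e1 : C - u ((e.extend 𝓘(ℝ, Plane)).symm x) ^ 2 / 2 =
          -(((u ∘ (e.extend 𝓘(ℝ, Plane)).symm) x + k) *
            ((u ∘ (e.extend 𝓘(ℝ, Plane)).symm) x - k)) / 2 := by
        rw [hC, Function.comp_apply]; ring
      rw [e1, abs_div, abs_neg, abs_mul, abs_two]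
      have := mul_le_mul_of_nonneg_right hx.le
        (abs_nonneg ((u ∘ (e.extend 𝓘(ℝ, Plane)).symm) x - k))
      linarith
  have hclopen : IsClopen {y | ∀ᶠ z in 𝓝 y, u z = k} := by
    refine ⟨isClosed_of_closure_subset fun y hy => ?_, isOpen_iff_mem_nhds.2 fun y hy =>
      eventually_eventually_nhds.2 hy⟩
    have hfreq := mem_closure_iff_frequently.1 hy
    refine hloc y ?_ ?_
    · have hcl : IsClosed {y | u y = k} := isClosed_eq hucont continuous_const
      exact hcl.closure_subset_iff.2 (fun z hz => hz.self_of_nhds) hy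
    · by_contra hne
      have he := chart_mem_atlas Plane y
      have hy := mem_chart_source Plane y
      set e := chartAt Plane y with hedef
      have hc : ContinuousAt (fun z => fderiv ℝ (u ∘ (e.extend 𝓘(ℝ, Plane)).symm) (e z)) y :=
        ContinuousAt.comp (f := e)
          (((hat he y hy).fderiv_right (m := 0) (by norm_num)).continuousAt) (e.continuousAt hy)
      obtain ⟨z, hz, hz1, hz2⟩ := (hfreq.and_eventually
        ((hc.eventually_ne hne).and (e.open_source.mem_nhds hy))).exists
      refine hz1 ?_
      have hzc : (u ∘ (e.extend 𝓘(ℝ, Plane)).symm) =ᶠ[𝓝 (e z)] fun _ => k := by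
        rw [extend_symm_eq]
        have h1 := e.continuousAt_symm (e.map_source hz2)
        rw [ContinuousAt, e.left_inv hz2] at h1
        exact h1.eventually hz
      rw [hzc.fderiv_eq, fderiv_fun_const]
      rfl
  exact ((hclopen.eq_univ ⟨p, hloc p rfl hp⟩ ▸ mem_univ y : y ∈ {y | ∀ᶠ z in 𝓝 y, u z = k})).self_of_nhds

end

/-! ### Solutions of `∇²u = (C - u² / 2) g` on closed surfaces -/

noncomputable section

open Filter Topology

open LocalGeometry

variable {M : Type*} [TopologicalSpace M] [ChartedSpace Plane M] [IsManifold 𝓘(ℝ, Plane) 4 M]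
  {g : BilinField 𝓘(ℝ, Plane) M} {u : M → ℝ}

/-- The Hessian at a maximum is negative semidefinite. -/
theorem BilinField.HessianEq.mul_nonpos_of_isMax {α : M → ℝ} (hu : ContMDiff 𝓘(ℝ, Plane) 𝓘(ℝ, ℝ) 4 u)
    (h : g.HessianEq u α) {p : M} (hp : ∀ y, u y ≤ u p) (X : Plane) :
    α p * g.inChart (chartAt Plane p) (chartAt Plane p p) X X ≤ 0 := by
  have he := chart_mem_atlas Plane p
  have hpe := mem_chart_source Plane p
  set e := chartAt Plane p with hedef
  have hx : e p ∈ (e.extend 𝓘(ℝ, Plane)).target := by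
    rw [extend_target_eq]; exact e.map_source hpe
  have hval : (u ∘ (e.extend 𝓘(ℝ, Plane)).symm) (e p) = u p := by
    rw [extend_symm_eq, Function.comp_apply, e.left_inv hpe]
  have hmax : IsLocalMax (u ∘ (e.extend 𝓘(ℝ, Plane)).symm) (e p) :=
    Eventually.of_forall fun x => by rw [hval]; exact hp _
  have hC : ContDiffAt ℝ 2 (u ∘ (e.extend 𝓘(ℝ, Plane)).symm) (e p) := by
    have h1 := (hu.contMDiffOn (s := univ)).contDiffOn_chart le_rfl he
    rw [chartDom_univ] at h1
    exact (h1.contDiffAt ((isOpen_extend_target e).mem_nhds hx)).of_le (by norm_num)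
  have h1 := h e he (e p) hx X X
  rw [hessian_apply, hmax.fderiv_eq_zero, zero_apply, sub_zero, extend_symm_eq,
    e.left_inv hpe, ← extend_symm_eq] at h1
  rw [← h1]
  exact hmax.fderiv_fderiv_nonpos hC X

theorem BilinField.HessianEq.neg (hg : g.IsPseudoRiemannian 3) {α : M → ℝ}
    (h : g.HessianEq u α) : (g.scale fun _ => -1).HessianEq (fun y => -u y) α := by
  intro e he x hx X Y
  have hg' : (g.scale fun _ => -1).IsPseudoRiemannian 3 := hg.scale contMDiff_const (by norm_num)
  have hfun : (g.scale fun _ => -1).inChart e = fun x => (-1 : ℝ) • g.inChart e x :=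
    funext fun x => BilinField.inChart_scale _ e x
  have hG := hg.isMetricOn he isOpen_univ
  have hG' := hg'.isMetricOn he isOpen_univ
  rw [hfun] at hG' ⊢
  have := hG.hessian_neg hG' (x := x) (by rwa [chartDom_univ]) (u ∘ (e.extend 𝓘(ℝ, Plane)).symm) X Y
  refine this.trans ?_
  rw [h e he x hx X Y, smul_apply, smul_apply, smul_eq_mul]
  ring

/-- A function on a closed surface with a positive definite metric, whose Hessian is `(C - u² / 2) g`,
is constant. -/
theorem IsConcircular.eq_of_compact [T2Space M] [CompactSpace M] [ConnectedSpace M] {C : ℝ}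
    (hc : IsConcircular g u fun t => C - t ^ 2 / 2) (y y' : M) : u y = u y' := by
  have hucont : Continuous u := hc.contMDiff.continuous
  obtain ⟨p, -, hp⟩ := isCompact_univ.exists_isMaxOn univ_nonempty hucont.continuousOn
  obtain ⟨q, -, hq⟩ := isCompact_univ.exists_isMinOn univ_nonempty hucont.continuousOn
  have hmax : ∀ y, u y ≤ u p := fun y => hp (mem_univ y)
  have hmin : ∀ y, u q ≤ u y := fun y => hq (mem_univ y)
  by_contra hne
  have hcp : C ≠ u p ^ 2 / 2 := fun h => hne <| by
    have := hc.hessianEq.eq_of_critical hc.isPseudoRiemannian hc.contMDiff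
      (IsConcircular.fderiv_chart_eq_zero_of_isMaxOn hmax (congrArg u (extend_symm_chartAt p))) h
    rw [this y, this y']
  have hcq : C ≠ u q ^ 2 / 2 := fun h => hne <| by
    have := hc.hessianEq.eq_of_critical hc.isPseudoRiemannian hc.contMDiff
      (IsConcircular.fderiv_chart_eq_zero_of_isMinOn hmin (congrArg u (extend_symm_chartAt q))) h
    rw [this y, this y']
  have hlt : u q < u p := by
    refine lt_of_le_of_ne (hmin p) fun h => hne ?_
    linarith [hmax y, hmax y', hmin y, hmin y']
  -- the squared length of the gradient is a cubic polynomial in `u`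
  obtain ⟨D, hD⟩ : ∃ D, ∀ y, g.gradSq u y = -u y ^ 3 / 3 + 2 * C * u y + D := by
    obtain ⟨y₀⟩ := (inferInstance : Nonempty M)
    have hconst : ∀ y, g.gradSq u y - (-u y ^ 3 / 3 + 2 * C * u y) =
        g.gradSq u y₀ - (-u y₀ ^ 3 / 3 + 2 * C * u y₀) := by
      intro y
      refine eq_of_hasFDerivAt_chart_zero (E := Plane)
        (φ := fun y => g.gradSq u y - (-u y ^ 3 / 3 + 2 * C * u y)) isOpen_univ isPreconnected_univ
        (fun e he x hx => ?_) (mem_univ y) (mem_univ y₀)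
      rw [chartDom_univ] at hx
      have h1 := hc.hessianEq.hasFDerivAt_gradSq hc.isPseudoRiemannian hc.contMDiff he hx
      have h2 := ((hc.contDiffAt he hx).differentiableAt (by norm_num)).hasFDerivAt
      refine (h1.sub (((h2.pow 3).neg.mul_const (1 / 3 : ℝ)).add
        (h2.const_mul (2 * C)))).congr_fderiv ?_ |>.congr_of_eventuallyEq ?_
      · ext X
        simp
        ring
      · refine Eventually.of_forall fun x => ?_
        simp [div_eq_mul_inv]
    exact ⟨g.gradSq u y₀ - (-u y₀ ^ 3 / 3 + 2 * C * u y₀), fun y => by linarith [hconst y]⟩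
  have hPp : g.gradSq u p = 0 := hc.gradSq_eq_zero
    (IsConcircular.fderiv_chart_eq_zero_of_isMaxOn hmax (congrArg u (extend_symm_chartAt p)))
  have hPq : g.gradSq u q = 0 := hc.gradSq_eq_zero
    (IsConcircular.fderiv_chart_eq_zero_of_isMinOn hmin (congrArg u (extend_symm_chartAt q)))
  -- the signs of the Hessian at the extrema
  have hsign : C - u p ^ 2 / 2 < 0 ∧ 0 < C - u q ^ 2 / 2 := by
    have hpos : ∀ z, 0 < g.inChart (chartAt Plane z) (chartAt Plane z z) (vec 0) (vec 0) :=
      fun z => hc.inChart_pos (chart_mem_atlas Plane z)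
        (by rw [extend_target_eq]; exact (chartAt Plane z).map_source (mem_chart_source Plane z))
        (by simp)
    constructor
    · have h1 := hc.hessianEq.mul_nonpos_of_isMax hc.contMDiff hmax (vec 0)
      exact lt_of_le_of_ne (nonpos_of_mul_nonpos_left h1 (hpos p)) (sub_ne_zero.2 hcp)
    · have h1 := (hc.hessianEq.neg hc.isPseudoRiemannian).mul_nonpos_of_isMax
        (contDiff_neg.contMDiff.comp hc.contMDiff) (fun z => neg_le_neg (hmin z)) (vec 0)
      rw [BilinField.inChart_scale, smul_apply, smul_apply, smul_eq_mul] at h1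
      have h2 : 0 ≤ (C - u q ^ 2 / 2) *
          g.inChart (chartAt Plane q) (chartAt Plane q q) (vec 0) (vec 0) := by linarith
      exact lt_of_le_of_ne (nonneg_of_mul_nonneg_left h2 (hpos q)) (sub_ne_zero.2 hcq).symm
  rw [hD] at hPp hPq
  -- the two roots `u p`, `u q` of the cubic determine `C`
  have hd : 0 < u p - u q := sub_pos.2 hlt
  have hC : C = (u q ^ 2 + u q * u p + u p ^ 2) / 6 := by
    have : (u p - u q) * (C - (u q ^ 2 + u q * u p + u p ^ 2) / 6) = 0 := by linarith
    linarith [(mul_eq_zero.1 this).resolve_left hd.ne']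
  have hroot : 0 < 2 * u q + u p := by
    have h1 : C - u q ^ 2 / 2 = (u p - u q) * (2 * u q + u p) / 6 := by rw [hC]; ring
    have h2 : 0 < (u p - u q) * (2 * u q + u p) := by linarith [hsign.2]
    exact pos_of_mul_pos_right h2 hd.le
  refine hc.false_of_lt hmin hmax hsign.2 ?_ fun z h1 h2 => ?_
  · have : -(C - u p ^ 2 / 2) - (C - u q ^ 2 / 2) = (u p - u q) ^ 2 / 6 := by rw [hC]; ring
    have : 0 < (u p - u q) ^ 2 := by positivity
    linarith
  · have : g.gradSq u z = (u z - u q) * (u p - u z) * (u z + u q + u p) / 3 := by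
      rw [hD]
      have : D = u q ^ 3 / 3 - 2 * C * u q := by linarith
      rw [this, hC]; ring
    rw [this]
    have h3 : 0 < u z - u q := sub_pos.2 h1
    have h4 : 0 < u p - u z := sub_pos.2 h2
    have h5 : 0 < u z + u q + u p := by linarith
    positivity

/-- A function on a closed surface with a metric of any signature, whose Hessian is `(C - u² / 2) g`,
is constant: otherwise the metric is definite at a maximum. -/
theorem BilinField.HessianEq.eq_of_compact [T2Space M] [CompactSpace M] [ConnectedSpace M]
    (hg : g.IsPseudoRiemannian 3) (hu : ContMDiff 𝓘(ℝ, Plane) 𝓘(ℝ, ℝ) 4 u) {C : ℝ}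
    (h : g.HessianEq u fun y => C - u y ^ 2 / 2) (y y' : M) : u y = u y' := by
  obtain ⟨p, -, hp⟩ := isCompact_univ.exists_isMaxOn univ_nonempty hu.continuous.continuousOn
  have hmax : ∀ y, u y ≤ u p := fun y => hp (mem_univ y)
  have he := chart_mem_atlas Plane p
  have hpe := mem_chart_source Plane p
  have hle := h.mul_nonpos_of_isMax hu hmax
  have hx : chartAt Plane p p ∈ ((chartAt Plane p).extend 𝓘(ℝ, Plane)).target := by
    rw [extend_target_eq]; exact (chartAt Plane p).map_source hpe
  have hxp : ((chartAt Plane p).extend 𝓘(ℝ, Plane)).symm (chartAt Plane p p) = p := by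
    rw [extend_symm_eq, (chartAt Plane p).left_inv hpe]
  have hg' : (g.scale fun _ => -1).IsPseudoRiemannian 3 := hg.scale contMDiff_const (by norm_num)
  have hG := hg.isMetricOn he isOpen_univ
  have hG' := hg'.isMetricOn he isOpen_univ
  rw [chartDom_univ] at hG hG'
  rcases lt_trichotomy (C - u p ^ 2 / 2) 0 with hC | hC | hC
  · refine IsConcircular.eq_of_compact (C := C) ⟨hg, ?_, hu, h⟩ y y'
    refine fun y X => hg.pos_of_pos ((BilinField.inChart_pos_iff he hx hxp).1 fun X hX => ?_) y X
    refine pos_of_nonneg (hG.symm _ hx) (hG.nondegenerate _ hx) (fun X => ?_) hX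
    exact nonneg_of_mul_nonpos_right (hle X) hC
  · have := h.eq_of_critical hg hu
      (IsConcircular.fderiv_chart_eq_zero_of_isMaxOn hmax (congrArg u (extend_symm_chartAt p)))
      (by linarith)
    rw [this y, this y']
  · refine neg_injective (IsConcircular.eq_of_compact (g := g.scale fun _ => -1) (C := C)
      (u := fun y => -u y) ⟨hg', ?_, contDiff_neg.contMDiff.comp hu, ?_⟩ y y')
    · refine fun y X => hg'.pos_of_pos
        ((BilinField.inChart_pos_iff he hx hxp).1 fun X hX => ?_) y X
      refine pos_of_nonneg (hG'.symm _ hx) (hG'.nondegenerate _ hx) (fun X => ?_) hX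
      rw [BilinField.inChart_scale, smul_apply, smul_apply, smul_eq_mul]
      have := nonpos_of_mul_nonpos_right (hle X) hC
      linarith
    · exact (h.neg hg).congr fun y => by ring

end

/-! ### Locally extremal metrics -/

noncomputable section

open Filter Topology

open LocalGeometry

variable {M : Type*} [TopologicalSpace M] [ChartedSpace Plane M] [IsManifold 𝓘(ℝ, Plane) 4 M]
  {g : BilinField 𝓘(ℝ, Plane) M}

/-- Every point has a neighbourhood on which the Ricci tensor is `K g` with a function `K` the
Hessian of which is `(C - K² / 2) g` with a constant `C`. -/
def IsLocallyExtremal (g : BilinField 𝓘(ℝ, Plane) M) : Prop :=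
  ∀ y : M, ∃ U : Set M, IsOpen U ∧ y ∈ U ∧ ∃ (K : M → ℝ) (C : ℝ),
    ContMDiffOn 𝓘(ℝ, Plane) 𝓘(ℝ, ℝ) 4 K U ∧ RicciHessEqOn g K K (fun y => C - K y ^ 2 / 2) U

/-- The local curvature functions and constants of a locally extremal metric fit together. -/
theorem IsLocallyExtremal.exists_ricciEq [ConnectedSpace M] (hL : IsLocallyExtremal g)
    (hg : g.IsPseudoRiemannian 3) : ∃ (K : M → ℝ) (C : ℝ), ContMDiff 𝓘(ℝ, Plane) 𝓘(ℝ, ℝ) 4 K ∧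
      g.RicciEq K ∧ g.HessianEq K fun y => C - K y ^ 2 / 2 := by
  choose U hU hmem K C hK hRH using hL
  -- on overlaps the curvature functions agree, since the metric has no zeros
  have hKeq : ∀ y z w, w ∈ U y → w ∈ U z → K y w = K z w := by
    intro y z w hy hz
    have he := chart_mem_atlas Plane w
    have hx := chartAt_mem_chartDom (E := Plane) hy
    have hx' := chartAt_mem_chartDom (E := Plane) hz
    obtain ⟨X, Y, hXY⟩ := hg.exists_inChart_ne_zero he hx.1
    have h1 := (hRH y _ he _ hx X Y).1
    have h2 := (hRH z _ he _ hx' X Y).1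
    rw [extend_symm_chartAt] at h1 h2
    exact mul_right_cancel₀ hXY (h1.symm.trans h2)
  have hCeq : ∀ y z w, w ∈ U y → w ∈ U z → C y = C z := by
    intro y z w hy hz
    have he := chart_mem_atlas Plane w
    have hx := chartAt_mem_chartDom (E := Plane) hy
    have hx' := chartAt_mem_chartDom (E := Plane) hz
    obtain ⟨X, Y, hXY⟩ := hg.exists_inChart_ne_zero he hx.1
    have h1 := (hRH y _ he _ hx X Y).2
    have h2 := (hRH z _ he _ hx' X Y).2
    have hev : K y ∘ ((chartAt Plane w).extend 𝓘(ℝ, Plane)).symm =ᶠ[𝓝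
        ((chartAt Plane w).extend 𝓘(ℝ, Plane) w)]
        K z ∘ ((chartAt Plane w).extend 𝓘(ℝ, Plane)).symm := by
      filter_upwards [(isOpen_chartDom _ (hU y)).mem_nhds hx,
        (isOpen_chartDom _ (hU z)).mem_nhds hx'] with x h3 h4
      exact hKeq y z _ h3.2 h4.2
    rw [hessian_congr hev] at h1
    rw [extend_symm_chartAt] at h1 h2
    have h3 := mul_right_cancel₀ hXY (h1.symm.trans h2)
    have h4 := hKeq y z w hy hz
    beta_reduce at h3
    rw [h4] at h3
    linarith
  have hCloc : IsLocallyConstant C := by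
    refine (IsLocallyConstant.iff_eventually_eq C).2 fun y => ?_
    filter_upwards [(hU y).mem_nhds (hmem y)] with z hz
    exact hCeq z y z (hmem z) hz
  obtain ⟨y₀⟩ := (inferInstance : Nonempty M)
  have hev : ∀ y, ∀ z ∈ U y, K z z = K y z := fun y z hz => hKeq z y z (hmem z) hz
  refine ⟨fun y => K y y, C y₀, fun y => ?_, fun e he x hx _ X Y => ?_, fun e he x hx X Y => ?_⟩
  · refine ((hK y).contMDiffAt ((hU y).mem_nhds (hmem y))).congr_of_eventuallyEq ?_
    filter_upwards [(hU y).mem_nhds (hmem y)] with z hz using hev y z hz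
  · exact (hRH _ e he x ⟨hx, hmem _⟩ X Y).1
  · have hxd : x ∈ chartDom e (U ((e.extend 𝓘(ℝ, Plane)).symm x)) := ⟨hx, hmem _⟩
    have h1 := (hRH _ e he x hxd X Y).2
    rw [hCloc.apply_eq_of_isPreconnected isPreconnected_univ
      (mem_univ ((e.extend 𝓘(ℝ, Plane)).symm x)) (mem_univ y₀)] at h1
    rw [← h1]
    refine congrFun (congrArg _ (congrFun (congrArg _ (hessian_congr ?_)) X)) Y
    filter_upwards [(isOpen_chartDom _ (hU _)).mem_nhds hxd] with z hz
    exact hev _ _ hz.2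

theorem IsLocallyExtremal.exists_ricciEq_const [T2Space M] [CompactSpace M] [ConnectedSpace M]
    (hL : IsLocallyExtremal g) (hg : g.IsPseudoRiemannian 3) :
    ∃ κ : ℝ, g.RicciEq fun _ => κ := by
  obtain ⟨K, C, hK, hR, hH⟩ := hL.exists_ricciEq hg
  obtain ⟨y₀⟩ := (inferInstance : Nonempty M)
  exact ⟨K y₀, hR.congr fun y => hH.eq_of_compact hg hK y y₀⟩

theorem RicciHessEqOn.of_affine {a K α : M → ℝ} {U : Set M} (hU : IsOpen U)
    (ha : ContMDiffOn 𝓘(ℝ, Plane) 𝓘(ℝ, ℝ) 4 a U) (h : RicciHessEqOn g a K α U) {s t c : ℝ}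
    (hK : ∀ y ∈ U, K y = s * a y + t ∧ 2 * α y = -s * a y ^ 2 - 2 * t * a y + c) :
    ∃ (K : M → ℝ) (C : ℝ), ContMDiffOn 𝓘(ℝ, Plane) 𝓘(ℝ, ℝ) 4 K U ∧
      RicciHessEqOn g K K (fun y => C - K y ^ 2 / 2) U := by
  refine ⟨fun y => s * a y + t, (t ^ 2 + s * c) / 2, ?_, fun e he x hx X Y => ⟨?_, ?_⟩⟩
  · have h1 : ContDiff ℝ 4 fun r : ℝ => s * r + t := by fun_prop
    exact h1.contMDiff.comp_contMDiffOn ha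
  · rw [(h e he x hx X Y).1, (hK _ hx.2).1]
  · have h1 := (ha.contDiffOn_chart le_rfl he).contDiffAt
      ((isOpen_chartDom e hU).mem_nhds hx)
    have h2 := hessian_affine (g.inChart e) (h1.of_le (m := 2) (by norm_num)) s t
    refine (congrFun (congrArg _ (congrFun (congrArg _ h2) X)) Y).trans ?_
    rw [smul_apply, smul_apply, smul_eq_mul, (h e he x hx X Y).2]
    have h3 := (hK _ hx.2).2
    linear_combination (s / 2 * g.inChart e x X Y) * h3

variable {N : Type*} [TopologicalSpace N] [ChartedSpace Plane N] [IsManifold 𝓘(ℝ, Plane) 4 N]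
  {h : BilinField 𝓘(ℝ, Plane) N}

/-- Both factors of a product of surfaces which is locally conformally Einstein, with factors that
depend on both variables, are locally extremal. -/
theorem BilinField.IsLocallyConformallyEinsteinProd.isLocallyExtremal [Nonempty M] [Nonempty N]
    (hg : g.IsPseudoRiemannian 3) (hh : h.IsPseudoRiemannian 3)
    (hE : BilinField.IsLocallyConformallyEinsteinProd 4 g h) :
    IsLocallyExtremal g ∧ IsLocallyExtremal h := by
  have key : ∀ (y : M) (x : N), ∃ (U : Set M) (V : Set N), IsOpen U ∧ IsOpen V ∧ y ∈ U ∧ x ∈ V ∧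
      (∃ (K : M → ℝ) (C : ℝ), ContMDiffOn 𝓘(ℝ, Plane) 𝓘(ℝ, ℝ) 4 K U ∧
        RicciHessEqOn g K K (fun y => C - K y ^ 2 / 2) U) ∧
      ∃ (K : N → ℝ) (C : ℝ), ContMDiffOn 𝓘(ℝ, Plane) 𝓘(ℝ, ℝ) 4 K V ∧
        RicciHessEqOn h K K (fun y => C - K y ^ 2 / 2) V := by
    intro y x
    have hfin : Module.finrank ℝ Plane = 2 := finrank_euclideanSpace_fin
    obtain ⟨U, V, hU, hV, hUc, hVc, hy, hx, f, hf, hf0, ⟨y₁, hy₁, y₂, hy₂, x₁, hx₁, hne₁⟩,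
      ⟨y₃, hy₃, x₂, hx₂, x₃, hx₃, hne₂⟩, hEin⟩ := hE (y, x)
    obtain ⟨a, b, lam, ha, hb, hab, hS⟩ := hEin.exists_isSplitEinstein hg hh
      (by rw [hfin]; norm_num) hU hV hUc hVc hf hf0
    obtain ⟨K, α, L, β, s, t, t', c, hK, hL, hKa, hLb, -, -, hsum⟩ := hS.exists_structure
      (by rw [hfin]; norm_num) hg hh hU hV hUc.isPreconnected hVc.isPreconnected ha hb
      (fun y hy x hx => by rw [← hab y hy x hx]; exact hf0 (y, x) ⟨hy, hx⟩)
      ⟨y₁, hy₁, y₂, hy₂, fun h => hne₁ (by rw [hab _ hy₁ _ hx₁, hab _ hy₂ _ hx₁, h])⟩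
      ⟨x₂, hx₂, x₃, hx₃, fun h => hne₂ (by rw [hab _ hy₃ _ hx₂, hab _ hy₃ _ hx₃, h])⟩
      (n := 2) (m := 2) (D := 2) (by rw [hfin]; norm_num) (by rw [hfin]; norm_num) (by norm_num)
    have ht' : t' = -t := by linarith
    subst ht'
    refine ⟨U, V, hU, hV, hy, hx, hK.of_affine (s := s) (t := t) (c := c) hU ha
      fun z hz => ⟨(hKa z hz).1, by rw [(hKa z hz).2]; ring⟩,
      hL.of_affine (s := s) (t := -t) (c := c) hV hb
      fun z hz => ⟨(hLb z hz).1, by rw [(hLb z hz).2]; ring⟩⟩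
  constructor
  · intro y
    obtain ⟨x⟩ := (inferInstance : Nonempty N)
    obtain ⟨U, V, hU, -, hy, -, h1, -⟩ := key y x
    exact ⟨U, hU, hy, h1⟩
  · intro x
    obtain ⟨y⟩ := (inferInstance : Nonempty M)
    obtain ⟨U, V, -, hV, -, hx, -, h2⟩ := key y x
    exact ⟨V, hV, hx, h2⟩

end

theorem mainTheorem1 (n m : ℕ) (hn : 1 ≤ n) (hm : 1 ≤ m) (hnm : 3 ≤ n + m)
    (M : Type*) [TopologicalSpace M] [T2Space M] [SecondCountableTopology M] [ConnectedSpace M]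
    [ChartedSpace (EuclideanSpace ℝ (Fin n)) M] [IsManifold (𝓡 n) 4 M]
    (N : Type*) [TopologicalSpace N] [T2Space N] [SecondCountableTopology N] [ConnectedSpace N]
    [ChartedSpace (EuclideanSpace ℝ (Fin m)) N] [IsManifold (𝓡 m) 4 N] :
    -- the classification
    (∀ (g : BilinField (𝓡 n) M) (h : BilinField (𝓡 m) N) (f : M × N → ℝ),
      g.IsPseudoRiemannian 3 → h.IsPseudoRiemannian 3 →
      ContMDiff ((𝓡 n).prod (𝓡 m)) 𝓘(ℝ, ℝ) 4 f → (∀ p, f p ≠ 0) → (¬ ∃ t, ∀ p, f p = t) →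
      (BilinField.conformalProd f g h).IsEinstein →
      -- (1) a warped product with Einstein fibre
      ((∃ φ : M → ℝ, (∀ y x, f (y, x) = φ y) ∧
          BilinField.conformalProd f g h =
            BilinField.warpedProdFst (g.scale fun y => (φ y ^ 2)⁻¹) (fun y => (φ y)⁻¹) h ∧
          h.IsEinstein) ∨
        (∃ ψ : N → ℝ, (∀ y x, f (y, x) = ψ x) ∧
          BilinField.conformalProd f g h =
            BilinField.warpedProdSnd g (fun x => (ψ x)⁻¹) (h.scale fun x => (ψ x ^ 2)⁻¹) ∧
          g.IsEinstein)) ∨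
      -- (2) a sum of two non-constant functions
      (∃ (a : M → ℝ) (b : N → ℝ) (k : M → ℝ) (l : N → ℝ),
        ContMDiff (𝓡 n) 𝓘(ℝ, ℝ) 4 a ∧ ContMDiff (𝓡 m) 𝓘(ℝ, ℝ) 4 b ∧
        (¬ ∃ t, ∀ y, a y = t) ∧ (¬ ∃ t, ∀ x, b x = t) ∧
        (∀ y x, f (y, x) = a y + b x) ∧
        g.RicciEq (fun y => ((n : ℝ) - 1) * k y) ∧ h.RicciEq (fun x => ((m : ℝ) - 1) * l x) ∧
        g.HessianEq a (fun y => g.laplacian a y / n) ∧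
        h.HessianEq b (fun x => h.laplacian b x / m) ∧
        (¬ (n = 2 ∧ m = 2) → ∃ κ c : ℝ, (∀ y, k y = κ) ∧ (∀ x, l x = -κ) ∧
          g.HessianEq a (fun y => -k y * a y + c) ∧ h.HessianEq b (fun x => -l x * b x + c)) ∧
        (n = 2 ∧ m = 2 →
          (∃ κ : ℝ, (∀ y, k y = κ) ∧ (∀ x, l x = -κ)) ∨
          ((¬ ∃ t, ∀ y, k y = t) ∧ (¬ ∃ t, ∀ x, l x = t) ∧
            ContMDiff (𝓡 n) 𝓘(ℝ, ℝ) 2 k ∧ ContMDiff (𝓡 m) 𝓘(ℝ, ℝ) 2 l ∧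
            g.HessianEq k (fun y => g.laplacian k y / 2) ∧
            h.HessianEq l (fun x => h.laplacian l x / 2))))) ∧
    -- converse of (1): warped products are conformal to products
    (∀ (g : BilinField (𝓡 n) M) (h : BilinField (𝓡 m) N),
      g.IsPseudoRiemannian 3 → h.IsPseudoRiemannian 3 →
      (∀ φ : M → ℝ, ContMDiff (𝓡 n) 𝓘(ℝ, ℝ) 4 φ → (∀ y, 0 < φ y) →
        ∃ (g' : BilinField (𝓡 n) M) (f : M → ℝ), g'.IsPseudoRiemannian 3 ∧
          ContMDiff (𝓡 n) 𝓘(ℝ, ℝ) 4 f ∧ (∀ y, 0 < f y) ∧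
          BilinField.warpedProdFst g φ h = BilinField.conformalProd (fun p => f p.1) g' h) ∧
      (∀ ψ : N → ℝ, ContMDiff (𝓡 m) 𝓘(ℝ, ℝ) 4 ψ → (∀ x, 0 < ψ x) →
        ∃ (h' : BilinField (𝓡 m) N) (f : N → ℝ), h'.IsPseudoRiemannian 3 ∧
          ContMDiff (𝓡 m) 𝓘(ℝ, ℝ) 4 f ∧ (∀ x, 0 < f x) ∧
          BilinField.warpedProdSnd g ψ h = BilinField.conformalProd (fun p => f p.2) g h')) ∧
    -- converse of (2)
    (∀ (g : BilinField (𝓡 n) M) (h : BilinField (𝓡 m) N) (a : M → ℝ) (b : N → ℝ) (κ c : ℝ),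
      g.IsPseudoRiemannian 3 → h.IsPseudoRiemannian 3 →
      ContMDiff (𝓡 n) 𝓘(ℝ, ℝ) 4 a → ContMDiff (𝓡 m) 𝓘(ℝ, ℝ) 4 b →
      g.RicciEq (fun _ => ((n : ℝ) - 1) * κ) → h.RicciEq (fun _ => ((m : ℝ) - 1) * (-κ)) →
      g.HessianEq a (fun y => -κ * a y + c) → h.HessianEq b (fun x => -(-κ) * b x + c) →
      (∀ y x, a y + b x ≠ 0) →
      (BilinField.conformalProd (fun p => a p.1 + b p.2) g h).IsPseudoRiemannian 3 ∧
      (BilinField.conformalProd (fun p => a p.1 + b p.2) g h).IsEinstein) ∧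
    -- surfaces: examples of non-constant curvature exist
    (∃ (g h : BilinField (𝓡 2) (EuclideanSpace ℝ (Fin 2)))
      (f : EuclideanSpace ℝ (Fin 2) × EuclideanSpace ℝ (Fin 2) → ℝ)
      (k l : EuclideanSpace ℝ (Fin 2) → ℝ),
      g.IsPseudoRiemannian ∞ ∧ h.IsPseudoRiemannian ∞ ∧
      ContMDiff ((𝓡 2).prod (𝓡 2)) 𝓘(ℝ, ℝ) ∞ f ∧ (∀ p, f p ≠ 0) ∧
      g.RicciEq k ∧ h.RicciEq l ∧ (¬ ∃ t, ∀ y, k y = t) ∧ (¬ ∃ t, ∀ x, l x = t) ∧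
      (BilinField.conformalProd f g h).IsEinstein) ∧
    -- surfaces: no compact example of non-constant curvature, not even locally conformally
    (n = 2 → m = 2 → CompactSpace M → CompactSpace N →
      ∀ (g : BilinField (𝓡 n) M) (h : BilinField (𝓡 m) N),
        g.IsPseudoRiemannian 3 → h.IsPseudoRiemannian 3 →
        BilinField.IsLocallyConformallyEinsteinProd 4 g h →
        ∃ κ κ' : ℝ, g.RicciEq (fun _ => κ) ∧ h.RicciEq (fun _ => κ')) := by
  have hnE : Module.finrank ℝ (EuclideanSpace ℝ (Fin n)) = n := finrank_euclideanSpace_fin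
  have hmE : Module.finrank ℝ (EuclideanSpace ℝ (Fin m)) = m := finrank_euclideanSpace_fin
  refine ⟨fun g h f hg hh hf h0 hfc hE => ?_, fun g h hg hh => ⟨fun φ hφ hφ0 => ?_,
    fun ψ hψ hψ0 => ?_⟩, fun g h a b κ c hg hh ha hb hK hL hα hβ h0 => ⟨?_, ?_⟩,
    NonConstantCurvature.exists_einstein, fun hn2 hm2 _ _ g h hg hh hE => ?_⟩
  · exact einstein_conformalProd_classification hn hm hnm hnE hmE hg hh hf h0 hE
  · exact hg.exists_warpedProdFst_eq hφ hφ0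
  · exact hh.exists_warpedProdSnd_eq hψ hψ0
  · exact hg.conformalProd hh ((ha.comp contMDiff_fst).add (hb.comp contMDiff_snd))
      fun p => h0 p.1 p.2
  · exact BilinField.isEinstein_conformalProd_of_constant hg hh (by rw [hnE]) (by rw [hmE]) ha hb
      hK hL hα hβ h0
  · subst hn2 hm2
    obtain ⟨h1, h2⟩ := hE.isLocallyExtremal hg hh
    obtain ⟨κ, hκ⟩ := h1.exists_ricciEq_const hg
    obtain ⟨κ', hκ'⟩ := h2.exists_ricciEq_const hh
    exact ⟨κ, κ', hκ, hκ'⟩
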